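/- There is an absolute constant $C>0$ such that the following holds for every $n$. Let $s_1<\dots<s_n$ be servers on the real line with pairwise distances at least $1$, and let $r_1,\dots,r_n$ be a sequence of requests, each of which arrives at the location of some server (the sequence is fixed in advance, i.e. the adversary is oblivious). Then the randomized algorithm Modified Doubled Harmonic (MDH) described below always assigns the requests to distinct servers, and its expected total cost satisfies $$\mathbb E\Big[\sum_{t=1}^n |r_t-s_{\sigma(t)}|\Big]\le C\,\log n\cdot \mathrm{OPT}(r_1,\dots,r_n),$$ where $s_{\sigma(t)}$ is the server to which MDH assigns $r_t$ and $\mathrm{OPT}$ of a sequence of requests is the minimum cost of matching these requests to distinct servers. That is, MDH is $O(\log n)$-competitive for online min-cost matching on the line. **Pseudo-distance.** For an estimate $Z>0$, the pseudo-distance $pd$ of adjacent servers at distance $\delta$ is $\infty$ if $\delta\ge Z$, is $Z/n^2$ if $\delta\le Z/n^2$, and is $\delta$ otherwise; for arbitrary servers it is the sum over the adjacent pairs between them. **Imaginary move.** Given a set $S_\iota$ of servers, a request at $x$ selects the server of $S_\iota$ at $x$ if there is one; otherwise, if $S_\iota$ has servers on only one side of $x$, the first of them on that side; otherwise, if $a,b$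 are the first servers of $S_\iota$ to the left and right of $x$, it selects $a$ with probability $pd(x,b)/(pd(x,a)+pd(x,b))$ and $b$ with probability $pd(x,a)/(pd(x,a)+pd(x,b))$ (an infinitely distant side is chosen with probability $0$ if the other is at finite pseudo-distance). **MDH.** It maintains the set $S_\rho$ of available servers, a set $S_\iota$ of imaginary servers, both initially equal to the set of all servers, and an estimate $Z$, initially $1$. A request that arrives at $x$ at time $t$ is *triggering* if $\mathrm{OPT}(r_1,\dots,r_{t-1},x)\ge Z$; then $x$ is a *trigger point*. Fix a minimum-cost matching $M$ between $S_\iota$ and $S_\rho$. A point $x$ is in a *left island* if $M$ matches some $\iota\in S_\iota$ to some $\rho\in S_\rho$ with $\rho\le x\le\iota$, $\rho<\iota$, and in a *right island* if $M$ matches some $\iota\in S_\iota$ to some $\rho\in S_\rho$ with $\iota\le x\le\rho$, $\iota<\rho$. *Assignment.* If there is an available server at $x$, the request is assigned to it; otherwise, if all available servers are on one side of $x$, it is assigned to the nearest one. Otherwise let $a,b$ be the first available servers to the left and right of $x$. - If the request is not triggering, it is assigned to $a$ if $x$ is in a left island, to $b$ if $x$ is in a right island, and otherwise to the one of $a,b$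 that lies in the direction of its imaginary move. - If it is triggering, let $y_\ell$ (resp. $y_r$) be the first server location reached when moving left (resp. right) from $x$ that is not a trigger point or is the location of $a$ (resp. $b$), and let $p_\ell,p_r$ be the probabilities with which a request arriving now at $y_\ell,y_r$ would be assigned to $b$. The request is assigned as one arriving at $y_r$ if $p_r<\frac12$; else as one arriving at $y_\ell$ if $p_\ell>\frac12$; else as one arriving at $y_\ell$ if $x<\frac{a+b}2$; else as one arriving at $y_r$. *Update.* The server used leaves $S_\rho$. After a non-triggering request, the server selected by its imaginary move leaves $S_\iota$. After a triggering request, $Z$ becomes the least power $10^j$ with $\mathrm{OPT}(r_1,\dots,r_t)<10^j$, and $S_\iota$ is recomputed (with fresh randomness): starting from all servers, the requests $r_1,\dots,r_t$ make imaginary moves one after the other with this $Z$, each selected server being removed. -/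

import Mathlib

open scoped ENNReal

/-! Online minimum-cost matching on the line.  The `n` servers are named in increasing order of
their location: server `i : Fin n` is at `s i`.  Every request arrives at the location of a server,
so a request is also an element of `Fin n`. -/

namespace LineMatching

noncomputable section

variable {n : ℕ}

/-- Optimal (offline) cost of matching the requests of the list `R` to distinct servers. -/
def optCost (s : Fin n → ℝ) (R : List (Fin n)) : ℝ :=
  ⨅ f : Fin R.length ↪ Fin n, ∑ k, |s (R.get k) - s (f k)|

/-- Pseudo-distance between the adjacent servers `k` and `k + 1`, for the estimate `Z`. -/
def adjPseudoDist (s : Fin n → ℝ) (Z : ℝ) (k : Fin n) : ℝ≥0∞ :=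
  if h : (k : ℕ) + 1 < n then
    if Z ≤ s ⟨k + 1, h⟩ - s k then ⊤
    else if s ⟨k + 1, h⟩ - s k ≤ Z / (n : ℝ) ^ 2 then ENNReal.ofReal (Z / (n : ℝ) ^ 2)
    else ENNReal.ofReal (s ⟨k + 1, h⟩ - s k)
  else 0

/-- Pseudo-distance between two arbitrary servers. -/
def pseudoDist (s : Fin n → ℝ) (Z : ℝ) (i j : Fin n) : ℝ≥0∞ :=
  ∑ k ∈ Finset.Ico (min i j) (max i j), adjPseudoDist s Z k

/-- The probability `pd(x,a) / (pd(x,a) + pd(x,b))` with which a point `x` strictly between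
`a` and `b` moves right, to `b`, instead of left, to `a`.  A side at infinite pseudo-distance is
never chosen if the other one is at finite pseudo-distance. -/
def rightProb (s : Fin n → ℝ) (Z : ℝ) (a x b : Fin n) : ℝ≥0∞ :=
  if pseudoDist s Z x b = ⊤ then 0
  else if pseudoDist s Z x a = ⊤ then 1
  else pseudoDist s Z x a / (pseudoDist s Z x a + pseudoDist s Z x b)

/-- The distribution that gives `b` with probability `p` and `a` with probability `1 - p`
(for `p ≤ 1`). -/
def coin {α : Type*} (p : ℝ≥0∞) (a b : α) : PMF α :=
  (PMF.ofFintype (fun c : Bool => if c then min p 1 else 1 - min p 1) (by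
    simp [add_tsub_cancel_of_le (min_le_right p 1)])).map (fun c : Bool => if c then b else a)

/-- The first server of `A` strictly to the left of `x`, if there is one. -/
def leftNbr (A : Finset (Fin n)) (x : Fin n) : Option (Fin n) :=
  if h : (A.filter (· < x)).Nonempty then some ((A.filter (· < x)).max' h) else none

/-- The first server of `A` strictly to the right of `x`, if there is one. -/
def rightNbr (A : Finset (Fin n)) (x : Fin n) : Option (Fin n) :=
  if h : (A.filter (x < ·)).Nonempty then some ((A.filter (x < ·)).min' h) else none

/-- The law of the imaginary server to which a request at `x` makes its imaginary move in Doubled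
Harmonic, when `I` is the set of imaginary servers and `Z` the estimate.  (The value for an empty
`I` is immaterial.) -/
def imagMove (s : Fin n → ℝ) (Z : ℝ) (I : Finset (Fin n)) (x : Fin n) : PMF (Fin n) :=
  if x ∈ I then PMF.pure x
  else
    match leftNbr I x, rightNbr I x with
    | none, none => PMF.pure x
    | none, some b => PMF.pure b
    | some a, none => PMF.pure a
    | some a, some b => coin (rightProb s Z a x b) a b

/-- The law of the set of imaginary servers that remain when Doubled Harmonic, with the fixed
estimate `Z`, makes the imaginary moves of the requests of a list, starting from the set `I`. -/
def simulate (s : Fin n → ℝ) (Z : ℝ) : Finset (Fin n) → List (Fin n) → PMF (Finset (Fin n))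
  | I, [] => PMF.pure I
  | I, x :: R => (imagMove s Z I x).bind fun g => simulate s Z (I.erase g) R

/-- `M` is an optimal matching between the set `I` of imaginary servers and the set `A` of
available servers. -/
def IsOptMatching (s : Fin n → ℝ) (I A : Finset (Fin n)) (M : Fin n → Fin n) : Prop :=
  Set.BijOn M (I : Set (Fin n)) (A : Set (Fin n)) ∧
    ∀ M' : Fin n → Fin n, Set.BijOn M' (I : Set (Fin n)) (A : Set (Fin n)) →
      ∑ j ∈ I, |s j - s (M j)| ≤ ∑ j ∈ I, |s j - s (M' j)|

/-- `x` is in a left island: an optimal matching matches an imaginary server to the right of `x`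
to an available server to the left of `x`.  Islands contain their end points. -/
def InLeftIsland (s : Fin n → ℝ) (I A : Finset (Fin n)) (x : Fin n) : Prop :=
  ∃ M, IsOptMatching s I A M ∧ ∃ j ∈ I, M j ≤ x ∧ x ≤ j ∧ M j < j

/-- `x` is in a right island: an optimal matching matches an imaginary server to the left of `x`
to an available server to the right of `x`.  Islands contain their end points. -/
def InRightIsland (s : Fin n → ℝ) (I A : Finset (Fin n)) (x : Fin n) : Prop :=
  ∃ M, IsOptMatching s I A M ∧ ∃ j ∈ I, j ≤ x ∧ x ≤ M j ∧ j < M j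

/-- State of Modified Doubled Harmonic: the requests so far, in order of arrival, the exponent of
the estimate `Z = 10 ^ expo`, the imaginary servers, and the available servers. -/
structure State (n : ℕ) where
  hist : List (Fin n)
  expo : ℕ
  imag : Finset (Fin n)
  avail : Finset (Fin n)

/-- The estimate of the optimal cost. -/
def State.est (q : State n) : ℝ := 10 ^ q.expo

/-- Before the first request all servers are available (and imaginary), and the estimate has its
default value `1`. -/
def initState (n : ℕ) : State n := ⟨[], 0, Finset.univ, Finset.univ⟩

/-- A request that arrives now at `x` is triggering. -/
def State.IsTrigger (s : Fin n → ℝ) (q : State n) (x : Fin n) : Prop :=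
  q.est ≤ optCost s (q.hist ++ [x])

open Classical in
/-- The server to which a non-triggering request at `x` is assigned, when its imaginary move goes
to `g`.  In a stationary island the request goes to the first available server in the direction of
`g`, hence to the right with the probability that `rightProb` gives for the first imaginary
servers to the left and right of `x`.  (The value for no available servers is immaterial.) -/
def State.correct (s : Fin n → ℝ) (q : State n) (x g : Fin n) : Fin n :=
  if x ∈ q.avail then x
  else
    match leftNbr q.avail x, rightNbr q.avail x with
    | none, none => x
    | none, some b => b
    | some a, none => a
    | some a, some b =>
      if InLeftIsland s q.imag q.avail x then a
      else if InRightIsland s q.imag q.avail x then b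
      else if g < x then a else b

/-- The law of the server to which a request is assigned if it arrives at `x`, where `x` is a
non-trigger point or the location of an available server. -/
def State.assign (s : Fin n → ℝ) (q : State n) (x : Fin n) : PMF (Fin n) :=
  (imagMove s q.est q.imag x).map fun g => q.correct s x g

open Classical in
/-- Moving left from `x`, the first server location that is a non-trigger point or is `a`, for an
available server `a` to the left of `x`. -/
def State.yLeft (s : Fin n → ℝ) (q : State n) (a x : Fin n) : Fin n :=
  (leftNbr (Finset.univ.filter fun y => a ≤ y ∧ (y = a ∨ ¬ q.IsTrigger s y)) x).getD a

open Classical in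
/-- Moving right from `x`, the first server location that is a non-trigger point or is `b`, for an
available server `b` to the right of `x`. -/
def State.yRight (s : Fin n → ℝ) (q : State n) (b x : Fin n) : Fin n :=
  (rightNbr (Finset.univ.filter fun y => y ≤ b ∧ (y = b ∨ ¬ q.IsTrigger s y)) x).getD b

/-- The law of the server to which a triggering request at `x` is assigned.  Between the available
servers `a` and `b`, it mimics a request at `yLeft` or one at `yRight`, depending on the
probabilities with which these would be assigned to the right, to `b`. -/
def State.trigAssign (s : Fin n → ℝ) (q : State n) (x : Fin n) : PMF (Fin n) :=
  if x ∈ q.avail then PMF.pure x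
  else
    match leftNbr q.avail x, rightNbr q.avail x with
    | none, none => PMF.pure x
    | none, some b => PMF.pure b
    | some a, none => PMF.pure a
    | some a, some b =>
      if q.assign s (q.yRight s b x) b < 1 / 2 then q.assign s (q.yRight s b x)
      else if 1 / 2 < q.assign s (q.yLeft s a x) b then q.assign s (q.yLeft s a x)
      else if s x < (s a + s b) / 2 then q.assign s (q.yLeft s a x)
      else q.assign s (q.yRight s b x)

open Classical in
/-- Modified Doubled Harmonic serves a request at `x`: the law of the new state and of the server
used.  A non-triggering request removes the goal of its imaginary move from the imaginary servers.
After a triggering request the estimate becomes the least power of ten above the optimal cost, and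
the adjustment operation is performed on all requests so far. -/
def State.step (s : Fin n → ℝ) (q : State n) (x : Fin n) : PMF (State n × Fin n) :=
  if q.IsTrigger s x then
    (q.trigAssign s x).bind fun σ =>
      (simulate s (10 ^ sInf {j : ℕ | optCost s (q.hist ++ [x]) < 10 ^ j})
          Finset.univ (q.hist ++ [x])).map fun I =>
        (⟨q.hist ++ [x], sInf {j : ℕ | optCost s (q.hist ++ [x]) < 10 ^ j}, I,
          q.avail.erase σ⟩, σ)
  else
    (imagMove s q.est q.imag x).map fun g =>
      (⟨q.hist ++ [x], q.expo, q.imag.erase g, q.avail.erase (q.correct s x g)⟩,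
        q.correct s x g)

/-- The law of the list of servers to which the successive requests of a list are assigned. -/
def State.run (s : Fin n → ℝ) : State n → List (Fin n) → PMF (List (Fin n))
  | _, [] => PMF.pure []
  | q, x :: R => (q.step s x).bind fun p => (State.run s p.1 R).map fun l => p.2 :: l

/-- The law of the assignment that Modified Doubled Harmonic makes for the requests `R`. -/
def mdh (s : Fin n → ℝ) (R : List (Fin n)) : PMF (List (Fin n)) :=
  (initState n).run s R

/-- Cost of assigning the requests of the list `R` to the servers of the list `l`. -/
def assignCost (s : Fin n → ℝ) (R l : List (Fin n)) : ℝ :=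
  (List.zipWith (fun x y => |s x - s y|) R l).sum

/-- Expected cost of Modified Doubled Harmonic on the requests `R`. -/
def mdhExpCost (s : Fin n → ℝ) (R : List (Fin n)) : ℝ≥0∞ :=
  ∑' l, mdh s R l * ENNReal.ofReal (assignCost s R l)

end

end LineMatching

/-!
Modified Doubled Harmonic is compared to its imaginary moves, and these are compared to an offline
optimum.

*The harmonic algorithm.*  With a fixed estimate `Z`, the imaginary moves are harmonic moves on the
line in which every edge has its pseudo-length and the edges of infinite pseudo-length are cut
(`expect_imagMove_le`).  On such a line, `diffBound` bounds the difference between the expected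
costs of two runs whose sets of servers differ in one server.  If the two runs are coupled, the
discrepancy between them is an interval whose end points move like martingales, and a potential
`phi` of the length of the discrepancy and of the gaps around its end points pays for the moves; the
logarithm of the gaps in `phi` gives the factor `log n`, since pseudo-distances lie between
`Z / n ^ 2` and `n * Z`.  Switching the requests one by one from an optimal matching to the harmonic
algorithm, one gets that the latter is competitive (`harmCost_le`).  Hence, if the optimal cost is
below `Z`, then the expected cost of the imaginary moves is `O(log n * Z)` (`simCost_le`).

*Requests that are not triggering.*  The state of the algorithm is measured by the minimum cost
`gap` of a matching between the imaginary and the available servers.  In a left or right island the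
request goes to the side on which there is a surplus of available servers, and elsewhere it follows
its imaginary move.  In both cases the cost of the request, plus the increase of `gap`, is at most
the length of the imaginary move (`correct_cost_le`).

*Triggering requests.*  One of the two available servers next to the request is no farther than the
optimal cost plus the cost so far (`exists_near_avail`).  The rule for triggering requests makes the
expected cost at most this distance, plus a multiple of `gap` and of the expected cost of imaginary
moves from points that are not trigger points (`expect_trigAssign_le`).  For such a point the
optimal cost is below the current estimate, so that `simCost_le` applies.  It is essential here that
the requests are fixed in advance: the estimates, and therefore the trigger points, are then
deterministic, and the imaginary servers are distributed as in a run with the current estimate from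
the start.

*Amortization.*  Between two triggering requests, the expected value of the cost so far plus `gap`
grows by `O(log n * Z)`.  A triggering request multiplies it by at most four, up to terms of the
order `log n * Z`, and multiplies the estimate `Z` by at least ten.  So the terms form a geometric
sum (`Invariant`), and in the end `Z` is at most ten times the optimal cost.  As long as no request
has been triggering, the optimal cost is below the least distance of two servers, so it is zero, and
then all costs are zero.
-/

open scoped ENNReal

namespace LineMatching

variable {n : ℕ}

/-! ### The potential function -/

/-- The contribution of one end point of a discrepancy of length `D` to the potential.  Here `g` is
the length of the gap around the end point, and `m` stands for the expected displacement of the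
end point when it leaves that gap. -/
noncomputable def phi (Λ g m D : ℝ) : ℝ :=
  14 * D * Real.log (Λ / g) + D / (g + D) * (8 * g + 6 * m)

/-- If servers leave, then the gap around an end point grows, the expected displacement grows by at
most as much, and the potential does not increase. -/
lemma phi_mono {Λ g g' m m' D : ℝ} (hΛ : 0 < Λ) (hg : 0 < g) (hgg : g ≤ g') (hm : 0 ≤ m)
    (hm' : m' ≤ m + (g' - g)) (hD : 0 ≤ D) : phi Λ g' m' D ≤ phi Λ g m D := by
  have hg' : 0 < g' := hg.trans_le hgg
  have hlog : (g' - g) / (g' + D) ≤ Real.log (Λ / g) - Real.log (Λ / g') := by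
    rw [← Real.log_div (by positivity) (by positivity)]
    have h1 : Λ / g / (Λ / g') = g' / g := by field_simp
    rw [h1]
    have h2 := Real.one_sub_inv_le_log_of_pos (show 0 < g' / g by positivity)
    refine le_trans ?_ h2
    have h3 : 1 - (g' / g)⁻¹ = (g' - g) / g' := by field_simp
    rw [h3]
    exact div_le_div_of_nonneg_left (by linarith) hg' (by linarith)
  have e1 : (8 * g' + 6 * m') / (g' + D) - (8 * g + 6 * m) / (g + D)
      ≤ 14 * ((g' - g) / (g' + D)) := by
    have h1 : (8 * g' + 6 * m') / (g' + D) ≤ (8 * g' + 6 * (m + (g' - g))) / (g' + D) := by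
      gcongr
    have h2 : 14 * ((g' - g) / (g' + D)) + (8 * g + 6 * m) / (g + D)
        - (8 * g' + 6 * (m + (g' - g))) / (g' + D)
        = (g' - g) * (8 * g + 6 * m) / ((g + D) * (g' + D)) := by
      field_simp
      ring
    have h3 : 0 ≤ (g' - g) * (8 * g + 6 * m) / ((g + D) * (g' + D)) := by
      have := sub_nonneg.2 hgg
      positivity
    linarith
  have e2 := mul_le_mul_of_nonneg_left e1 hD
  have e3 := mul_le_mul_of_nonneg_left hlog hD
  unfold phi
  have e4 : D / (g' + D) * (8 * g' + 6 * m') = D * ((8 * g' + 6 * m') / (g' + D)) := by ring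
  have e5 : D / (g + D) * (8 * g + 6 * m) = D * ((8 * g + 6 * m) / (g + D)) := by ring
  rw [e4, e5]
  linarith

/-- The potential bounds the distance between the end points. -/
lemma le_phi {Λ g m D : ℝ} (hg : 0 < g) (hΛ : 3 * g ≤ Λ) (hm : 0 ≤ m) (hD : 0 ≤ D) :
    D ≤ phi Λ g m D := by
  have h3 : 3 ≤ Λ / g := by rwa [le_div_iff₀ hg]
  have h4 := Real.one_sub_inv_le_log_of_pos (show 0 < Λ / g by linarith)
  have h5 : (Λ / g)⁻¹ ≤ 1 / 3 := by
    rw [inv_eq_one_div]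
    exact one_div_le_one_div_of_le (by norm_num) h3
  have h6 : 0 ≤ D / (g + D) * (8 * g + 6 * m) := by positivity
  have h7 : D * (2 / 3) ≤ D * Real.log (Λ / g) := mul_le_mul_of_nonneg_left (by linarith) hD
  unfold phi
  linarith

/-- The ratio of the potential to the length of the discrepancy decreases with the length. -/
lemma phi_star {Λ g m D D' : ℝ} (hg : 0 < g) (hm : 0 ≤ m) (hD : 0 < D) (h : D ≤ D') :
    D * phi Λ g m D' ≤ D' * phi Λ g m D := by
  have h1 : (8 * g + 6 * m) / (g + D') ≤ (8 * g + 6 * m) / (g + D) := by gcongr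
  have h2 := mul_le_mul_of_nonneg_left h1 (show 0 ≤ D * D' by nlinarith)
  unfold phi
  linear_combination h2

/-- If no server lies between the two end points, a move of one of them away from the other one
lowers the potential by an amount that pays for the move. -/
lemma phi_star_gain {Λ p D : ℝ} (hp : 0 ≤ p) (hD : 0 < D) :
    D * phi Λ (p + D) 0 (D + p) + 2 * D * p ≤ (D + p) * phi Λ (p + D) 0 D := by
  unfold phi
  have e : (D + p) * (D / (p + D + D) * (8 * (p + D) + 6 * 0))
      - D * ((D + p) / (p + D + (D + p)) * (8 * (p + D) + 6 * 0)) - 2 * D * p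
      = 2 * D * p ^ 2 / (p + D + D) := by
    have : p + D + (D + p) ≠ 0 := by positivity
    have : p + D + D ≠ 0 := by positivity
    field_simp
    ring
  have h : 0 ≤ 2 * D * p ^ 2 / (p + D + D) := by positivity
  nlinarith

/-- The potential is concave in the length of the discrepancy. -/
lemma phi_concave {Λ g m D p q : ℝ} (hg : 0 < g) (hm : 0 ≤ m) (hp : 0 ≤ p) (hq : 0 ≤ q)
    (h : q ≤ D) :
    q * phi Λ g m (D + p) + p * phi Λ g m (D - q) ≤ (p + q) * phi Λ g m D := by
  unfold phi
  have e : (p + q) * (D / (g + D)) - q * ((D + p) / (g + (D + p))) - p * ((D - q) / (g + (D - q)))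
      = g * p * q * (p + q) / ((g + D) * (g + (D + p)) * (g + (D - q))) := by
    have : g + D ≠ 0 := by linarith
    have : g + (D + p) ≠ 0 := by linarith
    have : g + (D - q) ≠ 0 := by linarith
    field_simp
    ring
  have h1 : 0 ≤ g * p * q * (p + q) / ((g + D) * (g + (D + p)) * (g + (D - q))) := by
    have : 0 ≤ D - q := by linarith
    have : 0 ≤ D := by linarith
    positivity
  have h2 := mul_nonneg h1 (show 0 ≤ 8 * g + 6 * m by positivity)
  rw [← e] at h2
  nlinarith

/-- The potential pays for the move of an end point that leaves its gap. -/
lemma phi_move {Λ D p q : ℝ} (hp : 0 < p) (hq : 0 < q) (h : q ≤ D) :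
    q * phi Λ (p + q) 0 (D + p) + p * phi Λ (p + q) 0 (D - q) + 2 * p * q
      ≤ (p + q) * phi Λ (p + q) (p * q / (p + q)) D := by
  have hD : 0 < D := by linarith
  unfold phi
  set G := p + q + D with hG
  have hGp : 0 < G := by positivity
  have h1 : p + q + (D + p) = G + p := by ring
  have h2 : p + q + (D - q) = G - q := by ring
  have h2' : 0 < G - q := by linarith
  rw [h1, h2]
  have e1 : (p + q) * (D / G * (8 * (p + q) + 6 * (p * q / (p + q))))
      - q * ((D + p) / (G + p) * (8 * (p + q) + 6 * 0))
      - p * ((D - q) / (G - q) * (8 * (p + q) + 6 * 0))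
      = p * q * (8 * (p + q) ^ 2 / G ^ 2 * (p * G / (G + p) + q * G / (G - q)) / G
        + 6 * (D / G)) := by
    have hD' : D = G - (p + q) := by rw [hG]; ring
    have : G - q ≠ 0 := h2'.ne'
    rw [hD']
    field_simp
    ring
  set t := (p + q) / G with ht
  have ht0 : 0 < t := by positivity
  have hDt : D / G = 1 - t := by rw [ht, hG]; field_simp; ring
  have h3 : (p + q) / 2 ≤ p * G / (G + p) + q * G / (G - q) := by
    have a1 : p / 2 ≤ p * G / (G + p) := by
      rw [le_div_iff₀ (by positivity)]; nlinarith
    have a2 : q / 2 ≤ q * G / (G - q) := by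
      rw [le_div_iff₀ h2']; nlinarith
    linarith
  have h4 : 4 * t ^ 3 ≤ 8 * (p + q) ^ 2 / G ^ 2 * (p * G / (G + p) + q * G / (G - q)) / G := by
    calc 4 * t ^ 3 = 8 * (p + q) ^ 2 / G ^ 2 * ((p + q) / 2) / G := by
          rw [ht]; field_simp; ring
      _ ≤ _ := by gcongr
  -- The minimum of `4 * t ^ 3 - 6 * t` on the positive half-line is attained at `t = 1 / √2`,
  -- which is close to `7 / 10`.
  have h5 : 2 ≤ 4 * t ^ 3 + 6 * (1 - t) := by
    nlinarith [sq_nonneg (t - 7/10), mul_nonneg ht0.le (sq_nonneg (t - 7/10)),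
      mul_nonneg ht0.le (sq_nonneg t)]
  have h6 : p * q * 2 ≤ p * q * (8 * (p + q) ^ 2 / G ^ 2 * (p * G / (G + p) + q * G / (G - q)) / G
        + 6 * (D / G)) := by
    rw [hDt]
    exact mul_le_mul_of_nonneg_left (by linarith) (by positivity)
  rw [← e1] at h6
  nlinarith

/-! ### The harmonic algorithm on a line with components -/

lemma leftNbr_eq_some {A : Finset (Fin n)} {x l : Fin n} :
    leftNbr A x = some l ↔ l ∈ A ∧ l < x ∧ ∀ e ∈ A, e < x → e ≤ l := by
  unfold leftNbr
  split_ifs with h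
  · rw [Option.some_inj]
    constructor
    · rintro rfl
      have := Finset.max'_mem _ h
      rw [Finset.mem_filter] at this
      exact ⟨this.1, this.2, fun e he hx => Finset.le_max' _ _ (by simp [he, hx])⟩
    · rintro ⟨h1, h2, h3⟩
      refine le_antisymm ?_ (Finset.le_max' _ _ (by simp [h1, h2]))
      refine Finset.max'_le _ _ _ fun y hy => ?_
      rw [Finset.mem_filter] at hy
      exact h3 y hy.1 hy.2
  · simp only [false_iff]
    rintro ⟨h1, h2, -⟩
    exact h ⟨l, by simp [h1, h2]⟩

lemma leftNbr_eq_none {A : Finset (Fin n)} {x : Fin n} :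
    leftNbr A x = none ↔ ∀ e ∈ A, x ≤ e := by
  unfold leftNbr
  split_ifs with h
  · simp only [false_iff]
    obtain ⟨e, he⟩ := h
    rw [Finset.mem_filter] at he
    exact fun H => absurd (H e he.1) (not_le.2 he.2)
  · simp only [true_iff]
    intro e he
    by_contra hc
    exact h ⟨e, by simp [he, not_le.1 hc]⟩

lemma rightNbr_eq_some {A : Finset (Fin n)} {x r : Fin n} :
    rightNbr A x = some r ↔ r ∈ A ∧ x < r ∧ ∀ e ∈ A, x < e → r ≤ e := by
  unfold rightNbr
  split_ifs with h
  · rw [Option.some_inj]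
    constructor
    · rintro rfl
      have := Finset.min'_mem _ h
      rw [Finset.mem_filter] at this
      exact ⟨this.1, this.2, fun e he hx => Finset.min'_le _ _ (by simp [he, hx])⟩
    · rintro ⟨h1, h2, h3⟩
      refine le_antisymm (Finset.min'_le _ _ (by simp [h1, h2])) ?_
      refine Finset.le_min' _ _ _ fun y hy => ?_
      rw [Finset.mem_filter] at hy
      exact h3 y hy.1 hy.2
  · simp only [false_iff]
    rintro ⟨h1, h2, -⟩
    exact h ⟨r, by simp [h1, h2]⟩

lemma rightNbr_eq_none {A : Finset (Fin n)} {x : Fin n} :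
    rightNbr A x = none ↔ ∀ e ∈ A, e ≤ x := by
  unfold rightNbr
  split_ifs with h
  · simp only [false_iff]
    obtain ⟨e, he⟩ := h
    rw [Finset.mem_filter] at he
    exact fun H => absurd (H e he.1) (not_le.2 he.2)
  · simp only [true_iff]
    intro e he
    by_contra hc
    exact h ⟨e, by simp [he, not_le.1 hc]⟩

/-- The expectation of `f` at the goal of a harmonic move from `x`, when the servers of `I` are
placed by `P` on a line that falls into components, labelled by `κ`, and only the servers in the
component of `x` can be reached.  (A request whose component has no servers stays where it is.) -/
noncomputable def harmExp (P : Fin n → ℝ) (κ : Fin n → ℕ) (I : Finset (Fin n)) (x : Fin n)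
    (f : Fin n → ℝ) : ℝ :=
  if x ∈ I then f x
  else
    match leftNbr (I.filter (κ · = κ x)) x, rightNbr (I.filter (κ · = κ x)) x with
    | none, none => f x
    | none, some b => f b
    | some a, none => f a
    | some a, some b => ((P b - P x) * f a + (P x - P a) * f b) / (P b - P a)

/-- The expected total cost of the harmonic algorithm that starts with the servers `I`, for the
requests of a list. -/
noncomputable def harmCost (P : Fin n → ℝ) (κ : Fin n → ℕ) : Finset (Fin n) → List (Fin n) → ℝ
  | _, [] => 0
  | I, x :: R => harmExp P κ I x fun g => |P x - P g| + harmCost P κ (I.erase g) R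

section

variable {P : Fin n → ℝ} {κ : Fin n → ℕ} {I : Finset (Fin n)} {x l r : Fin n} {f : Fin n → ℝ}

lemma harmExp_mem (h : x ∈ I) : harmExp P κ I x f = f x := by simp [harmExp, h]

lemma harmExp_none (h : ∀ e ∈ I, κ e ≠ κ x) : harmExp P κ I x f = f x := by
  have hx : x ∉ I := fun hx => h x hx rfl
  have h1 : leftNbr (I.filter (κ · = κ x)) x = none := leftNbr_eq_none.2 fun e he => by
    rw [Finset.mem_filter] at he; exact absurd he.2 (h e he.1)
  have h2 : rightNbr (I.filter (κ · = κ x)) x = none := rightNbr_eq_none.2 fun e he => by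
    rw [Finset.mem_filter] at he; exact absurd he.2 (h e he.1)
  simp [harmExp, hx, h1, h2]

lemma leftNbr_filter (hl : l ∈ I) (hκ : κ l = κ x) (hlx : l < x)
    (h : ∀ e ∈ I, κ e = κ x → e ≤ l ∨ x < e) : leftNbr (I.filter (κ · = κ x)) x = some l := by
  refine leftNbr_eq_some.2 ⟨by simp [hl, hκ], hlx, fun e he hx => ?_⟩
  rw [Finset.mem_filter] at he
  rcases h e he.1 he.2 with h | h
  · exact h
  · exact absurd h hx.not_gt

lemma rightNbr_filter (hr : r ∈ I) (hκ : κ r = κ x) (hxr : x < r)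
    (h : ∀ e ∈ I, κ e = κ x → e < x ∨ r ≤ e) : rightNbr (I.filter (κ · = κ x)) x = some r := by
  refine rightNbr_eq_some.2 ⟨by simp [hr, hκ], hxr, fun e he hx => ?_⟩
  rw [Finset.mem_filter] at he
  rcases h e he.1 he.2 with h | h
  · exact absurd h hx.not_gt
  · exact h

lemma harmExp_both (hl : l ∈ I) (hr : r ∈ I) (hκl : κ l = κ x) (hκr : κ r = κ x) (hlx : l < x)
    (hxr : x < r) (h : ∀ e ∈ I, κ e = κ x → e ≤ l ∨ r ≤ e) :
    harmExp P κ I x f = ((P r - P x) * f l + (P x - P l) * f r) / (P r - P l) := by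
  have hx : x ∉ I := fun hx => by
    rcases h x hx rfl with h | h
    · exact absurd hlx h.not_gt
    · exact absurd hxr h.not_gt
  have h1 := leftNbr_filter hl hκl hlx fun e he hk => (h e he hk).imp_right hxr.trans_le
  have h2 := rightNbr_filter hr hκr hxr fun e he hk => (h e he hk).imp_left fun h => h.trans_lt hlx
  simp [harmExp, hx, h1, h2]

lemma harmExp_left (hl : l ∈ I) (hκl : κ l = κ x) (hlx : l < x)
    (h : ∀ e ∈ I, κ e = κ x → e ≤ l) : harmExp P κ I x f = f l := by
  have hx : x ∉ I := fun hx => absurd hlx (h x hx rfl).not_gt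
  have h1 := leftNbr_filter hl hκl hlx fun e he hk => Or.inl (h e he hk)
  have h2 : rightNbr (I.filter (κ · = κ x)) x = none := rightNbr_eq_none.2 fun e he => by
    rw [Finset.mem_filter] at he; exact (h e he.1 he.2).trans hlx.le
  simp [harmExp, hx, h1, h2]

lemma harmExp_right (hr : r ∈ I) (hκr : κ r = κ x) (hxr : x < r)
    (h : ∀ e ∈ I, κ e = κ x → r ≤ e) : harmExp P κ I x f = f r := by
  have hx : x ∉ I := fun hx => absurd hxr (h x hx rfl).not_gt
  have h1 := rightNbr_filter hr hκr hxr fun e he hk => Or.inr (h e he hk)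
  have h2 : leftNbr (I.filter (κ · = κ x)) x = none := leftNbr_eq_none.2 fun e he => by
    rw [Finset.mem_filter] at he; exact hxr.le.trans (h e he.1 he.2)
  simp [harmExp, hx, h1, h2]

/-- There is a first element of `I` to the left of `x` that satisfies `P'`, or there is none. -/
lemma exists_left (P' : Fin n → Prop) (hx : x ∉ I) :
    (∃ l ∈ I, P' l ∧ l < x ∧ ∀ e ∈ I, P' e → e ≤ l ∨ x < e) ∨ ∀ e ∈ I, P' e → x < e := by
  classical
  rcases h : leftNbr (I.filter P') x with _ | l
  · rw [leftNbr_eq_none] at h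
    right
    intro e he hp
    exact lt_of_le_of_ne (h e (by simp [he, hp])) fun h => hx (h ▸ he)
  · rw [leftNbr_eq_some, Finset.mem_filter] at h
    obtain ⟨⟨h1, h2⟩, h3, h4⟩ := h
    refine Or.inl ⟨l, h1, h2, h3, fun e he hp => ?_⟩
    rcases lt_trichotomy e x with h | h | h
    · exact Or.inl (h4 e (by simp [he, hp]) h)
    · exact absurd (h ▸ he) hx
    · exact Or.inr h

lemma exists_right (P' : Fin n → Prop) (hx : x ∉ I) :
    (∃ r ∈ I, P' r ∧ x < r ∧ ∀ e ∈ I, P' e → e < x ∨ r ≤ e) ∨ ∀ e ∈ I, P' e → e < x := by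
  classical
  rcases h : rightNbr (I.filter P') x with _ | r
  · rw [rightNbr_eq_none] at h
    right
    intro e he hp
    exact lt_of_le_of_ne (h e (by simp [he, hp])) fun h => hx (h ▸ he)
  · rw [rightNbr_eq_some, Finset.mem_filter] at h
    obtain ⟨⟨h1, h2⟩, h3, h4⟩ := h
    refine Or.inl ⟨r, h1, h2, h3, fun e he hp => ?_⟩
    rcases lt_trichotomy e x with h | h | h
    · exact Or.inl h
    · exact absurd (h ▸ he) hx
    · exact Or.inr (h4 e (by simp [he, hp]) h)

end

/-! ### Comparison of two runs that differ in one server -/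

section algebra

variable {u v q Z Y Xl Xc T Sl Sc : ℝ}

/-- The point `x` has the servers `l` and `y` at distances `u` and `v` in one run, `l` and `c` at
distances `u` and `v + q` in the other one. -/
lemma abs_single_le (hu : 0 < u) (hv : 0 ≤ v) (hq : 0 ≤ q) (h0 : |Z - Xl| ≤ T)
    (hl : |Y - Xl| ≤ Sl) (hc : |Y - Xc| ≤ Sc)
    (hT : q * Sl + (u + v) * Sc + 2 * (u + v) * q ≤ (u + v + q) * T) :
    |(v * (u + Z) + u * (v + Y)) / (u + v)
      - ((v + q) * (u + Xl) + u * (v + q + Xc)) / (u + v + q)| ≤ T := by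
  have e : (v * (u + Z) + u * (v + Y)) / (u + v)
      - ((v + q) * (u + Xl) + u * (v + q + Xc)) / (u + v + q)
      = (v * (u + v + q) * (Z - Xl) + u * q * (Y - Xl) + u * (u + v) * (Y - Xc) - 2 * u ^ 2 * q)
        / ((u + v) * (u + v + q)) := by
    have : u + v ≠ 0 := by positivity
    have : u + v + q ≠ 0 := by positivity
    field_simp
    ring
  rw [e, abs_div, abs_of_pos (show 0 < (u + v) * (u + v + q) by positivity),
    div_le_iff₀ (by positivity)]
  rw [abs_le] at h0 hl hc
  have a1 := mul_nonneg hv (show 0 ≤ u + v + q by positivity)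
  have a2 := mul_nonneg hu.le hq
  have a3 := mul_nonneg hu.le (show 0 ≤ u + v by positivity)
  have b := mul_le_mul_of_nonneg_left hT hu.le
  have c : 0 ≤ u * v * q := by positivity
  rw [abs_le]
  constructor
  · nlinarith [mul_le_mul_of_nonneg_left h0.1 a1, mul_le_mul_of_nonneg_left hl.1 a2,
      mul_le_mul_of_nonneg_left hc.1 a3]
  · nlinarith [mul_le_mul_of_nonneg_left h0.2 a1, mul_le_mul_of_nonneg_left hl.2 a2,
      mul_le_mul_of_nonneg_left hc.2 a3, mul_nonneg a2 hu.le]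

end algebra

section step

variable {P : Fin n → ℝ} {κ : Fin n → ℕ} {A I : Finset (Fin n)} {a b x y z l r c : Fin n}
  {R : List (Fin n)} {T Sl Sc S : ℝ}

lemma harmCost_mem (h : x ∈ I) : harmCost P κ I (x :: R) = harmCost P κ (I.erase x) R := by
  simp [harmCost, harmExp_mem h]

lemma harmCost_both (hP : StrictMono P) (hl : l ∈ I) (hr : r ∈ I) (hκl : κ l = κ x)
    (hκr : κ r = κ x) (hlx : l < x) (hxr : x < r) (h : ∀ e ∈ I, κ e = κ x → e ≤ l ∨ r ≤ e) :
    harmCost P κ I (x :: R) = ((P r - P x) * (P x - P l + harmCost P κ (I.erase l) R)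
      + (P x - P l) * (P r - P x + harmCost P κ (I.erase r) R)) / (P r - P l) := by
  have h1 := hP hlx
  have h2 := hP hxr
  rw [harmCost, harmExp_both hl hr hκl hκr hlx hxr h, abs_of_pos (by linarith),
    abs_of_neg (by linarith), neg_sub]

lemma harmCost_left (hP : StrictMono P) (hl : l ∈ I) (hκl : κ l = κ x) (hlx : l < x)
    (h : ∀ e ∈ I, κ e = κ x → e ≤ l) :
    harmCost P κ I (x :: R) = P x - P l + harmCost P κ (I.erase l) R := by
  have h1 := hP hlx
  rw [harmCost, harmExp_left hl hκl hlx h, abs_of_pos (by linarith)]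

lemma harmCost_right (hP : StrictMono P) (hr : r ∈ I) (hκr : κ r = κ x) (hxr : x < r)
    (h : ∀ e ∈ I, κ e = κ x → r ≤ e) :
    harmCost P κ I (x :: R) = P r - P x + harmCost P κ (I.erase r) R := by
  have h1 := hP hxr
  rw [harmCost, harmExp_right hr hκr hxr h, abs_of_neg (by linarith), neg_sub]

/-- Only the end point `y` of the discrepancy lies in the gap of `x`. -/
lemma abs_harmCost_single_le (hP : StrictMono P) (hl : l ∈ A) (hc : c ∈ A) (hy : y ∉ A)
    (hz : z ∉ A) (hκl : κ l = κ x) (hκc : κ c = κ x) (hκy : κ y = κ x) (hly : l < y) (hyc : y < c)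
    (hzo : z < l ∨ c < z) (hlx : l < x) (hxc : x < c)
    (hgap : ∀ e ∈ A, κ e = κ x → e ≤ l ∨ c ≤ e)
    (h0l : |harmCost P κ (insert y (A.erase l)) R - harmCost P κ (insert z (A.erase l)) R| ≤ T)
    (h0c : |harmCost P κ (insert y (A.erase c)) R - harmCost P κ (insert z (A.erase c)) R| ≤ T)
    (hSl : |harmCost P κ A R - harmCost P κ (insert z (A.erase l)) R| ≤ Sl)
    (hSc : |harmCost P κ A R - harmCost P κ (insert z (A.erase c)) R| ≤ Sc)
    (hT : (P c - P y) * Sl + (P y - P l) * Sc + 2 * (P y - P l) * (P c - P y)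
      ≤ (P c - P l) * T) :
    |harmCost P κ (insert y A) (x :: R) - harmCost P κ (insert z A) (x :: R)| ≤ T := by
  have hzl : z ≠ l := fun h => hz (h ▸ hl)
  have hzc : z ≠ c := fun h => hz (h ▸ hc)
  have hyl : y ≠ l := hly.ne'
  have hyc' : y ≠ c := hyc.ne
  have e1 := harmCost_both (R := R) hP (I := insert z A) (Finset.mem_insert_of_mem hl)
    (Finset.mem_insert_of_mem hc) hκl hκc hlx hxc (by
      intro e he hk
      rcases Finset.mem_insert.1 he with rfl | he
      · exact hzo.imp le_of_lt le_of_lt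
      · exact hgap e he hk)
  rw [Finset.erase_insert_of_ne hzl, Finset.erase_insert_of_ne hzc] at e1
  have p1 := hP hly
  have p2 := hP hyc
  have p3 := hP hlx
  have p4 := hP hxc
  rcases lt_trichotomy x y with hxy | rfl | hxy
  · have e2 := harmCost_both (R := R) hP (I := insert y A) (Finset.mem_insert_of_mem hl)
      (Finset.mem_insert_self _ _) hκl hκy hlx hxy (by
        intro e he hk
        rcases Finset.mem_insert.1 he with rfl | he
        · exact Or.inr le_rfl
        · exact (hgap e he hk).imp_right hyc.le.trans)
    rw [Finset.erase_insert_of_ne hyl, Finset.erase_insert hy] at e2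
    have p5 := hP hxy
    have := abs_single_le (u := P x - P l) (v := P y - P x) (q := P c - P y) (by linarith)
      (by linarith) (by linarith) h0l hSl hSc (by convert hT using 2 <;> ring)
    rw [e1, e2]
    convert this using 4 <;> ring
  · have := abs_single_le (u := P x - P l) (v := 0) (q := P c - P x) (by linarith)
      le_rfl (by linarith) h0l hSl hSc (by convert hT using 2 <;> ring)
    rw [e1, harmCost_mem (Finset.mem_insert_self _ _), Finset.erase_insert hy]
    convert this using 3
    · have : P x - P l ≠ 0 := by linarith
      field_simp
      ring
    · ring
  · have e2 := harmCost_both (R := R) hP (I := insert y A) (Finset.mem_insert_self _ _)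
      (Finset.mem_insert_of_mem hc) hκy hκc hxy hxc (by
        intro e he hk
        rcases Finset.mem_insert.1 he with rfl | he
        · exact Or.inl le_rfl
        · exact (hgap e he hk).imp_left fun h => h.trans hly.le)
    rw [Finset.erase_insert_of_ne hyc', Finset.erase_insert hy] at e2
    have p5 := hP hxy
    have := abs_single_le (u := P c - P x) (v := P x - P y) (q := P y - P l) (by linarith)
      (by linarith) (by linarith) h0c hSc hSl (by convert hT using 2 <;> ring)
    rw [e1, e2]
    convert this using 4 <;> ring

/-- Only the end point `y` of the discrepancy lies in the gap of `x`, which extends infinitely to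
the left. -/
lemma abs_harmCost_single_le_of_right (hP : StrictMono P) (hc : c ∈ A) (hy : y ∉ A)
    (hz : z ∉ A) (hκc : κ c = κ x) (hκy : κ y = κ x) (hyc : y < c)
    (hzo : c < z) (hxc : x < c) (hgap : ∀ e ∈ A, κ e = κ x → c ≤ e)
    (h0c : |harmCost P κ (insert y (A.erase c)) R - harmCost P κ (insert z (A.erase c)) R| ≤ T)
    (hSc : |harmCost P κ A R - harmCost P κ (insert z (A.erase c)) R| ≤ Sc)
    (hT : Sc + (P c - P y) ≤ T) :
    |harmCost P κ (insert y A) (x :: R) - harmCost P κ (insert z A) (x :: R)| ≤ T := by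
  have hzc : z ≠ c := fun h => hz (h ▸ hc)
  have hyc' : y ≠ c := hyc.ne
  have e1 := harmCost_right (R := R) hP (I := insert z A)
    (Finset.mem_insert_of_mem hc) hκc hxc (by
      intro e he hk
      rcases Finset.mem_insert.1 he with rfl | he
      · exact hzo.le
      · exact hgap e he hk)
  rw [Finset.erase_insert_of_ne hzc] at e1
  have p2 := hP hyc
  have p4 := hP hxc
  rw [abs_le] at h0c hSc
  rcases lt_trichotomy x y with hxy | rfl | hxy
  · have e2 := harmCost_right (R := R) hP (I := insert y A)
      (Finset.mem_insert_self _ _) hκy hxy (by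
        intro e he hk
        rcases Finset.mem_insert.1 he with rfl | he
        · exact le_rfl
        · exact hyc.le.trans (hgap e he hk))
    rw [Finset.erase_insert hy] at e2
    rw [e1, e2, abs_le]
    constructor <;> linarith
  · rw [e1, harmCost_mem (Finset.mem_insert_self _ _), Finset.erase_insert hy, abs_le]
    constructor <;> linarith
  · have e2 := harmCost_both (R := R) hP (I := insert y A) (Finset.mem_insert_self _ _)
      (Finset.mem_insert_of_mem hc) hκy hκc hxy hxc (by
        intro e he hk
        rcases Finset.mem_insert.1 he with rfl | he
        · exact Or.inl le_rfl
        · exact Or.inr (hgap e he hk))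
    rw [Finset.erase_insert_of_ne hyc', Finset.erase_insert hy] at e2
    have p5 := hP hxy
    rw [e1, e2, div_sub' (by linarith), abs_div, abs_of_pos (show 0 < P c - P y by linarith),
      div_le_iff₀ (by linarith), abs_le]
    have b1 : 0 < P c - P x := by linarith
    have b2 : 0 < P x - P y := by linarith
    constructor <;> nlinarith

/-- Only the end point `y` of the discrepancy lies in the gap of `x`, which extends infinitely to
the right. -/
lemma abs_harmCost_single_le_of_left (hP : StrictMono P) (hl : l ∈ A) (hy : y ∉ A)
    (hz : z ∉ A) (hκl : κ l = κ x) (hκy : κ y = κ x) (hly : l < y)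
    (hzo : z < l) (hlx : l < x) (hgap : ∀ e ∈ A, κ e = κ x → e ≤ l)
    (h0l : |harmCost P κ (insert y (A.erase l)) R - harmCost P κ (insert z (A.erase l)) R| ≤ T)
    (hSl : |harmCost P κ A R - harmCost P κ (insert z (A.erase l)) R| ≤ Sl)
    (hT : Sl + (P y - P l) ≤ T) :
    |harmCost P κ (insert y A) (x :: R) - harmCost P κ (insert z A) (x :: R)| ≤ T := by
  have hzl : z ≠ l := fun h => hz (h ▸ hl)
  have hyl : y ≠ l := hly.ne'
  have e1 := harmCost_left (R := R) hP (I := insert z A)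
    (Finset.mem_insert_of_mem hl) hκl hlx (by
      intro e he hk
      rcases Finset.mem_insert.1 he with rfl | he
      · exact hzo.le
      · exact hgap e he hk)
  rw [Finset.erase_insert_of_ne hzl] at e1
  have p2 := hP hly
  have p4 := hP hlx
  rw [abs_le] at h0l hSl
  rcases lt_trichotomy y x with hxy | rfl | hxy
  · have e2 := harmCost_left (R := R) hP (I := insert y A)
      (Finset.mem_insert_self _ _) hκy hxy (by
        intro e he hk
        rcases Finset.mem_insert.1 he with rfl | he
        · exact le_rfl
        · exact (hgap e he hk).trans hly.le)
    rw [Finset.erase_insert hy] at e2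
    rw [e1, e2, abs_le]
    constructor <;> linarith
  · rw [e1, harmCost_mem (Finset.mem_insert_self _ _), Finset.erase_insert hy, abs_le]
    constructor <;> linarith
  · have e2 := harmCost_both (R := R) hP (I := insert y A) (Finset.mem_insert_of_mem hl)
      (Finset.mem_insert_self _ _) hκl hκy hlx hxy (by
        intro e he hk
        rcases Finset.mem_insert.1 he with rfl | he
        · exact Or.inr le_rfl
        · exact Or.inl (hgap e he hk))
    rw [Finset.erase_insert_of_ne hyl, Finset.erase_insert hy] at e2
    have p5 := hP hxy
    rw [e1, e2, div_sub' (by linarith), abs_div, abs_of_pos (show 0 < P y - P l by linarith),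
      div_le_iff₀ (by linarith), abs_le]
    have b1 : 0 < P y - P x := by linarith
    have b2 : 0 < P x - P l := by linarith
    constructor <;> nlinarith

/-- Both runs make the same moves if the gap of `x` contains no end point of the discrepancy. -/
lemma abs_harmCost_same_le (hP : StrictMono P) (ha : a ∉ A) (hb : b ∉ A)
    (h : ∀ e ∈ A, |harmCost P κ (insert a (A.erase e)) R
      - harmCost P κ (insert b (A.erase e)) R| ≤ T)
    (h' : |harmCost P κ (insert a A) R - harmCost P κ (insert b A) R| ≤ T)
    (hout : κ a ≠ κ x ∧ κ b ≠ κ x ∨ x ∈ A ∨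
      (∃ l ∈ A, κ l = κ x ∧ l < x ∧ (∀ e ∈ A, κ e = κ x → e ≤ l) ∧ a < l ∧ b < l) ∨
      (∃ r ∈ A, κ r = κ x ∧ x < r ∧ (∀ e ∈ A, κ e = κ x → r ≤ e) ∧ r < a ∧ r < b) ∨
      (∃ l ∈ A, ∃ r ∈ A, κ l = κ x ∧ κ r = κ x ∧ l < x ∧ x < r ∧
        (∀ e ∈ A, κ e = κ x → e ≤ l ∨ r ≤ e) ∧ (a < l ∨ r < a) ∧ (b < l ∨ r < b))) :
    |harmCost P κ (insert a A) (x :: R) - harmCost P κ (insert b A) (x :: R)| ≤ T := by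
  have hnea : ∀ e ∈ A, a ≠ e := fun e he h => ha (h ▸ he)
  have hneb : ∀ e ∈ A, b ≠ e := fun e he h => hb (h ▸ he)
  have hleft : ∀ l ∈ A, κ l = κ x → l < x → (∀ e ∈ A, κ e = κ x → e ≤ l) →
      (κ a = κ x → a < l) → (κ b = κ x → b < l) →
      |harmCost P κ (insert a A) (x :: R) - harmCost P κ (insert b A) (x :: R)| ≤ T := by
    intro l hl hk hlx hg hal hbl
    rw [harmCost_left hP (Finset.mem_insert_of_mem hl) hk hlx,
      harmCost_left hP (Finset.mem_insert_of_mem hl) hk hlx,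
      Finset.erase_insert_of_ne (hnea l hl), Finset.erase_insert_of_ne (hneb l hl),
      add_sub_add_left_eq_sub]
    · exact h l hl
    · intro e he hk
      rcases Finset.mem_insert.1 he with rfl | he
      · exact (hbl hk).le
      · exact hg e he hk
    · intro e he hk
      rcases Finset.mem_insert.1 he with rfl | he
      · exact (hal hk).le
      · exact hg e he hk
  have hright : ∀ r ∈ A, κ r = κ x → x < r → (∀ e ∈ A, κ e = κ x → r ≤ e) →
      (κ a = κ x → r < a) → (κ b = κ x → r < b) →
      |harmCost P κ (insert a A) (x :: R) - harmCost P κ (insert b A) (x :: R)| ≤ T := by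
    intro r hr hk hxr hg hal hbl
    rw [harmCost_right hP (Finset.mem_insert_of_mem hr) hk hxr,
      harmCost_right hP (Finset.mem_insert_of_mem hr) hk hxr,
      Finset.erase_insert_of_ne (hnea r hr), Finset.erase_insert_of_ne (hneb r hr),
      add_sub_add_left_eq_sub]
    · exact h r hr
    · intro e he hk
      rcases Finset.mem_insert.1 he with rfl | he
      · exact (hbl hk).le
      · exact hg e he hk
    · intro e he hk
      rcases Finset.mem_insert.1 he with rfl | he
      · exact (hal hk).le
      · exact hg e he hk
  have hboth : ∀ l ∈ A, ∀ r ∈ A, κ l = κ x → κ r = κ x → l < x → x < r →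
      (∀ e ∈ A, κ e = κ x → e ≤ l ∨ r ≤ e) →
      (κ a = κ x → a < l ∨ r < a) → (κ b = κ x → b < l ∨ r < b) →
      |harmCost P κ (insert a A) (x :: R) - harmCost P κ (insert b A) (x :: R)| ≤ T := by
    intro l hl r hr hkl hkr hlx hxr hg hal hbl
    have p1 := hP hlx
    have p2 := hP hxr
    rw [harmCost_both hP (Finset.mem_insert_of_mem hl) (Finset.mem_insert_of_mem hr) hkl hkr hlx
        hxr,
      harmCost_both hP (Finset.mem_insert_of_mem hl) (Finset.mem_insert_of_mem hr) hkl hkr hlx hxr,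
      Finset.erase_insert_of_ne (hnea l hl), Finset.erase_insert_of_ne (hneb l hl),
      Finset.erase_insert_of_ne (hnea r hr), Finset.erase_insert_of_ne (hneb r hr),
      ← sub_div, abs_div, abs_of_pos (show 0 < P r - P l by linarith),
      div_le_iff₀ (by linarith)]
    · have h1 := h l hl
      have h2 := h r hr
      rw [abs_le] at h1 h2 ⊢
      have b1 : 0 < P r - P x := by linarith
      have b2 : 0 < P x - P l := by linarith
      constructor <;> nlinarith
    · intro e he hk
      rcases Finset.mem_insert.1 he with rfl | he
      · exact (hbl hk).imp le_of_lt le_of_lt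
      · exact hg e he hk
    · intro e he hk
      rcases Finset.mem_insert.1 he with rfl | he
      · exact (hal hk).imp le_of_lt le_of_lt
      · exact hg e he hk
  rcases hout with ⟨hka, hkb⟩ | hx | ⟨l, hl, hk, hlx, hg, hal, hbl⟩ | ⟨r, hr, hk, hxr, hg, hal, hbl⟩
      | ⟨l, hl, r, hr, hkl, hkr, hlx, hxr, hg, hal, hbl⟩
  · by_cases hx : x ∈ A
    · rw [harmCost_mem (Finset.mem_insert_of_mem hx), harmCost_mem (Finset.mem_insert_of_mem hx),
        Finset.erase_insert_of_ne (hnea x hx), Finset.erase_insert_of_ne (hneb x hx)]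
      exact h x hx
    rcases exists_left (fun e => κ e = κ x) hx with ⟨l, hl, hkl, hlx, hgl⟩ | hgl <;>
      rcases exists_right (fun e => κ e = κ x) hx with ⟨r, hr, hkr, hxr, hgr⟩ | hgr
    · refine hboth l hl r hr hkl hkr hlx hxr (fun e he hk => ?_) (fun h => absurd h hka)
        fun h => absurd h hkb
      rcases hgl e he hk with h | h
      · exact Or.inl h
      · exact Or.inr ((hgr e he hk).resolve_left h.not_gt)
    · refine hleft l hl hkl hlx (fun e he hk => ?_) (fun h => absurd h hka)
        fun h => absurd h hkb
      exact (hgl e he hk).resolve_right (hgr e he hk).not_gt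
    · refine hright r hr hkr hxr (fun e he hk => ?_) (fun h => absurd h hka)
        fun h => absurd h hkb
      exact (hgr e he hk).resolve_left (hgl e he hk).not_gt
    · have hn : ∀ e ∈ A, κ e ≠ κ x := fun e he hk =>
        absurd (hgl e he hk) (hgr e he hk).not_gt
      have hna : ∀ e ∈ insert a A, κ e ≠ κ x := by
        intro e he
        rcases Finset.mem_insert.1 he with rfl | he
        · exact hka
        · exact hn e he
      have hnb : ∀ e ∈ insert b A, κ e ≠ κ x := by
        intro e he
        rcases Finset.mem_insert.1 he with rfl | he
        · exact hkb
        · exact hn e he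
      rw [harmCost, harmCost, harmExp_none hna, harmExp_none hnb,
        Finset.erase_eq_of_notMem fun h => hna x h rfl,
        Finset.erase_eq_of_notMem fun h => hnb x h rfl, add_sub_add_left_eq_sub]
      exact h'
  · rw [harmCost_mem (Finset.mem_insert_of_mem hx), harmCost_mem (Finset.mem_insert_of_mem hx),
      Finset.erase_insert_of_ne (hnea x hx), Finset.erase_insert_of_ne (hneb x hx)]
    exact h x hx
  · exact hleft l hl hk hlx hg (fun _ => hal) fun _ => hbl
  · exact hright r hr hk hxr hg (fun _ => hal) fun _ => hbl
  · exact hboth l hl r hr hkl hkr hlx hxr hg (fun _ => hal) fun _ => hbl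

end step

section algebra

variable {u v h Y X F S : ℝ}

/-- The point `x` lies between the end points, at distance `u` from `a` and `v` from `b`; the run
that owns `a` has its next server to the right at distance `v + h` from `x`. -/
lemma abs_mid_le (hu : 0 < u) (hv : 0 < v) (hh : 0 ≤ h) (hX : |Y - X| ≤ S)
    (hS : (u + v) * S + 2 * (u + v) * h ≤ (u + v + h) * F) :
    |((v + h) * (u + Y) + u * (v + h + X)) / (u + v + h) - Y - 2 * u * v / (u + v)|
      ≤ u * F / (u + v) := by
  have e : ((v + h) * (u + Y) + u * (v + h + X)) / (u + v + h) - Y - 2 * u * v / (u + v)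
      = u * ((u + v) * (X - Y) + 2 * u * h) / ((u + v + h) * (u + v)) := by
    have : u + v ≠ 0 := by positivity
    have : u + v + h ≠ 0 := by positivity
    field_simp
    ring
  rw [e, abs_div, abs_of_pos (show 0 < (u + v + h) * (u + v) by positivity), abs_mul,
    abs_of_pos hu, div_le_div_iff₀ (by positivity) (by positivity)]
  have h1 : |(u + v) * (X - Y) + 2 * u * h| ≤ (u + v + h) * F := by
    have a1 := mul_nonneg hu.le hh
    have a2 := mul_nonneg hv.le hh
    have a3 : 0 < u + v := by positivity
    rw [abs_le] at hX ⊢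
    constructor <;> nlinarith
  have := mul_le_mul_of_nonneg_left h1 (show 0 ≤ u * (u + v) by positivity)
  linarith

lemma abs_mid_le' (hu : 0 < u) (hv : 0 < v) (hF : u + v ≤ F) :
    |u + Y - Y - 2 * u * v / (u + v)| ≤ u * F / (u + v) := by
  have e : u + Y - Y - 2 * u * v / (u + v) = u * (u - v) / (u + v) := by
    field_simp
    ring
  rw [e, abs_div, abs_of_pos (show 0 < u + v by positivity), abs_mul, abs_of_pos hu]
  have : |u - v| ≤ F := by rw [abs_le]; constructor <;> linarith
  gcongr

end algebra

section step

variable {P : Fin n → ℝ} {κ : Fin n → ℕ} {A : Finset (Fin n)} {a b x : Fin n}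
  {R : List (Fin n)} {T : ℝ}

/-- Both end points of the discrepancy lie in the gap of `x`. -/
lemma abs_harmCost_double_le (hP : StrictMono P) (ha : a ∉ A) (hb : b ∉ A)
    (hκa : κ a = κ x) (hκb : κ b = κ x) (hab : a < b) (hD : P b - P a ≤ T)
    (hL : (∃ l ∈ A, κ l = κ x ∧ l < a ∧ l < x ∧ (∀ e ∈ A, κ e = κ x → e ≤ l ∨ b < e ∧ x < e) ∧
        |harmCost P κ (insert a (A.erase l)) R - harmCost P κ (insert b (A.erase l)) R| ≤ T ∧
        ∃ S, |harmCost P κ A R - harmCost P κ (insert b (A.erase l)) R| ≤ S ∧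
          (P b - P a) * S + 2 * (P b - P a) * (P a - P l) ≤ (P b - P l) * T) ∨
      ∀ e ∈ A, κ e = κ x → b < e ∧ x < e)
    (hR : (∃ r ∈ A, κ r = κ x ∧ b < r ∧ x < r ∧ (∀ e ∈ A, κ e = κ x → r ≤ e ∨ e < a ∧ e < x) ∧
        |harmCost P κ (insert a (A.erase r)) R - harmCost P κ (insert b (A.erase r)) R| ≤ T ∧
        ∃ S, |harmCost P κ A R - harmCost P κ (insert a (A.erase r)) R| ≤ S ∧
          (P b - P a) * S + 2 * (P b - P a) * (P r - P b) ≤ (P r - P a) * T) ∨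
      ∀ e ∈ A, κ e = κ x → e < a ∧ e < x) :
    |harmCost P κ (insert a A) (x :: R) - harmCost P κ (insert b A) (x :: R)| ≤ T := by
  have hPab := hP hab
  have hself : ∀ y : Fin n, y ∈ insert y A := fun y => Finset.mem_insert_self _ _
  have hins : ∀ {y l : Fin n}, l ∈ A → l ∈ insert y A := fun h => Finset.mem_insert_of_mem h
  rcases le_or_gt x a with hxa | hax
  · -- the request arrives to the left of the discrepancy
    have hxb : x < b := hxa.trans_lt hab
    have hPxa := hP.monotone hxa
    have hPxb := hP hxb
    rcases hL with ⟨l, hl, hκl, hla, hlx, hg, h0, S, hS, hST⟩ | hg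
    · have hPla := hP hla
      have hPlx := hP hlx
      have e1 := harmCost_both (R := R) hP (I := insert b A) (hins hl) (hself b) hκl hκb hlx hxb
        (by
          intro e he hk
          rcases Finset.mem_insert.1 he with rfl | he
          · exact Or.inr le_rfl
          · exact (hg e he hk).imp_right fun h => h.1.le)
      rw [Finset.erase_insert_of_ne (by rintro rfl; exact hb hl), Finset.erase_insert hb] at e1
      have e2 : harmCost P κ (insert a A) (x :: R) = ((P a - P x) * (P x - P l
          + harmCost P κ (insert a (A.erase l)) R) + (P x - P l) * (P a - P x
          + harmCost P κ A R)) / (P a - P l) := by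
        rcases hxa.eq_or_lt with rfl | hxa
        · rw [harmCost_mem (hself x), Finset.erase_insert ha]
          have : P x - P l ≠ 0 := by linarith
          field_simp
          ring
        · have e2 := harmCost_both (R := R) hP (I := insert a A) (hins hl) (hself a) hκl hκa hlx hxa
            (by
              intro e he hk
              rcases Finset.mem_insert.1 he with rfl | he
              · exact Or.inr le_rfl
              · exact (hg e he hk).imp_right fun h => hab.le.trans h.1.le)
          rwa [Finset.erase_insert_of_ne (by rintro rfl; exact ha hl), Finset.erase_insert ha] at e2
      have := abs_single_le (u := P x - P l) (v := P a - P x) (q := P b - P a)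
        (Y := harmCost P κ A R) (Xc := harmCost P κ A R) (Sc := 0) (by linarith)
        (by linarith) (by linarith) h0 hS (by simp) (by convert hST using 1 <;> ring)
      rw [e1, e2]
      convert this using 4 <;> ring
    · have e1 := harmCost_right (R := R) hP (I := insert b A) (hself b) hκb hxb (by
          intro e he hk
          rcases Finset.mem_insert.1 he with rfl | he
          · exact le_rfl
          · exact (hg e he hk).1.le)
      have e2 : harmCost P κ (insert a A) (x :: R) = P a - P x + harmCost P κ A R := by
        rcases hxa.eq_or_lt with rfl | hxa
        · rw [harmCost_mem (hself x), Finset.erase_insert ha, sub_self, zero_add]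
        · rw [harmCost_right (R := R) hP (I := insert a A) (hself a) hκa hxa (by
            intro e he hk
            rcases Finset.mem_insert.1 he with rfl | he
            · exact le_rfl
            · exact hab.le.trans (hg e he hk).1.le), Finset.erase_insert ha]
      rw [e1, e2, Finset.erase_insert hb, abs_le]
      constructor <;> linarith
  rcases le_or_gt b x with hbx | hxb
  · -- the request arrives to the right of the discrepancy
    have hPbx := hP.monotone hbx
    have hPax := hP hax
    rcases hR with ⟨r, hr, hκr, hbr, hxr, hg, h0, S, hS, hST⟩ | hg
    · have hPbr := hP hbr
      have hPxr := hP hxr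
      have e1 := harmCost_both (R := R) hP (I := insert a A) (hself a) (hins hr) hκa hκr hax hxr
        (by
          intro e he hk
          rcases Finset.mem_insert.1 he with rfl | he
          · exact Or.inl le_rfl
          · exact (hg e he hk).symm.imp_left fun h => h.1.le)
      rw [Finset.erase_insert ha, Finset.erase_insert_of_ne (by rintro rfl; exact ha hr)] at e1
      have e2 : harmCost P κ (insert b A) (x :: R) = ((P r - P x) * (P x - P b
          + harmCost P κ A R) + (P x - P b) * (P r - P x
          + harmCost P κ (insert b (A.erase r)) R)) / (P r - P b) := by
        rcases hbx.eq_or_lt with rfl | hbx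
        · rw [harmCost_mem (hself b), Finset.erase_insert hb]
          have : P r - P b ≠ 0 := by linarith
          field_simp
          ring
        · have e2 := harmCost_both (R := R) hP (I := insert b A) (hself b) (hins hr) hκb hκr hbx hxr
            (by
              intro e he hk
              rcases Finset.mem_insert.1 he with rfl | he
              · exact Or.inl le_rfl
              · exact (hg e he hk).symm.imp_left fun h => h.1.le.trans hab.le)
          rwa [Finset.erase_insert hb, Finset.erase_insert_of_ne (by rintro rfl; exact hb hr)] at e2
      rw [abs_sub_comm] at h0
      have := abs_single_le (u := P r - P x) (v := P x - P b) (q := P b - P a)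
        (Y := harmCost P κ A R) (Xc := harmCost P κ A R) (Sc := 0) (by linarith)
        (by linarith) (by linarith) h0 hS (by simp) (by convert hST using 1 <;> ring)
      rw [e1, e2, abs_sub_comm]
      convert this using 4 <;> ring
    · have e1 := harmCost_left (R := R) hP (I := insert a A) (hself a) hκa hax (by
          intro e he hk
          rcases Finset.mem_insert.1 he with rfl | he
          · exact le_rfl
          · exact (hg e he hk).1.le)
      have e2 : harmCost P κ (insert b A) (x :: R) = P x - P b + harmCost P κ A R := by
        rcases hbx.eq_or_lt with rfl | hbx
        · rw [harmCost_mem (hself b), Finset.erase_insert hb, sub_self, zero_add]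
        · rw [harmCost_left (R := R) hP (I := insert b A) (hself b) hκb hbx (by
            intro e he hk
            rcases Finset.mem_insert.1 he with rfl | he
            · exact le_rfl
            · exact (hg e he hk).1.le.trans hab.le), Finset.erase_insert hb]
      rw [e1, e2, Finset.erase_insert ha, abs_le]
      constructor <;> linarith
  -- the request arrives between the end points of the discrepancy
  have hPax := hP hax
  have hPxb := hP hxb
  have hVa : |harmCost P κ (insert a A) (x :: R) - harmCost P κ A R
      - 2 * (P x - P a) * (P b - P x) / (P x - P a + (P b - P x))|
      ≤ (P x - P a) * T / (P x - P a + (P b - P x)) := by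
    rcases hR with ⟨r, hr, hκr, hbr, hxr, hg, -, S, hS, hST⟩ | hg
    · have hPbr := hP hbr
      have e1 := harmCost_both (R := R) hP (I := insert a A) (hself a) (hins hr) hκa hκr hax hxr
        (by
          intro e he hk
          rcases Finset.mem_insert.1 he with rfl | he
          · exact Or.inl le_rfl
          · exact (hg e he hk).symm.imp_left fun h => h.1.le)
      rw [Finset.erase_insert ha, Finset.erase_insert_of_ne (by rintro rfl; exact ha hr)] at e1
      have := abs_mid_le (u := P x - P a) (v := P b - P x) (h := P r - P b) (F := T) (by linarith)
        (by linarith) (by linarith) hS (by convert hST using 1 <;> ring)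
      rw [e1]
      convert this using 5 <;> ring
    · rw [harmCost_left (R := R) hP (I := insert a A) (hself a) hκa hax (by
          intro e he hk
          rcases Finset.mem_insert.1 he with rfl | he
          · exact le_rfl
          · exact (hg e he hk).1.le), Finset.erase_insert ha]
      exact abs_mid_le' (by linarith) (by linarith) (by linarith)
  have hVb : |harmCost P κ (insert b A) (x :: R) - harmCost P κ A R
      - 2 * (P b - P x) * (P x - P a) / (P b - P x + (P x - P a))|
      ≤ (P b - P x) * T / (P b - P x + (P x - P a)) := by
    rcases hL with ⟨l, hl, hκl, hla, hlx, hg, -, S, hS, hST⟩ | hg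
    · have hPla := hP hla
      have e1 := harmCost_both (R := R) hP (I := insert b A) (hins hl) (hself b) hκl hκb hlx hxb
        (by
          intro e he hk
          rcases Finset.mem_insert.1 he with rfl | he
          · exact Or.inr le_rfl
          · exact (hg e he hk).imp_right fun h => h.1.le)
      rw [Finset.erase_insert_of_ne (by rintro rfl; exact hb hl), Finset.erase_insert hb] at e1
      have := abs_mid_le (u := P b - P x) (v := P x - P a) (h := P a - P l) (F := T) (by linarith)
        (by linarith) (by linarith) hS (by convert hST using 1 <;> ring)
      rw [e1, add_comm ((P b - P x) * (P x - P l + _))]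
      convert this using 5 <;> ring
    · rw [harmCost_right (R := R) hP (I := insert b A) (hself b) hκb hxb (by
          intro e he hk
          rcases Finset.mem_insert.1 he with rfl | he
          · exact le_rfl
          · exact (hg e he hk).1.le), Finset.erase_insert hb]
      exact abs_mid_le' (by linarith) (by linarith) (by linarith)
  have e : (P x - P a) * T / (P x - P a + (P b - P x)) + (P b - P x) * T / (P b - P x + (P x - P a))
      = T := by
    have : P b - P a ≠ 0 := by linarith
    have e1 : P x - P a + (P b - P x) = P b - P a := by ring
    have e2 : P b - P x + (P x - P a) = P b - P a := by ring
    rw [e1, e2]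
    field_simp
    ring
  have e' : 2 * (P b - P x) * (P x - P a) / (P b - P x + (P x - P a))
      = 2 * (P x - P a) * (P b - P x) / (P x - P a + (P b - P x)) := by
    rw [add_comm (P b - P x)]; ring
  rw [e'] at hVb
  rw [abs_le] at hVa hVb ⊢
  constructor <;> linarith

end step

/-! ### Certificates for the potential -/

/-- The server `e` lies beyond `y`, on the side opposite to `z`. -/
def Away (y z e : Fin n) : Prop := e < y ∧ y < z ∨ z < y ∧ y < e

/-- The server `e` lies strictly between `y` and `z`. -/
def Btw (y z e : Fin n) : Prop := y < e ∧ e < z ∨ z < e ∧ e < y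

/-- `Cert P κ Λ A y z T` certifies that `T D` may be used as the contribution of the end point `y`
to the potential of the discrepancy between `y` and `z`, of length `D`, when both runs own the
servers of `A`.  A certificate records lower bounds for the distances from `y` to the next servers
of `A`, or the absence of such servers. -/
inductive Cert (P : Fin n → ℝ) (κ : Fin n → ℕ) (Λ : ℝ) (A : Finset (Fin n)) (y z : Fin n) :
    (ℝ → ℝ) → Prop
  | free (h : ∀ e ∈ A, κ e = κ y → ¬ Away y z e) : Cert P κ Λ A y z fun D => D
  | two (p q : ℝ) (hp : 0 ≤ p) (hq : 0 ≤ q) (hpq : 0 < p + q) (hqD : q ≤ |P z - P y|)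
      (hΛ : 3 * (p + q) ≤ Λ) (ha : ∀ e ∈ A, κ e = κ y → Away y z e → p ≤ |P e - P y|)
      (hb : ∀ e ∈ A, κ e = κ y → Btw y z e → q ≤ |P e - P y|) :
      Cert P κ Λ A y z (phi Λ (p + q) (p * q / (p + q)))
  | one (p : ℝ) (hp : 0 ≤ p) (hpD : 0 < p + |P z - P y|) (hΛ : 3 * (p + |P z - P y|) ≤ Λ)
      (ha : ∀ e ∈ A, κ e = κ y → Away y z e → p ≤ |P e - P y|)
      (hb : ∀ e ∈ A, κ e = κ y → ¬ Btw y z e) :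
      Cert P κ Λ A y z (phi Λ (p + |P z - P y|) 0)

section cert

variable {P : Fin n → ℝ} {κ : Fin n → ℕ} {Λ : ℝ} {A A' : Finset (Fin n)} {y z w t : Fin n}
  {T : ℝ → ℝ} {D D' p q : ℝ}

lemma Cert.mono (h : Cert P κ Λ A y z T) (hA : A' ⊆ A) : Cert P κ Λ A' y z T := by
  cases h with
  | free h => exact .free fun e he => h e (hA he)
  | two p q hp hq hpq hqD hΛ ha hb =>
    exact .two p q hp hq hpq hqD hΛ (fun e he => ha e (hA he)) fun e he => hb e (hA he)
  | one p hp hpD hΛ ha hb =>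
    exact .one p hp hpD hΛ (fun e he => ha e (hA he)) fun e he => hb e (hA he)

lemma Cert.le (h : Cert P κ Λ A y z T) (hD : 0 ≤ D) : D ≤ T D := by
  cases h with
  | free h => exact le_rfl
  | two p q hp hq hpq hqD hΛ ha hb => exact le_phi hpq hΛ (by positivity) hD
  | one p hp hpD hΛ ha hb => exact le_phi hpD hΛ le_rfl hD

lemma phi_le_phi {Λ g m : ℝ} (hg : 0 < g) (hΛ : g ≤ Λ) (hm : 0 ≤ m) (hD : 0 ≤ D) (hDD : D ≤ D') :
    phi Λ g m D ≤ phi Λ g m D' := by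
  have h1 : 0 ≤ Real.log (Λ / g) := Real.log_nonneg (by rwa [le_div_iff₀ hg, one_mul])
  have h2 : D / (g + D) ≤ D' / (g + D') := by
    rw [div_le_div_iff₀ (by positivity) (by linarith)]
    nlinarith
  have h3 := mul_le_mul_of_nonneg_right h2 (show 0 ≤ 8 * g + 6 * m by positivity)
  have h4 := mul_le_mul_of_nonneg_right hDD h1
  unfold phi
  linarith

lemma Cert.apply_le (h : Cert P κ Λ A y z T) (hD : 0 ≤ D) (hDD : D ≤ D') : T D ≤ T D' := by
  cases h with
  | free h => exact hDD
  | two p q hp hq hpq hqD hΛ ha hb => exact phi_le_phi hpq (by linarith) (by positivity) hD hDD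
  | one p hp hpD hΛ ha hb => exact phi_le_phi hpD (by linarith) le_rfl hD hDD

lemma Cert.concave (h : Cert P κ Λ A y z T) (hp : 0 ≤ p) (hq : 0 ≤ q) (hqD : q ≤ D) :
    q * T (D + p) + p * T (D - q) ≤ (p + q) * T D := by
  cases h with
  | free h => exact le_of_eq (by ring)
  | two p q hp hq hpq hqD hΛ ha hb => exact phi_concave hpq (by positivity) ‹_› ‹_› ‹_›
  | one p hp hpD hΛ ha hb => exact phi_concave hpD le_rfl ‹_› ‹_› ‹_›

/-- The product over the sum of two lengths grows at most as much as the sum. -/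
lemma harmonic_mean_le {p q p' q' : ℝ} (hp : 0 ≤ p') (hq : 0 ≤ q') (h : 0 < p' + q') (hpp : p' ≤ p)
    (hqq : q' ≤ q) : p * q / (p + q) ≤ p' * q' / (p' + q') + (p + q - (p' + q')) := by
  have h2 : 0 < p + q := by linarith
  have e : p' * q' / (p' + q') + (p + q - (p' + q')) - p * q / (p + q)
      = ((p - p') * (p * p' + p * q' + q * p') + (q - q') * (p * q' + q * p' + q * q'))
        / ((p' + q') * (p + q)) := by
    have := h.ne'
    have := h2.ne'
    field_simp
    ring
  have : 0 ≤ ((p - p') * (p * p' + p * q' + q * p') + (q - q') * (p * q' + q * p' + q * q'))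
        / ((p' + q') * (p + q)) := by
    have := sub_nonneg.2 hpp
    have := sub_nonneg.2 hqq
    have := hp.trans hpp
    have := hq.trans hqq
    positivity
  linarith

/-- The certificate given by the two servers next to `y` is the best one. -/
lemma Cert.phi_two_le (h : Cert P κ Λ A y z T) (hD : 0 ≤ D) (hw : w ∈ A) (hκw : κ w = κ y)
    (haw : Away y z w) (ht : t ∈ A) (hκt : κ t = κ y) (hbt : Btw y z t) :
    phi Λ (|P w - P y| + |P t - P y|)
      (|P w - P y| * |P t - P y| / (|P w - P y| + |P t - P y|)) D ≤ T D := by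
  cases h with
  | free h => exact absurd haw (h w hw hκw)
  | two p q hp hq hpq hqD hΛ ha hb =>
    have h1 := ha w hw hκw haw
    have h2 := hb t ht hκt hbt
    exact phi_mono (by linarith) hpq (by linarith) (by positivity)
      (harmonic_mean_le hp hq hpq h1 h2) hD
  | one p hp hpD hΛ ha hb => exact absurd hbt (hb t ht hκt)

lemma Cert.phi_one_le (h : Cert P κ Λ A y z T) (hD : 0 ≤ D) (hw : w ∈ A) (hκw : κ w = κ y)
    (haw : Away y z w) : phi Λ (|P w - P y| + |P z - P y|) 0 D ≤ T D := by
  cases h with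
  | free h => exact absurd haw (h w hw hκw)
  | two p q hp hq hpq hqD hΛ ha hb =>
    have h1 := ha w hw hκw haw
    have h3 : 0 ≤ p * q / (p + q) := by positivity
    exact phi_mono (by linarith) hpq (by linarith) (by positivity)
      (by linarith) hD
  | one p hp hpD hΛ ha hb =>
    have h1 := ha w hw hκw haw
    exact phi_mono (by linarith) hpD (by linarith) le_rfl (by linarith) hD

/-- If there is a server between the end points `y` and `z`, then a certificate of `z` survives a
move of `y` within its gap. -/
lemma Cert.move (h : Cert P κ Λ A z y T) (hP : StrictMono P) (ht : t ∈ A) (hκt : κ t = κ z)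
    (hbt : Btw z y t) {y' : Fin n}
    (hy' : y' = t ∨ Away y z y') (hA : A' ⊆ A)
    (hgap : ∀ e ∈ A', κ e = κ z → Btw z y' e → Btw z y e) : Cert P κ Λ A' z y' T := by
  have hside : ∀ e, Away z y' e → Away z y e := by
    intro e he
    unfold Away Btw at *
    grind
  cases h with
  | free h => exact .free fun e he hk H => h e (hA he) hk (hside e H)
  | two p q hp hq hpq hqD hΛ ha hb =>
    refine .two p q hp hq hpq ?_ hΛ (fun e he hk H => ha e (hA he) hk (hside e H))
      fun e he hk H => hb e (hA he) hk (hgap e he hk H)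
    rcases hy' with rfl | hy'
    · exact hb _ ht hκt hbt
    · refine hqD.trans ?_
      unfold Away Btw at *
      rcases hy' with ⟨h1, h2⟩ | ⟨h1, h2⟩
      · have := hP h1
        have := hP h2
        rw [abs_of_neg (by linarith), abs_of_neg (by linarith)]
        linarith
      · have := hP h1
        have := hP h2
        rw [abs_of_pos (by linarith), abs_of_pos (by linarith)]
        linarith
  | one p hp hpD hΛ ha hb => exact absurd hbt (hb t ht hκt)

end cert

/-! ### The effect of a change of one server -/

section main

variable {P : Fin n → ℝ} {κ : Fin n → ℕ} {Λ : ℝ} {A : Finset (Fin n)} {x y z w t a b : Fin n}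
  {Ty Tz : ℝ → ℝ} {R : List (Fin n)}

/-- The potential bounds the difference between the costs, for the requests `R`, of any two runs
whose sets of servers differ in one server. -/
def DiffBound (P : Fin n → ℝ) (κ : Fin n → ℕ) (Λ : ℝ) (R : List (Fin n)) : Prop :=
  ∀ (A : Finset (Fin n)) (a b : Fin n), a ∉ A → b ∉ A → a ≠ b → κ a = κ b →
    ∀ Ta Tb : ℝ → ℝ, Cert P κ Λ A a b Ta → Cert P κ Λ A b a Tb →
      |harmCost P κ (insert a A) R - harmCost P κ (insert b A) R|
        ≤ Ta |P b - P a| + Tb |P b - P a|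

/-- An exchange of a server `w` of `A` by `z` is an instance of `DiffBound`. -/
lemma DiffBound.move (h : DiffBound P κ Λ R) (hw : w ∈ A) (hz : z ∉ A) (hκ : κ w = κ z)
    (h1 : Cert P κ Λ (A.erase w) w z Ty) (h2 : Cert P κ Λ (A.erase w) z w Tz) :
    |harmCost P κ A R - harmCost P κ (insert z (A.erase w)) R|
      ≤ Ty |P z - P w| + Tz |P z - P w| := by
  have := h (A.erase w) w z (Finset.notMem_erase _ _)
    (fun h => hz (Finset.mem_of_mem_erase h)) (by rintro rfl; exact hz hw) hκ _ _ h1 h2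
  rwa [Finset.insert_erase hw] at this

/-- The case that the end point `y` lies in the gap of `x`, between `w` and `t`, and the server `t`
separates it from the other end point `z`. -/
lemma DiffBound.single (h : DiffBound P κ Λ R) (hP : StrictMono P)
    (hΛ : ∀ i j, κ i = κ j → 3 * |P i - P j| ≤ Λ) (hy : y ∉ A) (hz : z ∉ A) (hκy : κ y = κ x)
    (hκz : κ z = κ x) (hw : w ∈ A) (ht : t ∈ A) (hκw : κ w = κ x) (hκt : κ t = κ x)
    (hord : w < x ∧ x < t ∧ w < y ∧ y < t ∧ t < z ∧ (∀ e ∈ A, κ e = κ x → e ≤ w ∨ t ≤ e) ∨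
      z < t ∧ t < y ∧ y < w ∧ t < x ∧ x < w ∧ (∀ e ∈ A, κ e = κ x → e ≤ t ∨ w ≤ e))
    (h1 : Cert P κ Λ A y z Ty) (h2 : Cert P κ Λ A z y Tz) :
    |harmCost P κ (insert y A) (x :: R) - harmCost P κ (insert z A) (x :: R)|
      ≤ Ty |P z - P y| + Tz |P z - P y| := by
  have hbt : Btw y z t := by unfold Btw; grind
  have hbt' : Btw z y t := by unfold Btw; grind
  have haw : Away y z w := by unfold Away; grind
  have hyz : y ≠ z := by grind
  have hle : ∀ e ∈ A, |harmCost P κ (insert y (A.erase e)) R - harmCost P κ (insert z (A.erase e)) R|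
      ≤ Ty |P z - P y| + Tz |P z - P y| := fun e _ =>
    h _ _ _ (fun h => hy (Finset.mem_of_mem_erase h)) (fun h => hz (Finset.mem_of_mem_erase h)) hyz
      (hκy.trans hκz.symm) _ _ (h1.mono (Finset.erase_subset _ _))
      (h2.mono (Finset.erase_subset _ _))
  have hwD : |P z - P w| = |P z - P y| + |P w - P y| := by
    rcases hord with ⟨-, -, o1, o2, o3, -⟩ | ⟨o1, o2, o3, -, -, -⟩
    · have := hP o1; have := hP o2; have := hP o3
      rw [abs_of_pos (by linarith), abs_of_pos (by linarith), abs_of_neg (by linarith)]; ring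
    · have := hP o1; have := hP o2; have := hP o3
      rw [abs_of_neg (by linarith), abs_of_neg (by linarith), abs_of_pos (by linarith)]; ring
  have htD : |P z - P t| = |P z - P y| - |P t - P y| := by
    rcases hord with ⟨-, -, o1, o2, o3, -⟩ | ⟨o1, o2, o3, -, -, -⟩
    · have := hP o1; have := hP o2; have := hP o3
      rw [abs_of_pos (by linarith), abs_of_pos (by linarith), abs_of_pos (by linarith)]; ring
    · have := hP o1; have := hP o2; have := hP o3
      rw [abs_of_neg (by linarith), abs_of_neg (by linarith), abs_of_neg (by linarith)]; ring
  have hwt : |P w - P t| = |P w - P y| + |P t - P y| := by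
    rcases hord with ⟨-, -, o1, o2, o3, -⟩ | ⟨o1, o2, o3, -, -, -⟩
    · have := hP o1; have := hP o2; have := hP o3
      rw [abs_of_neg (by linarith), abs_of_neg (by linarith), abs_of_pos (by linarith)]; ring
    · have := hP o1; have := hP o2; have := hP o3
      rw [abs_of_pos (by linarith), abs_of_pos (by linarith), abs_of_neg (by linarith)]; ring
  have hp0 : 0 < |P w - P y| := abs_pos.2 (sub_ne_zero.2 (hP.injective.ne (by grind)))
  have hq0 : 0 < |P t - P y| := abs_pos.2 (sub_ne_zero.2 (hP.injective.ne (by grind)))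
  have hzt0 : 0 ≤ |P z - P t| := abs_nonneg _
  have key := h1.phi_two_le (abs_nonneg _) hw (hκw.trans hκy.symm) haw ht (hκt.trans hκy.symm) hbt
    (D := |P z - P y|)
  have hΛ' : 3 * (|P w - P y| + |P t - P y|) ≤ Λ := hwt ▸ hΛ w t (hκw.trans hκt.symm)
  -- the servers of `A` on the far side of `t`, and those on the far side of `w`
  have hfar : ∀ e ∈ A, κ e = κ x → (Btw w z e → |P w - P t| ≤ |P e - P w|) ∧
      (Away t z e → |P w - P t| ≤ |P e - P t|) := by
    intro e he hk
    unfold Btw Away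
    rcases hord with ⟨-, -, o1, o2, o3, hg⟩ | ⟨o1, o2, o3, -, -, hg⟩
    · have := hP (o1.trans o2)
      constructor
      · intro hb
        have h3 := hP.monotone ((hg e he hk).resolve_left (by grind))
        rw [abs_of_neg (by linarith), abs_of_pos (by linarith)]; linarith
      · intro hb
        have h3 := hP.monotone ((hg e he hk).resolve_right (by grind))
        rw [abs_of_neg (by linarith), abs_of_neg (by linarith)]; linarith
    · have := hP (o2.trans o3)
      constructor
      · intro hb
        have h3 := hP.monotone ((hg e he hk).resolve_right (by grind))
        rw [abs_of_pos (by linarith), abs_of_neg (by linarith)]; linarith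
      · intro hb
        have h3 := hP.monotone ((hg e he hk).resolve_left (by grind))
        rw [abs_of_pos (by linarith), abs_of_pos (by linarith)]; linarith
  have cw : Cert P κ Λ (A.erase w) w z (phi Λ (|P w - P y| + |P t - P y|) 0) := by
    have := Cert.two (P := P) (κ := κ) (Λ := Λ) (A := A.erase w) (y := w) (z := z) 0
      (|P w - P y| + |P t - P y|) le_rfl (by positivity) (by positivity) (by linarith)
      (by linarith) (fun _ _ _ _ => abs_nonneg _) (fun e he hk hb => by
        rw [← hwt]
        exact (hfar e (Finset.mem_of_mem_erase he) (hk.trans hκw)).1 hb)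
    simpa using this
  have ct : Cert P κ Λ (A.erase t) t z (phi Λ (|P w - P y| + |P t - P y|) 0) := by
    have := Cert.two (P := P) (κ := κ) (Λ := Λ) (A := A.erase t) (y := t) (z := z)
      (|P w - P y| + |P t - P y|) 0 (by positivity) le_rfl (by positivity) (by linarith)
      (by linarith) (fun e he hk hb => by
        rw [← hwt]
        exact (hfar e (Finset.mem_of_mem_erase he) (hk.trans hκt)).2 hb)
      (fun _ _ _ _ => abs_nonneg _)
    simpa using this
  have czw : Cert P κ Λ (A.erase w) z w Tz :=
    h2.move hP ht (hκt.trans hκz.symm) hbt' (Or.inr haw) (Finset.erase_subset _ _) (by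
      intro e he hk hb
      have hg := Finset.mem_of_mem_erase he
      rw [hκz] at hk
      unfold Btw at *
      grind)
  have czt : Cert P κ Λ (A.erase t) z t Tz :=
    h2.move hP ht (hκt.trans hκz.symm) hbt' (Or.inl rfl) (Finset.erase_subset _ _) (by
      intro e he hk hb
      unfold Btw at *
      grind)
  have hSw := h.move hw hz (hκw.trans hκz.symm) cw czw
  have hSt := h.move ht hz (hκt.trans hκz.symm) ct czt
  rw [hwD] at hSw
  rw [htD] at hSt hzt0
  have m1 := phi_move (Λ := Λ) hp0 hq0 (sub_nonneg.1 hzt0)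
  have m2 := h2.concave hp0.le hq0.le (sub_nonneg.1 hzt0)
  have m3 := mul_le_mul_of_nonneg_left key (add_pos hp0 hq0).le
  obtain ⟨Sw, hSw, St, hSt, hT⟩ : ∃ Sw, |harmCost P κ A R - harmCost P κ (insert z (A.erase w)) R|
      ≤ Sw ∧ ∃ St, |harmCost P κ A R - harmCost P κ (insert z (A.erase t)) R| ≤ St ∧
      |P t - P y| * Sw + |P w - P y| * St + 2 * |P w - P y| * |P t - P y|
        ≤ (|P w - P y| + |P t - P y|) * (Ty |P z - P y| + Tz |P z - P y|) :=
    ⟨_, hSw, _, hSt, by linarith⟩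
  generalize Ty |P z - P y| + Tz |P z - P y| = T at *
  rcases hord with ⟨x1, x2, o1, o2, o3, hg⟩ | ⟨o1, o2, o3, x1, x2, hg⟩
  · refine abs_harmCost_single_le hP hw ht hy hz hκw hκt hκy o1 o2 (Or.inr o3) x1 x2 hg
      (hle w hw) (hle t ht) hSw hSt ?_
    rw [abs_of_pos (by linarith [hP o2]), abs_of_neg (by linarith [hP o1])] at hT
    linarith
  · refine abs_harmCost_single_le hP ht hw hy hz hκt hκw hκy o2 o3 (Or.inl o1) x1 x2 hg
      (hle t ht) (hle w hw) hSt hSw ?_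
    rw [abs_of_neg (by linarith [hP o2]), abs_of_pos (by linarith [hP o3])] at hT
    linarith

/-- The case that the gap of `x` contains the end point `y` and extends infinitely beyond it, and
the server `t` separates `y` from the other end point `z`. -/
lemma DiffBound.single_free (h : DiffBound P κ Λ R) (hP : StrictMono P) (hy : y ∉ A)
    (hz : z ∉ A) (hκy : κ y = κ x) (hκz : κ z = κ x) (ht : t ∈ A) (hκt : κ t = κ x)
    (hord : x < t ∧ y < t ∧ t < z ∧ (∀ e ∈ A, κ e = κ x → t ≤ e) ∨
      z < t ∧ t < y ∧ t < x ∧ (∀ e ∈ A, κ e = κ x → e ≤ t))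
    (h1 : Cert P κ Λ A y z Ty) (h2 : Cert P κ Λ A z y Tz) :
    |harmCost P κ (insert y A) (x :: R) - harmCost P κ (insert z A) (x :: R)|
      ≤ Ty |P z - P y| + Tz |P z - P y| := by
  have hbt' : Btw z y t := by unfold Btw; grind
  have hyz : y ≠ z := by grind
  have hle : |harmCost P κ (insert y (A.erase t)) R - harmCost P κ (insert z (A.erase t)) R|
      ≤ Ty |P z - P y| + Tz |P z - P y| :=
    h _ _ _ (fun h => hy (Finset.mem_of_mem_erase h)) (fun h => hz (Finset.mem_of_mem_erase h)) hyz
      (hκy.trans hκz.symm) _ _ (h1.mono (Finset.erase_subset _ _))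
      (h2.mono (Finset.erase_subset _ _))
  have htD : |P z - P t| = |P z - P y| - |P t - P y| := by
    rcases hord with ⟨-, o2, o3, -⟩ | ⟨o1, o2, -⟩
    · have := hP o2; have := hP o3
      rw [abs_of_pos (by linarith), abs_of_pos (by linarith), abs_of_pos (by linarith)]; ring
    · have := hP o1; have := hP o2
      rw [abs_of_neg (by linarith), abs_of_neg (by linarith), abs_of_neg (by linarith)]; ring
  have ct : Cert P κ Λ (A.erase t) t z fun D => D := .free fun e he hk => by
    have := Finset.mem_of_mem_erase he
    rw [hκt] at hk
    unfold Away
    grind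
  have czt : Cert P κ Λ (A.erase t) z t Tz :=
    h2.move hP ht (hκt.trans hκz.symm) hbt' (Or.inl rfl) (Finset.erase_subset _ _) (by
      intro e he hk hb
      unfold Btw at *
      grind)
  have hSt := h.move ht hz (hκt.trans hκz.symm) ct czt
  have hq0 := abs_nonneg (P t - P y)
  have m1 := h1.le (abs_nonneg (P z - P y))
  have m2 := h2.apply_le (abs_nonneg (P z - P t)) (D' := |P z - P y|) (by linarith)
  rcases hord with ⟨x2, o2, o3, hg⟩ | ⟨o1, o2, x1, hg⟩
  · refine abs_harmCost_single_le_of_right hP ht hy hz hκt hκy o2 o3 x2 hg hle hSt ?_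
    have e2 : |P t - P y| = P t - P y := by rw [abs_of_pos (by linarith [hP o2])]
    linarith
  · refine abs_harmCost_single_le_of_left hP ht hy hz hκt hκy o2 o1 x1 hg hle hSt ?_
    have e2 : |P t - P y| = P y - P t := by rw [abs_of_neg (by linarith [hP o2])]; ring
    linarith

/-- The case that there is no server between the end points: the end point `y` moves to `w`. -/
lemma DiffBound.double (h : DiffBound P κ Λ R) (hP : StrictMono P)
    (hΛ : ∀ i j, κ i = κ j → 3 * |P i - P j| ≤ Λ) (hz : z ∉ A) (hκy : κ y = κ x)
    (hκz : κ z = κ x) (hw : w ∈ A) (hκw : κ w = κ x) (haw : Away y z w)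
    (hgap : ∀ e ∈ A, κ e = κ x → ¬ Btw w z e)
    (hr : (∃ r ∈ A, κ r = κ x ∧ Away z y r ∧
        ∀ e ∈ A, κ e = κ x → Away z y e → |P r - P z| ≤ |P e - P z|) ∨
      ∀ e ∈ A, κ e = κ x → ¬ Away z y e)
    (h1 : Cert P κ Λ A y z Ty) (h2 : Cert P κ Λ A z y Tz) :
    ∃ S, |harmCost P κ A R - harmCost P κ (insert z (A.erase w)) R| ≤ S ∧
      |P z - P y| * S + 2 * |P z - P y| * |P w - P y|
        ≤ |P z - P w| * (Ty |P z - P y| + Tz |P z - P y|) := by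
  have hwD : |P z - P w| = |P z - P y| + |P w - P y| := by
    rcases haw with ⟨o1, o2⟩ | ⟨o1, o2⟩
    · have := hP o1; have := hP o2
      rw [abs_of_pos (by linarith), abs_of_pos (by linarith), abs_of_neg (by linarith)]; ring
    · have := hP o1; have := hP o2
      rw [abs_of_neg (by linarith), abs_of_neg (by linarith), abs_of_pos (by linarith)]; ring
  have hD0 : 0 < |P z - P y| :=
    abs_pos.2 (sub_ne_zero.2 (hP.injective.ne (by unfold Away at haw; grind)))
  have hp0 := abs_nonneg (P w - P y)
  have hs := phi_star_gain (Λ := Λ) hp0 hD0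
  have hy1 := h1.phi_one_le (abs_nonneg (P z - P y)) hw (hκw.trans hκy.symm) haw
  have hside : ∀ e, Away z w e → Away z y e := by
    intro e he
    unfold Away at *
    grind
  have cw : Cert P κ Λ (A.erase w) w z (phi Λ (|P w - P y| + |P z - P y|) 0) := by
    have e : |P w - P y| + |P z - P y| = 0 + |P z - P w| := by rw [hwD]; ring
    rw [e]
    refine .one 0 le_rfl (by linarith) ?_ (fun _ _ _ _ => abs_nonneg _) fun e he hk => ?_
    · rw [zero_add]; exact hΛ _ _ (hκz.trans hκw.symm)
    · exact hgap e (Finset.mem_of_mem_erase he) (hk.trans hκw)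
  have hfin : ∀ F : ℝ, |harmCost P κ A R - harmCost P κ (insert z (A.erase w)) R|
      ≤ phi Λ (|P w - P y| + |P z - P y|) 0 |P z - P w| + F →
      |P z - P y| * F ≤ |P z - P w| * Tz |P z - P y| →
      ∃ S, |harmCost P κ A R - harmCost P κ (insert z (A.erase w)) R| ≤ S ∧
      |P z - P y| * S + 2 * |P z - P y| * |P w - P y|
        ≤ |P z - P w| * (Ty |P z - P y| + Tz |P z - P y|) := by
    intro F hF1 hF2
    refine ⟨_, hF1, ?_⟩
    have := mul_le_mul_of_nonneg_left hy1 (abs_nonneg (P z - P w))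
    rw [hwD] at *
    linarith
  rcases hr with ⟨r, hr, hκr, har, hrmin⟩ | hr
  · have h3 : 3 * (|P r - P z| + |P w - P z|) ≤ Λ := by
      have e : |P r - P z| + |P w - P z| = |P r - P w| := by
        unfold Away at *
        rcases haw with ⟨o1, o2⟩ | ⟨o1, o2⟩ <;> rcases har with ⟨o3, o4⟩ | ⟨o3, o4⟩
        · exact absurd o4 o2.not_gt
        · have := hP o1; have := hP o2; have := hP o3; have := hP o4
          rw [abs_of_pos (by linarith), abs_of_neg (by linarith), abs_of_pos (by linarith)]; ring
        · have := hP o1; have := hP o2; have := hP o3; have := hP o4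
          rw [abs_of_neg (by linarith), abs_of_pos (by linarith), abs_of_neg (by linarith)]; ring
        · exact absurd o1 o3.not_gt
      rw [e]
      exact hΛ _ _ (hκr.trans hκw.symm)
    rw [abs_sub_comm (P w) (P z)] at h3
    have hr0 := abs_nonneg (P r - P z)
    have hz1 := h2.phi_one_le (abs_nonneg (P z - P y)) hr (hκr.trans hκz.symm) har
    rw [abs_sub_comm (P y) (P z)] at hz1
    have cz : Cert P κ Λ (A.erase w) z w (phi Λ (|P r - P z| + |P w - P z|) 0) := by
      refine .one _ hr0 ?_ ?_ (fun e he hk ha => ?_) fun e he hk hb => ?_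
      · rw [abs_sub_comm (P w)]; linarith
      · rw [abs_sub_comm (P w)]; exact h3
      · exact hrmin e (Finset.mem_of_mem_erase he) (hk.trans hκz) (hside e ha)
      · refine hgap e (Finset.mem_of_mem_erase he) (hk.trans hκz) ?_
        unfold Btw at *
        exact hb.symm
    refine hfin _ (h.move hw hz (hκw.trans hκz.symm) cw cz) ?_
    rw [abs_sub_comm (P w)]
    calc |P z - P y| * phi Λ (|P r - P z| + |P z - P w|) 0 |P z - P w|
        ≤ |P z - P y| * phi Λ (|P r - P z| + |P z - P y|) 0 |P z - P w| := by
          refine mul_le_mul_of_nonneg_left (phi_mono ?_ ?_ ?_ le_rfl ?_ ?_) hD0.le <;> linarith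
      _ ≤ |P z - P w| * phi Λ (|P r - P z| + |P z - P y|) 0 |P z - P y| :=
          phi_star (by linarith) le_rfl hD0 (by linarith)
      _ ≤ _ := mul_le_mul_of_nonneg_left hz1 (abs_nonneg _)
  · have cz : Cert P κ Λ (A.erase w) z w fun D => D := .free fun e he hk ha =>
      hr e (Finset.mem_of_mem_erase he) (hk.trans hκz) (hside e ha)
    refine hfin _ (h.move hw hz (hκw.trans hκz.symm) cw cz) ?_
    rw [mul_comm]
    exact mul_le_mul_of_nonneg_left (h2.le hD0.le) (abs_nonneg _)

end main

section main

variable {P : Fin n → ℝ} {κ : Fin n → ℕ} {Λ : ℝ} {A : Finset (Fin n)} {x a b : Fin n}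
  {Ta Tb : ℝ → ℝ} {R : List (Fin n)}

/-- The induction step of `diffBound`: the cases differ in which end points of the discrepancy lie
in the gap of `x`. -/
lemma DiffBound.cons_of_lt (h : DiffBound P κ Λ R) (hP : StrictMono P)
    (hΛ : ∀ i j, κ i = κ j → 3 * |P i - P j| ≤ Λ) (ha : a ∉ A) (hb : b ∉ A) (hab : a < b)
    (hκ : κ a = κ b) (h1 : Cert P κ Λ A a b Ta) (h2 : Cert P κ Λ A b a Tb) :
    |harmCost P κ (insert a A) (x :: R) - harmCost P κ (insert b A) (x :: R)|
      ≤ Ta |P b - P a| + Tb |P b - P a| := by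
  have hle : ∀ e ∈ A, |harmCost P κ (insert a (A.erase e)) R - harmCost P κ (insert b (A.erase e)) R|
      ≤ Ta |P b - P a| + Tb |P b - P a| := fun e _ =>
    h _ _ _ (fun h => ha (Finset.mem_of_mem_erase h)) (fun h => hb (Finset.mem_of_mem_erase h))
      hab.ne hκ _ _ (h1.mono (Finset.erase_subset _ _)) (h2.mono (Finset.erase_subset _ _))
  have hle' := h _ _ _ ha hb hab.ne hκ _ _ h1 h2
  have hsame := abs_harmCost_same_le (x := x) hP ha hb hle hle'
  by_cases hκx : κ a = κ x
  swap
  · exact hsame (Or.inl ⟨hκx, hκ ▸ hκx⟩)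
  have hκb : κ b = κ x := hκ ▸ hκx
  by_cases hx : x ∈ A
  · exact hsame (Or.inr (Or.inl hx))
  have hsym : ∀ {c : ℝ → ℝ} {c' : ℝ → ℝ},
      |harmCost P κ (insert b A) (x :: R) - harmCost P κ (insert a A) (x :: R)|
        ≤ c |P a - P b| + c' |P a - P b| →
      |harmCost P κ (insert a A) (x :: R) - harmCost P κ (insert b A) (x :: R)|
        ≤ c' |P b - P a| + c |P b - P a| := fun H => by
    rw [abs_sub_comm, add_comm, abs_sub_comm (P b)]; exact H
  have hne : ∀ e ∈ A, e ≠ a ∧ e ≠ b := fun e he =>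
    ⟨fun h => ha (h ▸ he), fun h => hb (h ▸ he)⟩
  have hPab := hP hab
  have habs : |P b - P a| = P b - P a := abs_of_pos (by linarith)
  have hDle : P b - P a ≤ Ta |P b - P a| + Tb |P b - P a| := by
    have := h1.le (abs_nonneg (P b - P a))
    have := h2.le (abs_nonneg (P b - P a))
    linarith
  rcases exists_left (fun e => κ e = κ x) hx with ⟨l, hl, hκl, hlx, hgl⟩ | hgl <;>
    rcases exists_right (fun e => κ e = κ x) hx with ⟨r, hr, hκr, hxr, hgr⟩ | hgr
  · have hg : ∀ e ∈ A, κ e = κ x → e ≤ l ∨ r ≤ e := by grind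
    have := hne l hl
    have := hne r hr
    by_cases hbl : b < l
    · exact hsame (Or.inr (Or.inr (Or.inr (Or.inr ⟨l, hl, r, hr, hκl, hκr, hlx, hxr, hg,
        Or.inl (hab.trans hbl), Or.inl hbl⟩))))
    by_cases hra : r < a
    · exact hsame (Or.inr (Or.inr (Or.inr (Or.inr ⟨l, hl, r, hr, hκl, hκr, hlx, hxr, hg,
        Or.inr hra, Or.inr (hra.trans hab)⟩))))
    by_cases hal : a < l
    · by_cases hrb : r < b
      · exact hsame (Or.inr (Or.inr (Or.inr (Or.inr ⟨l, hl, r, hr, hκl, hκr, hlx, hxr, hg,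
          Or.inl hal, Or.inr hrb⟩))))
      · exact hsym (h.single hP hΛ hb ha hκb hκx hr hl hκr hκl
          (Or.inr ⟨hal, by grind, by grind, hlx, hxr, hg⟩) h2 h1)
    · by_cases hrb : r < b
      · exact h.single hP hΛ ha hb hκx hκb hl hr hκl hκr
          (Or.inl ⟨hlx, hxr, by grind, by grind, hrb, hg⟩) h1 h2
      · have hla : l < a := by grind
        have hbr : b < r := by grind
        have hL := h.double hP hΛ hb hκx hκb hl hκl (Or.inl ⟨hla, hab⟩)
          (by unfold Btw; grind) (Or.inl ⟨r, hr, hκr, Or.inr ⟨hab, hbr⟩, by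
            intro e he hk haw
            have h3 := hP.monotone ((hg e he hk).resolve_left (by unfold Away at haw; grind))
            have := hP hbr
            rw [abs_of_pos (by linarith), abs_of_pos (by linarith)]
            linarith⟩) h1 h2
        have hR := h.double hP hΛ ha hκb hκx hr hκr (Or.inr ⟨hab, hbr⟩)
          (by unfold Btw; grind) (Or.inl ⟨l, hl, hκl, Or.inl ⟨hla, hab⟩, by
            intro e he hk haw
            have h3 := hP.monotone ((hg e he hk).resolve_right (by unfold Away at haw; grind))
            have := hP hla
            rw [abs_of_neg (by linarith), abs_of_neg (by linarith)]
            linarith⟩) h2 h1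
        have q1 := hP hla
        have q2 := hP hbr
        refine abs_harmCost_double_le hP ha hb hκx hκb hab ?_
          (Or.inl ⟨l, hl, hκl, hla, hlx, by grind, hle l hl, ?_⟩)
          (Or.inl ⟨r, hr, hκr, hbr, hxr, by grind, hle r hr, ?_⟩)
        · exact hDle
        · obtain ⟨S, hS, hS'⟩ := hL
          refine ⟨S, hS, ?_⟩
          generalize Ta |P b - P a| + Tb |P b - P a| = T at *
          rwa [habs, abs_of_neg (by linarith), neg_sub, abs_of_pos (by linarith)] at hS'
        · obtain ⟨S, hS, hS'⟩ := hR
          refine ⟨S, hS, ?_⟩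
          rw [abs_sub_comm (P a) (P b), add_comm (Tb _)] at hS'
          generalize Ta |P b - P a| + Tb |P b - P a| = T at *
          rwa [habs, abs_of_pos (by linarith), abs_of_neg (by linarith), neg_sub] at hS'
  · have hg : ∀ e ∈ A, κ e = κ x → e ≤ l := by grind
    have := hne l hl
    by_cases hbl : b < l
    · exact hsame (Or.inr (Or.inr (Or.inl ⟨l, hl, hκl, hlx, hg, hab.trans hbl, hbl⟩)))
    by_cases hal : a < l
    · exact hsym (h.single_free hP hb ha hκb hκx hl hκl
          (Or.inr ⟨hal, by grind, hlx, hg⟩) h2 h1)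
    · have hla : l < a := by grind
      have hL := h.double hP hΛ hb hκx hκb hl hκl (Or.inl ⟨hla, hab⟩)
          (by unfold Btw; grind) (Or.inr (by unfold Away; grind)) h1 h2
      have q1 := hP hla
      refine abs_harmCost_double_le hP ha hb hκx hκb hab ?_
          (Or.inl ⟨l, hl, hκl, hla, hlx, by grind, hle l hl, ?_⟩)
          (Or.inr (by grind))
      · exact hDle
      · obtain ⟨S, hS, hS'⟩ := hL
        refine ⟨S, hS, ?_⟩
        generalize Ta |P b - P a| + Tb |P b - P a| = T at *
        rwa [habs, abs_of_neg (by linarith), neg_sub, abs_of_pos (by linarith)] at hS'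
  · have hg : ∀ e ∈ A, κ e = κ x → r ≤ e := by grind
    have := hne r hr
    by_cases hra : r < a
    · exact hsame (Or.inr (Or.inr (Or.inr (Or.inl ⟨r, hr, hκr, hxr, hg, hra, hra.trans hab⟩))))
    by_cases hrb : r < b
    · exact h.single_free hP ha hb hκx hκb hr hκr
          (Or.inl ⟨hxr, by grind, hrb, hg⟩) h1 h2
    · have hbr : b < r := by grind
      have hR := h.double hP hΛ ha hκb hκx hr hκr (Or.inr ⟨hab, hbr⟩)
          (by unfold Btw; grind) (Or.inr (by unfold Away; grind)) h2 h1
      have q2 := hP hbr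
      refine abs_harmCost_double_le hP ha hb hκx hκb hab ?_
          (Or.inr (by grind))
          (Or.inl ⟨r, hr, hκr, hbr, hxr, by grind, hle r hr, ?_⟩)
      · exact hDle
      · obtain ⟨S, hS, hS'⟩ := hR
        refine ⟨S, hS, ?_⟩
        rw [abs_sub_comm (P a) (P b), add_comm (Tb _)] at hS'
        generalize Ta |P b - P a| + Tb |P b - P a| = T at *
        rwa [habs, abs_of_pos (by linarith), abs_of_neg (by linarith), neg_sub] at hS'
  · have hno : ∀ e ∈ A, κ e ≠ κ x := by grind
    refine abs_harmCost_double_le hP ha hb hκx hκb hab ?_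
      (Or.inr fun e he hk => absurd hk (hno e he)) (Or.inr fun e he hk => absurd hk (hno e he))
    exact hDle

/-- Two runs of the harmonic algorithm that differ in one server have nearly the same cost. -/
theorem diffBound (hP : StrictMono P) (hΛ : ∀ i j, κ i = κ j → 3 * |P i - P j| ≤ Λ)
    (R : List (Fin n)) : DiffBound P κ Λ R := by
  induction R with
  | nil =>
    intro A a b ha hb hab hκ Ta Tb h1 h2
    have := h1.le (abs_nonneg (P b - P a))
    have := h2.le (abs_nonneg (P b - P a))
    have := abs_nonneg (P b - P a)
    simp only [harmCost, sub_self, abs_zero]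
    linarith
  | cons x R ih =>
    intro A a b ha hb hab hκ Ta Tb h1 h2
    rcases hab.lt_or_gt with h | h
    · exact ih.cons_of_lt hP hΛ ha hb h hκ h1 h2
    · rw [abs_sub_comm, add_comm, abs_sub_comm (P b)]
      exact ih.cons_of_lt hP hΛ hb ha h hκ.symm h2 h1

/-- If distinct servers have distance at least `η`, then an exchange of one server by another one
changes the cost by at most a logarithmic factor times their distance. -/
lemma abs_harmCost_insert_le {η : ℝ} (hη : 0 < η) (hP : StrictMono P)
    (hΛ : ∀ i j, κ i = κ j → 3 * |P i - P j| ≤ Λ) (hηP : ∀ i j, i ≠ j → η ≤ |P i - P j|)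
    (hηΛ : 3 * η ≤ Λ) (R : List (Fin n)) (ha : a ∉ A) (hb : b ∉ A) (hκ : κ a = κ b) :
    |harmCost P κ (insert a A) R - harmCost P κ (insert b A) R|
      ≤ (28 * Real.log (Λ / η) + 16) * |P a - P b| := by
  have hlog : 0 ≤ Real.log (Λ / η) :=
    Real.log_nonneg (by rw [le_div_iff₀ hη]; linarith)
  by_cases hab : a = b
  · subst hab
    simp
  have hc : ∀ y z : Fin n, y ∉ A → Cert P κ Λ A y z (phi Λ η 0) := fun y z hy => by
    have := Cert.two (P := P) (κ := κ) (Λ := Λ) (A := A) (y := y) (z := z) η 0 hη.le le_rfl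
      (by linarith) (abs_nonneg _) (by linarith)
      (fun e he _ _ => hηP e y fun h => hy (h ▸ he)) fun _ _ _ _ => abs_nonneg _
    simpa using this
  have h1 := diffBound hP hΛ R A a b ha hb hab hκ _ _ (hc a b ha) (hc b a hb)
  rw [abs_sub_comm (P b)] at h1
  refine h1.trans ?_
  have h2 : phi Λ η 0 |P a - P b| ≤ (14 * Real.log (Λ / η) + 8) * |P a - P b| := by
    have hD := abs_nonneg (P a - P b)
    unfold phi
    have : |P a - P b| / (η + |P a - P b|) * (8 * η + 6 * 0) ≤ 8 * |P a - P b| := by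
      rw [div_mul_eq_mul_div, div_le_iff₀ (by positivity)]
      nlinarith
    linarith
  linarith

/-- The expected distance of a harmonic move is at most twice the distance to any given server. -/
lemma harmExp_le {f : Fin n → ℝ} {o : Fin n} {c d : ℝ} (hP : StrictMono P) {I : Finset (Fin n)}
    (ho : o ∈ I) (hκ : κ o = κ x) (hd : 0 ≤ d) (hf : ∀ g ∈ I, κ g = κ x → f g ≤ c + d * |P x - P g|) :
    harmExp P κ I x f ≤ c + 2 * d * |P x - P o| := by
  have ho' := abs_nonneg (P x - P o)
  by_cases hx : x ∈ I
  · rw [harmExp_mem hx]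
    have := hf x hx rfl
    rw [sub_self, abs_zero, mul_zero] at this
    nlinarith
  have hone : ∀ g ∈ I, κ g = κ x → |P x - P g| ≤ |P x - P o| → f g ≤ c + 2 * d * |P x - P o| := by
    intro g hg hk h
    have h1 := hf g hg hk
    have h2 := mul_le_mul_of_nonneg_left h hd
    have h3 := mul_nonneg hd ho'
    linarith
  rcases exists_left (fun e => κ e = κ x) hx with ⟨l, hl, hκl, hlx, hgl⟩ | hgl <;>
    rcases exists_right (fun e => κ e = κ x) hx with ⟨r, hr, hκr, hxr, hgr⟩ | hgr
  · rw [harmExp_both hl hr hκl hκr hlx hxr (by grind)]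
    have h1 := hf l hl hκl
    have h2 := hf r hr hκr
    have p1 := hP hlx
    have p2 := hP hxr
    rw [abs_of_pos (by linarith)] at h1
    rw [abs_of_neg (by linarith), neg_sub] at h2
    rw [div_le_iff₀ (by linarith)]
    have q1 : 0 < P r - P x := by linarith
    have q2 : 0 < P x - P l := by linarith
    have m1 := mul_le_mul_of_nonneg_left h1 q1.le
    have m2 := mul_le_mul_of_nonneg_left h2 q2.le
    have m3 : (P r - P x) * (P x - P l) ≤ (P r - P l) * |P x - P o| := by
      rcases hgl o ho hκ with h | h
      · have := hP.monotone h
        rw [abs_of_pos (by linarith)]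
        nlinarith
      · have := hP.monotone ((hgr o ho hκ).resolve_left h.not_gt)
        rw [abs_of_neg (by linarith)]
        nlinarith
    have m4 := mul_le_mul_of_nonneg_left m3 hd
    nlinarith
  · rw [harmExp_left hl hκl hlx (by grind)]
    refine hone l hl hκl ?_
    have := hP.monotone ((hgl o ho hκ).resolve_right (hgr o ho hκ).not_gt)
    have := hP hlx
    rw [abs_of_pos (by linarith), abs_of_pos (by linarith)]
    linarith
  · rw [harmExp_right hr hκr hxr (by grind)]
    refine hone r hr hκr ?_
    have := hP.monotone ((hgr o ho hκ).resolve_left (hgl o ho hκ).not_gt)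
    have := hP hxr
    rw [abs_of_neg (by linarith), abs_of_neg (by linarith)]
    linarith
  · exact absurd (hgl o ho hκ) (hgr o ho hκ).not_gt

/-- The harmonic algorithm is competitive against the matching of the requests `R` to the distinct
servers `O`: the requests are switched from the matching to the harmonic algorithm one by one. -/
theorem harmCost_le {η : ℝ} (hη : 0 < η) (hP : StrictMono P)
    (hΛ : ∀ i j, κ i = κ j → 3 * |P i - P j| ≤ Λ) (hηP : ∀ i j, i ≠ j → η ≤ |P i - P j|)
    (hηΛ : 3 * η ≤ Λ) {R O : List (Fin n)} (hRO : List.Forall₂ (fun x o => κ x = κ o) R O)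
    (hO : O.Nodup) {I : Finset (Fin n)} (hI : ∀ o ∈ O, o ∈ I) :
    harmCost P κ I R ≤ (3 * (28 * Real.log (Λ / η) + 16) + 2)
      * (List.zipWith (fun x o => |P x - P o|) R O).sum := by
  induction hRO generalizing I with
  | nil => simp [harmCost]
  | @cons x o R O hκ _ ih =>
    rw [List.nodup_cons] at hO
    have hoI : o ∈ I := hI o (by simp)
    have hih := ih hO.2 (I := I.erase o) fun o' ho' =>
      Finset.mem_erase.2 ⟨fun h => hO.1 (h ▸ ho'), hI o' (by simp [ho'])⟩
    have hlog : 0 ≤ Real.log (Λ / η) :=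
      Real.log_nonneg (by rw [le_div_iff₀ hη]; linarith)
    set C := 28 * Real.log (Λ / η) + 16 with hC
    have hC0 : 0 ≤ C := by positivity
    have hstep : harmCost P κ I (x :: R)
        ≤ (C * |P x - P o| + harmCost P κ (I.erase o) R) + 2 * (1 + C) * |P x - P o| := by
      rw [harmCost]
      refine harmExp_le hP hoI hκ.symm (by positivity) fun g hg hk => ?_
      have hdiff : |harmCost P κ (I.erase g) R - harmCost P κ (I.erase o) R|
          ≤ C * |P o - P g| := by
        by_cases hgo : g = o
        · subst hgo
          simp
        have := abs_harmCost_insert_le (A := (I.erase o).erase g) (a := o) (b := g) hη hP hΛ hηP hηΛ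
          R (by simp) (by simp) (hκ.symm.trans hk.symm)
        rwa [Finset.insert_erase (Finset.mem_erase.2 ⟨hgo, hg⟩), Finset.erase_right_comm,
          Finset.insert_erase (Finset.mem_erase.2 ⟨Ne.symm hgo, hoI⟩)] at this
      have h1 := (abs_le.1 hdiff).2
      have h2 : |P o - P g| ≤ |P x - P o| + |P x - P g| := by
        rw [abs_sub_comm (P x) (P o)]
        exact abs_sub_le _ _ _
      have h3 := mul_le_mul_of_nonneg_left h2 hC0
      linarith
    simp only [List.zipWith_cons_cons, List.sum_cons]
    linarith

end main

/-! ### Expectations -/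

/-- The expectation of an extended nonnegative function. -/
noncomputable def expect {α : Type*} (p : PMF α) (f : α → ℝ≥0∞) : ℝ≥0∞ := ∑' a, p a * f a

section expect

variable {α β : Type*}

lemma expect_pure (a : α) (f : α → ℝ≥0∞) : expect (PMF.pure a) f = f a := by
  unfold expect
  rw [tsum_eq_single a]
  · simp
  · intro b hb
    simp [PMF.pure_apply, hb]

lemma expect_bind (p : PMF α) (q : α → PMF β) (f : β → ℝ≥0∞) :
    expect (p.bind q) f = expect p fun a => expect (q a) f := by
  unfold expect
  simp_rw [PMF.bind_apply, ← ENNReal.tsum_mul_right, ← ENNReal.tsum_mul_left]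
  rw [ENNReal.tsum_comm]
  simp_rw [mul_assoc]

lemma expect_map (p : PMF α) (g : α → β) (f : β → ℝ≥0∞) :
    expect (p.map g) f = expect p fun a => f (g a) := by
  rw [← PMF.bind_pure_comp, expect_bind]
  simp [expect_pure]

lemma expect_mono {p : PMF α} {f g : α → ℝ≥0∞} (h : ∀ a ∈ p.support, f a ≤ g a) :
    expect p f ≤ expect p g := by
  refine ENNReal.tsum_le_tsum fun a => ?_
  by_cases ha : p a = 0
  · simp [ha]
  · gcongr
    exact h a ((PMF.mem_support_iff _ _).2 ha)

lemma expect_congr {p : PMF α} {f g : α → ℝ≥0∞} (h : ∀ a ∈ p.support, f a = g a) :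
    expect p f = expect p g :=
  le_antisymm (expect_mono fun a ha => (h a ha).le) (expect_mono fun a ha => (h a ha).ge)

lemma expect_add (p : PMF α) (f g : α → ℝ≥0∞) :
    (expect p fun a => f a + g a) = expect p f + expect p g := by
  unfold expect
  simp_rw [mul_add]
  exact ENNReal.tsum_add

lemma expect_const_mul (p : PMF α) (c : ℝ≥0∞) (f : α → ℝ≥0∞) :
    (expect p fun a => c * f a) = c * expect p f := by
  unfold expect
  rw [← ENNReal.tsum_mul_left]
  exact tsum_congr fun a => by ring

lemma expect_const (p : PMF α) (c : ℝ≥0∞) : (expect p fun _ => c) = c := by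
  unfold expect
  rw [ENNReal.tsum_mul_right, p.tsum_coe, one_mul]

lemma expect_coin (p : ℝ≥0∞) (a b : α) (f : α → ℝ≥0∞) :
    expect (coin p a b) f = min p 1 * f b + (1 - min p 1) * f a := by
  unfold coin
  rw [expect_map]
  unfold expect
  rw [tsum_fintype, Fintype.sum_bool]
  simp

end expect

/-! ### The pseudo-distance as a distance on a line with components -/

/-- The distance between the servers `k` and `k + 1`; zero for the last server. -/
noncomputable def edgeLen (s : Fin n → ℝ) (k : Fin n) : ℝ :=
  if h : (k : ℕ) + 1 < n then s ⟨k + 1, h⟩ - s k else 0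

lemma sum_edgeLen (s : Fin n → ℝ) {i j : Fin n} (hij : i ≤ j) :
    ∑ k ∈ Finset.Ico i j, edgeLen s k = s j - s i := by
  let S : ℕ → ℝ := fun m => if h : m < n then s ⟨m, h⟩ else 0
  have h1 : ∑ k ∈ Finset.Ico i j, edgeLen s k = ∑ m ∈ Finset.Ico (i : ℕ) j, (S (m + 1) - S m) := by
    rw [← Fin.map_valEmbedding_Ico, Finset.sum_map]
    refine Finset.sum_congr rfl fun k hk => ?_
    have hk' : (k : ℕ) + 1 < n := by
      have := (Finset.mem_Ico.1 hk).2
      have := j.2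
      omega
    simp [edgeLen, S, hk']
  rw [h1, Finset.sum_Ico_sub _ hij]
  simp [S]

lemma edgeLen_nonneg {s : Fin n → ℝ} (hs : StrictMono s) (k : Fin n) : 0 ≤ edgeLen s k := by
  unfold edgeLen
  split_ifs with h
  · have : s k < s ⟨k + 1, h⟩ := hs (Fin.lt_def.2 (Nat.lt_succ_self _))
    linarith
  · exact le_rfl

/-- The length of the edge between the servers `k` and `k + 1` for the pseudo-distance, an infinite
length being replaced by the estimate `Z`. -/
noncomputable def pseudoLen (s : Fin n → ℝ) (Z : ℝ) (k : Fin n) : ℝ :=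
  min Z (max (edgeLen s k) (Z / (n : ℝ) ^ 2))

/-- The position of a server on the line when the edges have their pseudo-lengths. -/
noncomputable def pseudoPos (s : Fin n → ℝ) (Z : ℝ) (i : Fin n) : ℝ :=
  ∑ k ∈ Finset.Iio i, pseudoLen s Z k

open Classical in
/-- The number of the component of a server: the edges of infinite pseudo-length are cut. -/
noncomputable def component (s : Fin n → ℝ) (Z : ℝ) (i : Fin n) : ℕ :=
  ((Finset.Iio i).filter fun k => Z ≤ edgeLen s k).card

section pseudo

variable {s : Fin n → ℝ} {Z : ℝ} {i j : Fin n}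

lemma pseudoPos_sub (hij : i ≤ j) :
    pseudoPos s Z j - pseudoPos s Z i = ∑ k ∈ Finset.Ico i j, pseudoLen s Z k := by
  have : Finset.Iio j = Finset.Iio i ∪ Finset.Ico i j := by
    ext k
    simp only [Finset.mem_Iio, Finset.mem_union, Finset.mem_Ico]
    grind
  unfold pseudoPos
  rw [this, Finset.sum_union]
  · ring
  · rw [Finset.disjoint_left]
    intro k hk hk'
    simp only [Finset.mem_Iio, Finset.mem_Ico] at hk hk'
    exact absurd hk hk'.1.not_gt

lemma component_mono (s : Fin n → ℝ) (Z : ℝ) : Monotone (component s Z) := fun _ _ hij =>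
  Finset.card_le_card (Finset.filter_subset_filter _ (Finset.Iio_subset_Iio hij))

lemma component_eq_iff (hij : i ≤ j) :
    component s Z i = component s Z j ↔ ∀ k ∈ Finset.Ico i j, edgeLen s k < Z := by
  classical
  constructor
  · intro h k hk
    by_contra hc
    rw [not_lt] at hc
    rw [Finset.mem_Ico] at hk
    refine h.not_lt (Finset.card_lt_card ?_)
    refine (Finset.ssubset_iff_of_subset
      (Finset.filter_subset_filter _ (Finset.Iio_subset_Iio hij))).2 ⟨k, ?_, ?_⟩
    · simp [hk.2, hc]
    · simp [hk.1]
  · intro h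
    unfold component
    congr 1
    ext k
    simp only [Finset.mem_filter, Finset.mem_Iio]
    constructor
    · exact fun ⟨h1, h2⟩ => ⟨h1.trans_le hij, h2⟩
    · rintro ⟨h1, h2⟩
      refine ⟨?_, h2⟩
      by_contra hc
      exact absurd (h k (Finset.mem_Ico.2 ⟨not_lt.1 hc, h1⟩)) h2.not_gt

lemma div_sq_le (hZ : 0 < Z) (k : Fin n) : Z / (n : ℝ) ^ 2 ≤ Z := by
  have : (1 : ℝ) ≤ n := by exact_mod_cast (Nat.one_le_iff_ne_zero.2 (by have := k.2; omega))
  exact div_le_self hZ.le (one_le_pow₀ this)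

lemma div_sq_pos (hZ : 0 < Z) (k : Fin n) : 0 < Z / (n : ℝ) ^ 2 := by
  have : (1 : ℝ) ≤ n := by exact_mod_cast (Nat.one_le_iff_ne_zero.2 (by have := k.2; omega))
  positivity

lemma le_pseudoLen (hZ : 0 < Z) (k : Fin n) : Z / (n : ℝ) ^ 2 ≤ pseudoLen s Z k :=
  le_min (div_sq_le hZ k) (le_max_right _ _)

lemma pseudoLen_pos (hZ : 0 < Z) (k : Fin n) : 0 < pseudoLen s Z k :=
  (div_sq_pos hZ k).trans_le (le_pseudoLen hZ k)

lemma pseudoPos_strictMono (hZ : 0 < Z) : StrictMono (pseudoPos s Z) := fun i j hij => by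
  rw [← sub_pos, pseudoPos_sub hij.le]
  exact Finset.sum_pos (fun k _ => pseudoLen_pos hZ k) ⟨i, Finset.mem_Ico.2 ⟨le_rfl, hij⟩⟩

lemma pseudoDist_comm (i j : Fin n) : pseudoDist s Z i j = pseudoDist s Z j i := by
  unfold pseudoDist
  rw [min_comm, max_comm]

lemma adjPseudoDist_eq_top (h : (i : ℕ) + 1 < n) (hi : Z ≤ edgeLen s i) :
    adjPseudoDist s Z i = ⊤ := by
  unfold adjPseudoDist
  unfold edgeLen at hi
  simp only [h, dite_true] at hi ⊢
  rw [if_pos hi]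

lemma adjPseudoDist_eq (h : (i : ℕ) + 1 < n) (hZ : 0 < Z) (hi : edgeLen s i < Z) :
    adjPseudoDist s Z i = ENNReal.ofReal (pseudoLen s Z i) := by
  have h1 : pseudoLen s Z i = max (edgeLen s i) (Z / (n : ℝ) ^ 2) :=
    min_eq_right (max_le hi.le (div_sq_le hZ i))
  rw [h1]
  unfold adjPseudoDist
  unfold edgeLen at hi ⊢
  simp only [h, dite_true] at hi ⊢
  rw [if_neg hi.not_ge]
  split_ifs with h2
  · rw [max_eq_right h2]
  · rw [max_eq_left (not_le.1 h2).le]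

lemma lt_of_mem_Ico {k : Fin n} (hk : k ∈ Finset.Ico i j) : (k : ℕ) + 1 < n := by
  have := (Finset.mem_Ico.1 hk).2
  have := j.2
  omega

lemma pseudoDist_eq_top (h : component s Z i ≠ component s Z j) : pseudoDist s Z i j = ⊤ := by
  wlog hij : i ≤ j generalizing i j
  · rw [pseudoDist_comm]
    exact this h.symm (not_le.1 hij).le
  rw [Ne, component_eq_iff hij] at h
  push Not at h
  obtain ⟨k, hk, hkZ⟩ := h
  unfold pseudoDist
  rw [min_eq_left hij, max_eq_right hij, ENNReal.sum_eq_top]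
  exact ⟨k, hk, adjPseudoDist_eq_top (lt_of_mem_Ico hk) hkZ⟩

lemma pseudoDist_eq (hZ : 0 < Z) (h : component s Z i = component s Z j) :
    pseudoDist s Z i j = ENNReal.ofReal |pseudoPos s Z i - pseudoPos s Z j| := by
  wlog hij : i ≤ j generalizing i j
  · rw [pseudoDist_comm, abs_sub_comm]
    exact this h.symm (not_le.1 hij).le
  rw [component_eq_iff hij] at h
  rw [abs_sub_comm, abs_of_nonneg (sub_nonneg.2 ((pseudoPos_strictMono hZ).monotone hij)),
    pseudoPos_sub hij, ENNReal.ofReal_sum_of_nonneg fun k _ => (pseudoLen_pos hZ k).le]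
  unfold pseudoDist
  rw [min_eq_left hij, max_eq_right hij]
  exact Finset.sum_congr rfl fun k hk => adjPseudoDist_eq (lt_of_mem_Ico hk) hZ (h k hk)

lemma abs_sub_le_pseudoPos (hs : StrictMono s) (hZ : 0 < Z)
    (h : component s Z i = component s Z j) :
    |s i - s j| ≤ |pseudoPos s Z i - pseudoPos s Z j| := by
  wlog hij : i ≤ j generalizing i j
  · rw [abs_sub_comm, abs_sub_comm (pseudoPos s Z i)]
    exact this h.symm (not_le.1 hij).le
  rw [component_eq_iff hij] at h
  rw [abs_sub_comm, abs_of_nonneg (sub_nonneg.2 (hs.monotone hij)), abs_sub_comm,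
    abs_of_nonneg (sub_nonneg.2 ((pseudoPos_strictMono hZ).monotone hij)),
    pseudoPos_sub hij, ← sum_edgeLen s hij]
  exact Finset.sum_le_sum fun k hk => le_min (h k hk).le (le_max_left _ _)

lemma abs_pseudoPos_le_add (hs : StrictMono s) (hZ : 0 < Z) (i j : Fin n) :
    |pseudoPos s Z i - pseudoPos s Z j| ≤ |s i - s j| + Z / n := by
  wlog hij : i ≤ j generalizing i j
  · rw [abs_sub_comm, abs_sub_comm (s i)]
    exact this _ _ (not_le.1 hij).le
  rw [abs_sub_comm, abs_of_nonneg (sub_nonneg.2 ((pseudoPos_strictMono hZ).monotone hij)),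
    abs_sub_comm (s i), abs_of_nonneg (sub_nonneg.2 (hs.monotone hij)),
    pseudoPos_sub hij, ← sum_edgeLen s hij]
  calc ∑ k ∈ Finset.Ico i j, pseudoLen s Z k
      ≤ ∑ k ∈ Finset.Ico i j, (edgeLen s k + Z / (n : ℝ) ^ 2) := by
        refine Finset.sum_le_sum fun k _ => (min_le_right _ _).trans (max_le ?_ ?_)
        · linarith [div_sq_pos hZ k]
        · linarith [edgeLen_nonneg hs k]
    _ = ∑ k ∈ Finset.Ico i j, edgeLen s k + (Finset.Ico i j).card * (Z / (n : ℝ) ^ 2) := by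
        rw [Finset.sum_add_distrib, Finset.sum_const, nsmul_eq_mul]
    _ ≤ ∑ k ∈ Finset.Ico i j, edgeLen s k + n * (Z / (n : ℝ) ^ 2) := by
        have : ((Finset.Ico i j).card : ℝ) ≤ n := by
          exact_mod_cast (Finset.card_le_univ _).trans_eq (Fintype.card_fin n)
        have := div_sq_pos hZ i
        gcongr
    _ = _ := by
        have : (n : ℝ) ≠ 0 := by
          have := i.2
          exact_mod_cast (by omega)
        field_simp

lemma abs_pseudoPos_le (hZ : 0 < Z) (i j : Fin n) :
    |pseudoPos s Z i - pseudoPos s Z j| ≤ n * Z := by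
  wlog hij : i ≤ j generalizing i j
  · rw [abs_sub_comm]
    exact this _ _ (not_le.1 hij).le
  rw [abs_sub_comm, abs_of_nonneg (sub_nonneg.2 ((pseudoPos_strictMono hZ).monotone hij)),
    pseudoPos_sub hij]
  calc ∑ k ∈ Finset.Ico i j, pseudoLen s Z k ≤ ∑ k ∈ Finset.Ico i j, Z :=
        Finset.sum_le_sum fun k _ => min_le_left _ _
    _ = (Finset.Ico i j).card * Z := by rw [Finset.sum_const, nsmul_eq_mul]
    _ ≤ n * Z := by
        have : ((Finset.Ico i j).card : ℝ) ≤ n := by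
          exact_mod_cast (Finset.card_le_univ _).trans_eq (Fintype.card_fin n)
        gcongr

lemma le_abs_pseudoPos (hZ : 0 < Z) (hij : i ≠ j) :
    Z / (n : ℝ) ^ 2 ≤ |pseudoPos s Z i - pseudoPos s Z j| := by
  wlog h : i < j generalizing i j
  · rw [abs_sub_comm]
    exact this hij.symm (lt_of_le_of_ne (not_lt.1 h) hij.symm)
  rw [abs_sub_comm, abs_of_nonneg (sub_nonneg.2 ((pseudoPos_strictMono hZ).monotone h.le)),
    pseudoPos_sub h.le]
  exact (le_pseudoLen hZ i).trans (Finset.single_le_sum (f := pseudoLen s Z)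
    (fun k _ => (pseudoLen_pos hZ k).le) (Finset.mem_Ico.2 ⟨le_rfl, h⟩))

/-- An imaginary move is a harmonic move on the line of the pseudo-distance, provided that its
component has a server left. -/
lemma expect_imagMove_le (hZ : 0 < Z) {I : Finset (Fin n)} {x : Fin n} {F : Fin n → ℝ≥0∞}
    {f : Fin n → ℝ} (hI : ∃ e ∈ I, component s Z e = component s Z x)
    (hF : ∀ g ∈ I, component s Z g = component s Z x → 0 ≤ f g ∧ F g ≤ ENNReal.ofReal (f g)) :
    expect (imagMove s Z I x) F
      ≤ ENNReal.ofReal (harmExp (pseudoPos s Z) (component s Z) I x f) := by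
  have hmono := component_mono s Z
  obtain ⟨e, heI, hex⟩ := hI
  by_cases hx : x ∈ I
  · rw [harmExp_mem hx, imagMove, if_pos hx, expect_pure]
    exact (hF x hx rfl).2
  rw [imagMove, if_neg hx]
  rcases ha : leftNbr I x with _ | a <;> rcases hb : rightNbr I x with _ | b
  · rw [leftNbr_eq_none] at ha
    rw [rightNbr_eq_none] at hb
    exact absurd (le_antisymm (hb e heI) (ha e heI) ▸ heI) hx
  · rw [leftNbr_eq_none] at ha
    rw [rightNbr_eq_some] at hb
    obtain ⟨hbI, hxb, hbmin⟩ := hb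
    have h1 : ∀ e ∈ I, b ≤ e := fun e he =>
      hbmin e he (lt_of_le_of_ne (ha e he) fun h => hx (h ▸ he))
    have hκ : component s Z b = component s Z x :=
      le_antisymm (hex ▸ hmono (h1 e heI)) (hmono hxb.le)
    rw [harmExp_right hbI hκ hxb fun e he _ => h1 e he]
    simp only [expect_pure]
    exact (hF b hbI hκ).2
  · rw [leftNbr_eq_some] at ha
    rw [rightNbr_eq_none] at hb
    obtain ⟨haI, hax, hamax⟩ := ha
    have h1 : ∀ e ∈ I, e ≤ a := fun e he =>
      hamax e he (lt_of_le_of_ne (hb e he) fun h => hx (h ▸ he))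
    have hκ : component s Z a = component s Z x :=
      le_antisymm (hmono hax.le) (hex ▸ hmono (h1 e heI))
    rw [harmExp_left haI hκ hax fun e he _ => h1 e he]
    simp only [expect_pure]
    exact (hF a haI hκ).2
  · rw [leftNbr_eq_some] at ha
    rw [rightNbr_eq_some] at hb
    obtain ⟨haI, hax, hamax⟩ := ha
    obtain ⟨hbI, hxb, hbmin⟩ := hb
    have hg : ∀ e ∈ I, e ≤ a ∨ b ≤ e := by
      intro e he
      rcases lt_trichotomy e x with h | h | h
      · exact Or.inl (hamax e he h)
      · exact absurd (h ▸ he) hx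
      · exact Or.inr (hbmin e he h)
    simp only [expect_coin]
    by_cases hκb : component s Z b = component s Z x
    · by_cases hκa : component s Z a = component s Z x
      · rw [harmExp_both haI hbI hκa hκb hax hxb fun e he _ => hg e he]
        have p1 := pseudoPos_strictMono (s := s) hZ hax
        have p2 := pseudoPos_strictMono (s := s) hZ hxb
        obtain ⟨fa0, hFa⟩ := hF a haI hκa
        obtain ⟨fb0, hFb⟩ := hF b hbI hκb
        rw [rightProb, pseudoDist_eq hZ hκb.symm, pseudoDist_eq hZ hκa.symm,
          if_neg ENNReal.ofReal_ne_top, if_neg ENNReal.ofReal_ne_top,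
          ← ENNReal.ofReal_add (abs_nonneg _) (abs_nonneg _), abs_of_pos (sub_pos.2 p1),
          abs_of_neg (sub_neg.2 p2), neg_sub]
        set u := pseudoPos s Z x - pseudoPos s Z a with hu
        set v := pseudoPos s Z b - pseudoPos s Z x with hv
        have hu0 : 0 < u := sub_pos.2 p1
        have hv0 : 0 < v := sub_pos.2 p2
        have huv : pseudoPos s Z b - pseudoPos s Z a = u + v := by rw [hu, hv]; ring
        rw [← ENNReal.ofReal_div_of_pos (by positivity), min_eq_left (by
            rw [ENNReal.ofReal_le_one, div_le_one (by positivity)]; linarith),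
          ← ENNReal.ofReal_one, ← ENNReal.ofReal_sub _ (by positivity), huv]
        have h1 : 1 - u / (u + v) = v / (u + v) := by field_simp; ring
        rw [h1]
        calc ENNReal.ofReal (u / (u + v)) * F b + ENNReal.ofReal (v / (u + v)) * F a
            ≤ ENNReal.ofReal (u / (u + v)) * ENNReal.ofReal (f b)
              + ENNReal.ofReal (v / (u + v)) * ENNReal.ofReal (f a) := by gcongr
          _ = ENNReal.ofReal ((v * f a + u * f b) / (u + v)) := by
              rw [← ENNReal.ofReal_mul (by positivity), ← ENNReal.ofReal_mul (by positivity),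
                ← ENNReal.ofReal_add (by positivity) (by positivity)]
              congr 1
              ring
      · have hall : ∀ e ∈ I, component s Z e = component s Z x → b ≤ e := by
          intro e he hk
          rcases hg e he with h | h
          · exact absurd (le_antisymm (hmono hax.le) (hk ▸ hmono h)) hκa
          · exact h
        rw [harmExp_right hbI hκb hxb hall, rightProb, pseudoDist_eq hZ hκb.symm,
          if_neg ENNReal.ofReal_ne_top, pseudoDist_eq_top (Ne.symm hκa), if_pos rfl]
        simpa using (hF b hbI hκb).2
    · have hall : ∀ e ∈ I, component s Z e = component s Z x → e ≤ a := by
        intro e he hk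
        rcases hg e he with h | h
        · exact h
        · exact absurd (le_antisymm (hk ▸ hmono h) (hmono hxb.le)) hκb
      have hκa : component s Z a = component s Z x :=
        le_antisymm (hmono hax.le) (hex ▸ hmono (hall e heI hex))
      rw [harmExp_left haI hκa hax hall, rightProb, pseudoDist_eq_top (Ne.symm hκb), if_pos rfl]
      simpa using (hF a haI hκa).2

end pseudo

/-! ### Offline matchings -/

section opt

variable {s : Fin n → ℝ} {R : List (Fin n)}

lemma optCost_le (s : Fin n → ℝ) (R : List (Fin n)) (f : Fin R.length ↪ Fin n) :
    optCost s R ≤ ∑ k, |s (R.get k) - s (f k)| :=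
  ciInf_le (Set.finite_range _).bddBelow f

lemma exists_optCost_eq (s : Fin n → ℝ) (h : R.length ≤ n) :
    ∃ f : Fin R.length ↪ Fin n, ∑ k, |s (R.get k) - s (f k)| = optCost s R := by
  have : Nonempty (Fin R.length ↪ Fin n) := ⟨Fin.castLEEmb h⟩
  exact exists_eq_ciInf_of_finite

/-- An optimal matching, as a list of servers. -/
lemma exists_opt_list (s : Fin n → ℝ) (h : R.length ≤ n) :
    ∃ O : List (Fin n), O.length = R.length ∧ O.Nodup ∧
      (∀ d : Fin n → Fin n → ℝ, (List.zipWith d R O).sum = ∑ k : Fin R.length, d R[k] (O.getD k R[k]))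
      ∧ ∑ k : Fin R.length, |s R[k] - s (O.getD k R[k])| = optCost s R := by
  obtain ⟨f, hf⟩ := exists_optCost_eq s h
  have hget : ∀ k : Fin R.length, (List.ofFn f).getD k R[k] = f k := fun k => by
    simp [List.getD_eq_getElem?_getD]
  refine ⟨List.ofFn f, by simp, List.nodup_ofFn.2 f.injective, fun d => ?_, ?_⟩
  · have : List.zipWith d R (List.ofFn f) = List.ofFn fun k : Fin R.length => d R[k] (f k) := by
      apply List.ext_getElem
      · simp
      · intro i h1 h2
        simp
    rw [this, List.sum_ofFn]
    simp only [hget]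
  · rw [← hf]
    simp only [hget]
    rfl

/-- An optimal matching whose cost is below the estimate does not leave the components. -/
lemma exists_opt_component {Z : ℝ} (hs : StrictMono s) (h : R.length ≤ n) (hZ : 0 < Z)
    (hopt : optCost s R < Z) :
    ∃ O : List (Fin n), O.Nodup ∧
      List.Forall₂ (fun x o => component s Z x = component s Z o) R O ∧
      (List.zipWith (fun x o => |pseudoPos s Z x - pseudoPos s Z o|) R O).sum
        ≤ optCost s R + Z ∧
      (optCost s R = 0 →
        (List.zipWith (fun x o => |pseudoPos s Z x - pseudoPos s Z o|) R O).sum = 0) := by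
  obtain ⟨O, hlen, hO, hsum, hcost⟩ := exists_opt_list s h
  have hle : ∀ k : Fin R.length, |s R[k] - s (O.getD k R[k])| ≤ optCost s R := fun k => by
    rw [← hcost]
    exact Finset.single_le_sum (f := fun k : Fin R.length => |s R[k] - s (O.getD k R[k])|)
      (fun _ _ => abs_nonneg _) (Finset.mem_univ k)
  have hcomp : ∀ i j : Fin n, |s i - s j| < Z → component s Z i = component s Z j := by
    intro i j hij
    wlog h : i ≤ j generalizing i j
    · exact (this j i (by rwa [abs_sub_comm]) (not_le.1 h).le).symm
    rw [component_eq_iff h]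
    intro k hk
    rw [abs_sub_comm, abs_of_nonneg (sub_nonneg.2 (hs.monotone h)), ← sum_edgeLen s h] at hij
    exact (Finset.single_le_sum (f := edgeLen s) (fun k _ => edgeLen_nonneg hs k) hk).trans_lt hij
  refine ⟨O, hO, ?_, ?_, ?_⟩
  · rw [List.forall₂_iff_get]
    refine ⟨hlen.symm, fun i h1 h2 => hcomp _ _ ?_⟩
    have := hle ⟨i, h1⟩
    simp only [List.getD_eq_getElem?_getD, Fin.getElem_fin, List.getElem?_eq_getElem h2,
      Option.getD_some] at this
    exact this.trans_lt hopt
  · rw [hsum, ← hcost]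
    calc ∑ k : Fin R.length, |pseudoPos s Z R[k] - pseudoPos s Z (O.getD k R[k])|
        ≤ ∑ k : Fin R.length, (|s R[k] - s (O.getD k R[k])| + Z / n) :=
          Finset.sum_le_sum fun k _ => abs_pseudoPos_le_add hs hZ _ _
      _ = ∑ k : Fin R.length, |s R[k] - s (O.getD k R[k])| + R.length * (Z / n) := by
          rw [Finset.sum_add_distrib, Finset.sum_const, nsmul_eq_mul, Finset.card_univ,
            Fintype.card_fin]
      _ ≤ _ := by
          gcongr
          rcases Nat.eq_zero_or_pos n with rfl | hn
          · simp [hZ.le]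
          · have hn' : (0 : ℝ) < n := by exact_mod_cast hn
            have : (R.length : ℝ) ≤ n := by exact_mod_cast h
            calc (R.length : ℝ) * (Z / n) ≤ n * (Z / n) := by gcongr
              _ = Z := by field_simp
  · intro h0
    rw [hsum]
    refine Finset.sum_eq_zero fun k _ => ?_
    have h1 := abs_nonpos_iff.1 (h0 ▸ hle k)
    have h2 := hs.injective (sub_eq_zero.1 h1)
    rw [← h2, sub_self, abs_zero]

end opt

/-! ### The cost of Doubled Harmonic with a fixed estimate -/

/-- The expected cost of the imaginary moves of the requests of a list, for the estimate `Z` and the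
imaginary servers `I`. -/
noncomputable def simCost (s : Fin n → ℝ) (Z : ℝ) : Finset (Fin n) → List (Fin n) → ℝ≥0∞
  | _, [] => 0
  | I, x :: R => expect (imagMove s Z I x) fun g =>
      ENNReal.ofReal |s x - s g| + simCost s Z (I.erase g) R

section sim

variable {s : Fin n → ℝ} {Z : ℝ} {R : List (Fin n)} {I : Finset (Fin n)} {x : Fin n}

/-- The recursion of `simulate` at the last request of the list. -/
lemma simulate_append (s : Fin n → ℝ) (Z : ℝ) (I : Finset (Fin n)) (R : List (Fin n)) (x : Fin n) :
    simulate s Z I (R ++ [x])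
      = (simulate s Z I R).bind fun J => (imagMove s Z J x).map fun g => J.erase g := by
  induction R generalizing I with
  | nil => simp [simulate, ← PMF.bind_pure_comp, Function.comp_def]
  | cons y R ih => simp [simulate, ih, PMF.bind_bind]

/-- The recursion of `simCost` at the last request of the list. -/
lemma simCost_append (s : Fin n → ℝ) (Z : ℝ) (I : Finset (Fin n)) (R : List (Fin n)) (x : Fin n) :
    simCost s Z I (R ++ [x]) = simCost s Z I R + expect (simulate s Z I R) fun J =>
      expect (imagMove s Z J x) fun g => ENNReal.ofReal |s x - s g| := by
  induction R generalizing I with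
  | nil => simp [simulate, simCost, expect_pure]
  | cons y R ih =>
    simp only [List.cons_append, simCost, simulate, expect_bind, ih]
    rw [← expect_add]
    simp only [add_assoc]

lemma harmExp_nonneg {P : Fin n → ℝ} {κ : Fin n → ℕ} {f : Fin n → ℝ} (hP : StrictMono P)
    (hf : ∀ g, 0 ≤ f g) : 0 ≤ harmExp P κ I x f := by
  unfold harmExp
  split_ifs
  · exact hf x
  split
  · exact hf _
  · exact hf _
  · exact hf _
  · rename_i a b ha hb
    have h1 := hP (leftNbr_eq_some.1 ha).2.1
    have h2 := hP (rightNbr_eq_some.1 hb).2.1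
    exact div_nonneg (add_nonneg (mul_nonneg (by linarith) (hf _))
      (mul_nonneg (by linarith) (hf _))) (by linarith)

lemma harmCost_nonneg {P : Fin n → ℝ} {κ : Fin n → ℕ} (hP : StrictMono P) (I : Finset (Fin n))
    (R : List (Fin n)) : 0 ≤ harmCost P κ I R := by
  induction R generalizing I with
  | nil => exact le_rfl
  | cons x R ih => exact harmExp_nonneg hP fun g => add_nonneg (abs_nonneg _) (ih _)

lemma simCost_le_harmCost (hs : StrictMono s) (hZ : 0 < Z)
    (hI : ∀ c, R.countP (fun x => component s Z x = c)
      ≤ (I.filter fun e => component s Z e = c).card) :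
    simCost s Z I R ≤ ENNReal.ofReal (harmCost (pseudoPos s Z) (component s Z) I R) := by
  induction R generalizing I with
  | nil => simp [simCost]
  | cons x R ih =>
    rw [simCost, harmCost]
    refine expect_imagMove_le hZ ?_ fun g hg hk => ⟨?_, ?_⟩
    · have := hI (component s Z x)
      rw [List.countP_cons_of_pos (by simp)] at this
      obtain ⟨e, he⟩ := Finset.card_pos.1 (show 0 <
        (I.filter fun e => component s Z e = component s Z x).card by omega)
      rw [Finset.mem_filter] at he
      exact ⟨e, he.1, he.2⟩
    · exact add_nonneg (abs_nonneg _) (harmCost_nonneg (pseudoPos_strictMono hZ) _ _)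
    · rw [ENNReal.ofReal_add (abs_nonneg _) (harmCost_nonneg (pseudoPos_strictMono hZ) _ _)]
      refine add_le_add (ENNReal.ofReal_le_ofReal (abs_sub_le_pseudoPos hs hZ hk.symm)) (ih ?_)
      intro c
      have h1 := hI c
      rw [Finset.filter_erase]
      by_cases hc : component s Z x = c
      · rw [List.countP_cons_of_pos (by simp [hc])] at h1
        rw [Finset.card_erase_of_mem (by simp [hg, hk, hc])]
        omega
      · rw [List.countP_cons_of_neg (by simp [hc])] at h1
        rwa [Finset.erase_eq_of_notMem (by simp [hk, hc])]

lemma countP_le_card {κ : Fin n → ℕ} {O : List (Fin n)}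
    (h : List.Forall₂ (fun x o => κ x = κ o) R O) (hO : O.Nodup) (c : ℕ) :
    R.countP (fun x => κ x = c) ≤ (Finset.univ.filter fun e => κ e = c).card := by
  have h1 : R.countP (fun x => κ x = c) = O.countP (fun x => κ x = c) := by
    clear hO
    induction h with
    | nil => rfl
    | cons hxo _ ih => simp [List.countP_cons, ih, hxo]
  rw [h1, List.countP_eq_length_filter, ← List.toFinset_card_of_nodup (hO.filter _)]
  refine Finset.card_le_card fun e he => ?_
  simp only [List.mem_toFinset, List.mem_filter, decide_eq_true_eq] at he
  simpa using he.2

/-- The imaginary moves are competitive against the estimate. -/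
theorem simCost_le (hs : StrictMono s) (hn : 2 ≤ n) (hZ : 0 < Z) (h : R.length ≤ n)
    (hopt : optCost s R < Z) :
    simCost s Z Finset.univ R ≤ ENNReal.ofReal (1000 * Real.log n * Z) ∧
      (optCost s R = 0 → simCost s Z Finset.univ R = 0) := by
  obtain ⟨O, hO, hcomp, hsum, hzero⟩ := exists_opt_component hs h hZ hopt
  have hn' : (2 : ℝ) ≤ n := by exact_mod_cast hn
  have hη : 0 < Z / (n : ℝ) ^ 2 := by positivity
  have hη' : Z / (n : ℝ) ^ 2 ≤ Z := div_le_self hZ.le (one_le_pow₀ (by linarith))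
  have hsim := simCost_le_harmCost hs hZ (countP_le_card hcomp hO)
  have hharm := harmCost_le (P := pseudoPos s Z) (κ := component s Z) (Λ := 3 * (n * Z)) hη
    (pseudoPos_strictMono hZ)
    (fun i j _ => mul_le_mul_of_nonneg_left (abs_pseudoPos_le hZ i j) (by norm_num))
    (fun i j => le_abs_pseudoPos hZ) (by nlinarith) hcomp hO (fun o _ => Finset.mem_univ o)
  constructor
  · refine hsim.trans (ENNReal.ofReal_le_ofReal (hharm.trans ?_))
    have e1 : 3 * (n * Z) / (Z / (n : ℝ) ^ 2) = 3 * (n : ℝ) ^ 3 := by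
      field_simp
    have hl2 := Real.log_two_gt_d9
    have hln : Real.log 2 ≤ Real.log n := Real.log_le_log (by norm_num) hn'
    have hl3 : Real.log 3 ≤ 2 * Real.log 2 := by
      rw [← Real.log_rpow (by norm_num)]
      exact Real.log_le_log (by norm_num) (by norm_num)
    have e2 : Real.log (3 * (n : ℝ) ^ 3) = Real.log 3 + 3 * Real.log n := by
      rw [Real.log_mul (by norm_num) (by positivity), Real.log_pow]
      norm_num
    rw [e1, e2]
    have hK : 3 * (28 * (Real.log 3 + 3 * Real.log n) + 16) + 2 ≤ 500 * Real.log n := by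
      linarith
    calc _ ≤ (500 * Real.log n) * (2 * Z) := by
          refine mul_le_mul hK (by linarith) ?_ (by linarith)
          exact List.sum_nonneg fun y hy => by
            obtain ⟨i, hi, rfl⟩ := List.getElem_of_mem hy
            simp
      _ = _ := by ring
  · intro h0
    rw [hzero h0, mul_zero] at hharm
    exact le_antisymm (hsim.trans (by rw [ENNReal.ofReal_of_nonpos hharm])) bot_le

end sim

/-! ### Flows on the line -/

/-- The indicator function of the edges to the right of `x`. -/
def ind (x k : Fin n) : ℤ := if x ≤ k then 1 else 0

/-- The number of servers of `A` to the left of the edge `k`. -/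
def cnt (A : Finset (Fin n)) (k : Fin n) : ℤ := ((A.filter (· ≤ k)).card : ℤ)

/-- The number of requests of `R` to the left of the edge `k`. -/
def reqCnt (R : List (Fin n)) (k : Fin n) : ℤ := (R.map fun x => ind x k).sum

/-- The cost of a flow on the line, where `h k` units flow over the edge `k`. -/
noncomputable def flowCost (s : Fin n → ℝ) (h : Fin n → ℤ) : ℝ := ∑ k, edgeLen s k * |(h k : ℝ)|

section flow

variable {s : Fin n → ℝ} {A I : Finset (Fin n)} {a b x g k k' : Fin n} {h : Fin n → ℤ}

lemma flowCost_nonneg (hs : StrictMono s) (h : Fin n → ℤ) : 0 ≤ flowCost s h :=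
  Finset.sum_nonneg fun k _ => mul_nonneg (edgeLen_nonneg hs k) (abs_nonneg _)

lemma flowCost_add_le (hs : StrictMono s) (h h' : Fin n → ℤ) :
    flowCost s (fun k => h k + h' k) ≤ flowCost s h + flowCost s h' := by
  unfold flowCost
  rw [← Finset.sum_add_distrib]
  refine Finset.sum_le_sum fun k _ => ?_
  rw [← mul_add]
  refine mul_le_mul_of_nonneg_left ?_ (edgeLen_nonneg hs k)
  push_cast
  exact abs_add_le _ _

lemma flowCost_neg (s : Fin n → ℝ) (h : Fin n → ℤ) :
    flowCost s (fun k => - h k) = flowCost s h := by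
  simp [flowCost]

lemma flowCost_sum_le (hs : StrictMono s) {ι : Type*} (S : Finset ι) (h : ι → Fin n → ℤ) :
    flowCost s (fun k => ∑ i ∈ S, h i k) ≤ ∑ i ∈ S, flowCost s (h i) := by
  classical
  induction S using Finset.induction_on with
  | empty => simp [flowCost]
  | insert i S hi ih =>
    simp only [Finset.sum_insert hi]
    exact (flowCost_add_le hs _ _).trans (by linarith)

/-- The path from `x` to `g`, as a flow, costs the distance between them. -/
lemma flowCost_ind (hs : StrictMono s) (x g : Fin n) :
    flowCost s (fun k => ind x k - ind g k) = |s x - s g| := by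
  wlog hxg : x ≤ g generalizing x g
  · rw [abs_sub_comm, ← this g x (not_le.1 hxg).le, ← flowCost_neg]
    simp only [neg_sub]
  rw [abs_sub_comm, abs_of_nonneg (sub_nonneg.2 (hs.monotone hxg)), ← sum_edgeLen s hxg]
  unfold flowCost
  rw [← Finset.sum_subset (Finset.subset_univ (Finset.Ico x g))]
  · refine Finset.sum_congr rfl fun k hk => ?_
    rw [Finset.mem_Ico] at hk
    simp [ind, hk.1, hk.2.not_ge]
  · intro k _ hk
    rw [Finset.mem_Ico, not_and_or, not_le, not_lt] at hk
    rcases hk with hk | hk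
    · simp [ind, hk.not_ge, (hk.trans_le hxg).not_ge]
    · simp [ind, hk, hxg.trans hk]

lemma le_flowCost (hs : StrictMono s) {i j : Fin n} (hij : i ≤ j)
    (hh : ∀ k, i ≤ k → k < j → 1 ≤ |h k|) : s j - s i ≤ flowCost s h := by
  rw [← sum_edgeLen s hij]
  refine (Finset.sum_le_sum fun k hk => ?_).trans
    (Finset.sum_le_sum_of_subset_of_nonneg (Finset.subset_univ (Finset.Ico i j))
      fun k _ _ => mul_nonneg (edgeLen_nonneg hs k) (abs_nonneg _))
  rw [Finset.mem_Ico] at hk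
  have h1 : (1 : ℝ) ≤ |(h k : ℝ)| := by exact_mod_cast hh k hk.1 hk.2
  exact le_mul_of_one_le_right (edgeLen_nonneg hs k) h1

/-- A pointwise comparison of integral flows gives a comparison of their costs. -/
lemma flowCost_add_le_of_pointwise (hs : StrictMono s) {h₁ h₂ h₃ h₄ : Fin n → ℤ}
    (H : ∀ k, |h₁ k| + |h₂ k| ≤ |h₃ k| + |h₄ k|) :
    flowCost s h₁ + flowCost s h₂ ≤ flowCost s h₃ + flowCost s h₄ := by
  unfold flowCost
  rw [← Finset.sum_add_distrib, ← Finset.sum_add_distrib]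
  refine Finset.sum_le_sum fun k _ => ?_
  rw [← mul_add, ← mul_add]
  exact mul_le_mul_of_nonneg_left (by exact_mod_cast H k) (edgeLen_nonneg hs k)

/-- A unit of flow from `x` to `a`, instead of `g`, costs nothing extra if `h` already leads towards
the left there. -/
lemma flowCost_move_left (hs : StrictMono s) (ha : a < x)
    (H : ∀ k, a ≤ k → k < x → k < g → h k ≤ -1) :
    |s x - s a| + flowCost s (fun k => h k + ind a k - ind g k)
      ≤ |s x - s g| + flowCost s h := by
  rw [← flowCost_ind hs, ← flowCost_ind hs]
  refine flowCost_add_le_of_pointwise hs fun k => ?_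
  have := H k
  unfold ind
  grind

/-- A unit of flow from `x` to `b`, instead of `g`, costs nothing extra if `h` already leads towards
the right there. -/
lemma flowCost_move_right (hs : StrictMono s) (hb : x < b)
    (H : ∀ k, x ≤ k → k < b → g ≤ k → 1 ≤ h k) :
    |s x - s b| + flowCost s (fun k => h k + ind b k - ind g k)
      ≤ |s x - s g| + flowCost s h := by
  rw [← flowCost_ind hs, ← flowCost_ind hs]
  refine flowCost_add_le_of_pointwise hs fun k => ?_
  have := H k
  unfold ind
  grind

lemma cnt_eq_sum (A : Finset (Fin n)) (k : Fin n) : cnt A k = ∑ e ∈ A, ind e k := by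
  simp [cnt, ind]

lemma cnt_erase (hg : g ∈ A) (k : Fin n) : cnt (A.erase g) k = cnt A k - ind g k := by
  rw [cnt_eq_sum, cnt_eq_sum, ← Finset.add_sum_erase A _ hg]
  ring

/-- If all elements of `I` between two edges belong to `A`, then the count of `I` grows at most as
much as that of `A` from one edge to the other. -/
lemma cnt_sub_le (hk : k ≤ k') (H : ∀ e ∈ I, k < e → e ≤ k' → e ∈ A) :
    cnt I k' - cnt I k ≤ cnt A k' - cnt A k := by
  have key : ∀ S : Finset (Fin n), cnt S k' - cnt S k
      = ((S.filter fun e => k < e ∧ e ≤ k').card : ℤ) := by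
    intro S
    have : S.filter (· ≤ k') = S.filter (· ≤ k) ∪ S.filter fun e => k < e ∧ e ≤ k' := by
      ext e
      simp only [Finset.mem_filter, Finset.mem_union]
      grind
    unfold cnt
    rw [this, Finset.card_union_of_disjoint]
    · push_cast
      ring
    · rw [Finset.disjoint_left]
      intro e he he'
      rw [Finset.mem_filter] at he he'
      exact absurd he.2 he'.2.1.not_ge
  rw [key, key]
  exact_mod_cast Finset.card_le_card fun e he => by
    rw [Finset.mem_filter] at he ⊢
    exact ⟨H e he.1 he.2.1 he.2.2, he.2⟩

lemma cnt_mono (A : Finset (Fin n)) : Monotone (cnt A) := fun k k' hk => by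
  have := cnt_sub_le (I := ∅) (A := A) hk (by simp)
  simp [cnt] at this ⊢
  exact this

end flow

/-! ### Islands -/

section islands

variable {s : Fin n → ℝ} {A I : Finset (Fin n)} {M : Fin n → Fin n} {x i j : Fin n}

lemma exists_isOptMatching (s : Fin n → ℝ) (h : I.card = A.card) : ∃ M, IsOptMatching s I A M := by
  classical
  obtain ⟨e⟩ : Nonempty (I ≃ A) := ⟨Finset.equivOfCardEq h⟩
  have hne : {M : Fin n → Fin n | Set.BijOn M (I : Set (Fin n)) (A : Set (Fin n))}.Nonempty := by
    refine ⟨fun i => if hi : i ∈ I then e ⟨i, hi⟩ else i, fun i hi => ?_, fun i hi j hj hij => ?_,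
      fun a ha => ?_⟩
    · have hi' : i ∈ I := hi
      simp [hi']
    · have hi' : i ∈ I := hi
      have hj' : j ∈ I := hj
      simp only [hi', hj', dite_true] at hij
      have := e.injective (Subtype.ext hij)
      exact congrArg Subtype.val this
    · refine ⟨e.symm ⟨a, ha⟩, (e.symm ⟨a, ha⟩).2, ?_⟩
      simp
  obtain ⟨M, hM, hmin⟩ := Set.exists_min_image _ (fun M => ∑ j ∈ I, |s j - s (M j)|)
    (Set.toFinite _) hne
  exact ⟨M, hM, hmin⟩

/-- In an optimal matching no two matched pairs cross a common edge in opposite directions. -/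
lemma IsOptMatching.not_cross (h : IsOptMatching s I A M) (hs : StrictMono s) (hi : i ∈ I)
    (hj : j ∈ I) (h1 : i < M i) (h2 : i < j) (h3 : M j < M i) (h4 : M j < j) : False := by
  classical
  have hbij : Set.BijOn (M ∘ Equiv.swap i j) (I : Set (Fin n)) (A : Set (Fin n)) := by
    refine h.1.comp ⟨?_, (Equiv.injective _).injOn, ?_⟩
    · intro k hk
      rcases eq_or_ne k i with rfl | hki
      · simpa using hj
      rcases eq_or_ne k j with rfl | hkj
      · simpa using hi
      · rwa [Equiv.swap_apply_of_ne_of_ne hki hkj]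
    · intro k hk
      refine ⟨Equiv.swap i j k, ?_, by simp⟩
      rcases eq_or_ne k i with rfl | hki
      · simpa using hj
      rcases eq_or_ne k j with rfl | hkj
      · simpa using hi
      · rwa [Equiv.swap_apply_of_ne_of_ne hki hkj]
  have hle := h.2 _ hbij
  have hj' : j ∈ I.erase i := Finset.mem_erase.2 ⟨h2.ne', hj⟩
  rw [← Finset.add_sum_erase I _ hi, ← Finset.add_sum_erase (I.erase i) _ hj',
    ← Finset.add_sum_erase I _ hi, ← Finset.add_sum_erase (I.erase i) _ hj'] at hle
  have hrest : ∑ k ∈ (I.erase i).erase j, |s k - s ((M ∘ Equiv.swap i j) k)|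
      = ∑ k ∈ (I.erase i).erase j, |s k - s (M k)| := by
    refine Finset.sum_congr rfl fun k hk => ?_
    rw [Finset.mem_erase, Finset.mem_erase] at hk
    simp [Equiv.swap_apply_of_ne_of_ne hk.2.1 hk.1]
  rw [hrest] at hle
  simp only [Function.comp_apply, Equiv.swap_apply_left, Equiv.swap_apply_right] at hle
  have p1 := hs h1
  have p2 := hs h2
  have p3 := hs h3
  have p4 := hs h4
  rw [abs_of_neg (a := s i - s (M i)) (by linarith),
    abs_of_pos (a := s j - s (M j)) (by linarith)] at hle
  rcases abs_cases (s i - s (M j)) with ⟨e1, _⟩ | ⟨e1, _⟩ <;>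
    rcases abs_cases (s j - s (M i)) with ⟨e2, _⟩ | ⟨e2, _⟩ <;> linarith

/-- By `IsOptMatching.not_cross`, an optimal matching leads no imaginary server across `x` to the
right in a left island. -/
lemma card_lt_of_inLeftIsland (hs : StrictMono s) (hx : x ∉ A) (h : InLeftIsland s I A x) :
    (I.filter (· < x)).card < (A.filter (· < x)).card := by
  classical
  obtain ⟨M, hM, j, hj, h1, h2, -⟩ := h
  have hMj : M j ∈ A := hM.1.mapsTo hj
  have h1' : M j < x := lt_of_le_of_ne h1 fun h => hx (h ▸ hMj)
  have hmaps : ∀ i ∈ I, i < x → M i < x := by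
    intro i hi hix
    by_contra hc
    exact hM.not_cross hs hi hj (hix.trans_le (not_lt.1 hc)) (hix.trans_le h2)
      (h1'.trans_le (not_lt.1 hc)) (h1'.trans_le h2)
  have hsub : (I.filter (· < x)).image M ⊆ (A.filter (· < x)).erase (M j) := by
    intro y hy
    obtain ⟨i, hi, rfl⟩ := Finset.mem_image.1 hy
    rw [Finset.mem_filter] at hi
    rw [Finset.mem_erase, Finset.mem_filter]
    refine ⟨fun he => ?_, hM.1.mapsTo hi.1, hmaps i hi.1 hi.2⟩
    exact absurd hi.2 (hM.1.injOn hi.1 hj he ▸ h2).not_gt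
  have h3 := Finset.card_le_card hsub
  rw [Finset.card_image_of_injOn (hM.1.injOn.mono fun i hi => (Finset.mem_filter.1 hi).1),
    Finset.card_erase_of_mem (by simp [hMj, h1'])] at h3
  have h4 : 0 < (A.filter (· < x)).card := Finset.card_pos.2 ⟨M j, by simp [hMj, h1']⟩
  omega

lemma card_lt_of_inRightIsland (hs : StrictMono s) (hx : x ∉ A) (h : InRightIsland s I A x) :
    (A.filter (· ≤ x)).card < (I.filter (· ≤ x)).card := by
  classical
  obtain ⟨M, hM, j, hj, h1, h2, -⟩ := h
  have hMj : M j ∈ A := hM.1.mapsTo hj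
  have h2' : x < M j := lt_of_le_of_ne h2 fun h => hx (h ▸ hMj)
  have hmaps : ∀ i ∈ I, M i ≤ x → i ≤ x := by
    intro i hi hix
    by_contra hc
    rw [not_le] at hc
    exact hM.not_cross hs hj hi (h1.trans_lt h2') (h1.trans_lt hc) (hix.trans_lt h2')
      (hix.trans_lt hc)
  have hsub : A.filter (· ≤ x) ⊆ ((I.filter (· ≤ x)).erase j).image M := by
    intro y hy
    rw [Finset.mem_filter] at hy
    obtain ⟨i, hi, rfl⟩ := hM.1.surjOn hy.1
    refine Finset.mem_image.2 ⟨i, ?_, rfl⟩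
    rw [Finset.mem_erase, Finset.mem_filter]
    exact ⟨fun he => absurd hy.2 (he ▸ h2').not_ge, hi, hmaps i hi hy.2⟩
  have h3 := (Finset.card_le_card hsub).trans Finset.card_image_le
  rw [Finset.card_erase_of_mem (by simp [hj, h1])] at h3
  have h4 : 0 < (I.filter (· ≤ x)).card := Finset.card_pos.2 ⟨j, by simp [hj, h1]⟩
  omega

lemma card_le_of_not_inRightIsland (hcard : I.card = A.card) (h : ¬ InRightIsland s I A x) :
    (I.filter (· < x)).card ≤ (A.filter (· < x)).card := by
  obtain ⟨M, hM⟩ := exists_isOptMatching s hcard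
  refine Finset.card_le_card_of_injOn M (fun i hi => ?_)
    (hM.1.injOn.mono fun i hi => (Finset.mem_filter.1 hi).1)
  have hi' := Finset.mem_filter.1 hi
  refine Finset.mem_coe.2 (Finset.mem_filter.2 ⟨hM.1.mapsTo hi'.1, ?_⟩)
  by_contra hc
  exact h ⟨M, hM, i, hi'.1, hi'.2.le, not_lt.1 hc, hi'.2.trans_le (not_lt.1 hc)⟩

lemma card_le_of_not_inLeftIsland (hcard : I.card = A.card) (h : ¬ InLeftIsland s I A x) :
    (A.filter (· ≤ x)).card ≤ (I.filter (· ≤ x)).card := by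
  classical
  obtain ⟨M, hM⟩ := exists_isOptMatching s hcard
  have hsub : A.filter (· ≤ x) ⊆ (I.filter (· ≤ x)).image M := by
    intro y hy
    rw [Finset.mem_filter] at hy
    obtain ⟨i, hi, rfl⟩ := hM.1.surjOn hy.1
    refine Finset.mem_image.2 ⟨i, Finset.mem_filter.2 ⟨hi, ?_⟩, rfl⟩
    by_contra hc
    rw [not_le] at hc
    exact h ⟨M, hM, i, hi, hy.2, hc.le, hy.2.trans_lt hc⟩
  exact (Finset.card_le_card hsub).trans Finset.card_image_le

lemma mem_avail_of_not_island (hcard : I.card = A.card) (hl : ¬ InLeftIsland s I A x)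
    (hr : ¬ InRightIsland s I A x) (hx : x ∈ I) : x ∈ A := by
  obtain ⟨M, hM⟩ := exists_isOptMatching s hcard
  have hMx : M x ∈ A := hM.1.mapsTo hx
  rcases lt_trichotomy (M x) x with h | h | h
  · exact absurd ⟨M, hM, x, hx, h.le, le_rfl, h⟩ hl
  · exact h ▸ hMx
  · exact absurd ⟨M, hM, x, hx, le_rfl, h.le, h⟩ hr

end islands

/-! ### One step of the algorithm -/

section steps

variable {s : Fin n → ℝ} {Z : ℝ} {A I : Finset (Fin n)} {q : State n} {a b x g σ : Fin n}

lemma mem_of_mem_support_coin {α : Type*} {p : ℝ≥0∞} {a b c : α} (h : c ∈ (coin p a b).support) :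
    c = a ∨ c = b := by
  unfold coin at h
  rw [PMF.mem_support_map_iff] at h
  obtain ⟨t, -, rfl⟩ := h
  cases t <;> simp

lemma mem_of_mem_support_imagMove (hI : I.Nonempty) (hg : g ∈ (imagMove s Z I x).support) :
    g ∈ I := by
  unfold imagMove at hg
  split_ifs at hg with hx
  · rw [PMF.support_pure, Set.mem_singleton_iff] at hg
    rwa [hg]
  · rcases hl : leftNbr I x with _ | l <;> rcases hr : rightNbr I x with _ | r <;>
      simp only [hl, hr] at hg
    · obtain ⟨e, he⟩ := hI
      rw [leftNbr_eq_none] at hl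
      rw [rightNbr_eq_none] at hr
      exact absurd (le_antisymm (hr e he) (hl e he) ▸ he) hx
    · rw [PMF.support_pure, Set.mem_singleton_iff] at hg
      rw [hg]
      exact (rightNbr_eq_some.1 hr).1
    · rw [PMF.support_pure, Set.mem_singleton_iff] at hg
      rw [hg]
      exact (leftNbr_eq_some.1 hl).1
    · rcases mem_of_mem_support_coin hg with rfl | rfl
      · exact (leftNbr_eq_some.1 hl).1
      · exact (rightNbr_eq_some.1 hr).1

/-- The minimum cost of a matching between two sets of servers of the same size, as the cost of a
flow. -/
noncomputable def gap (s : Fin n → ℝ) (I A : Finset (Fin n)) : ℝ :=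
  flowCost s fun k => cnt I k - cnt A k

lemma gap_nonneg (hs : StrictMono s) (I A : Finset (Fin n)) : 0 ≤ gap s I A := flowCost_nonneg hs _

/-- The flow of `gap` after the removal of a server from both sets. -/
lemma gap_erase (hg : g ∈ I) (hσ : σ ∈ A) : gap s (I.erase g) (A.erase σ)
    = flowCost s fun k => (cnt I k - cnt A k) + ind σ k - ind g k := by
  unfold gap
  congr 1
  ext k
  rw [cnt_erase hg, cnt_erase hσ]
  ring

lemma not_nbrs_eq_none (hA : A.Nonempty) (hx : x ∉ A) (hl : leftNbr A x = none)
    (hr : rightNbr A x = none) : False := by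
  obtain ⟨e, he⟩ := hA
  rw [leftNbr_eq_none] at hl
  rw [rightNbr_eq_none] at hr
  exact hx (le_antisymm (hr e he) (hl e he) ▸ he)

lemma correct_mem_avail (hA : q.avail.Nonempty) : q.correct s x g ∈ q.avail := by
  classical
  unfold State.correct
  by_cases hx : x ∈ q.avail
  · rwa [if_pos hx]
  · rw [if_neg hx]
    rcases hl : leftNbr q.avail x with _ | l <;> rcases hr : rightNbr q.avail x with _ | r
    · exact (not_nbrs_eq_none hA hx hl hr).elim
    · exact (rightNbr_eq_some.1 hr).1
    · exact (leftNbr_eq_some.1 hl).1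
    · have h1 := (leftNbr_eq_some.1 hl).1
      have h2 := (rightNbr_eq_some.1 hr).1
      simp only
      split_ifs <;> assumption

lemma cnt_le_card_filter_lt {k : Fin n} (hk : k < x) : cnt I k ≤ ((I.filter (· < x)).card : ℤ) := by
  unfold cnt
  exact_mod_cast Finset.card_le_card fun e he => by
    rw [Finset.mem_filter] at he ⊢
    exact ⟨he.1, he.2.trans_lt hk⟩

lemma cnt_eq_filter_lt {k : Fin n} (ha : leftNbr A x = some a) (hak : a ≤ k) (hk : k < x) :
    cnt A k = ((A.filter (· < x)).card : ℤ) := by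
  unfold cnt
  congr 2
  ext e
  simp only [Finset.mem_filter]
  exact ⟨fun he => ⟨he.1, he.2.trans_lt hk⟩,
    fun he => ⟨he.1, ((leftNbr_eq_some.1 ha).2.2 e he.1 he.2).trans hak⟩⟩

lemma cnt_eq_of_rightNbr {k : Fin n} (hb : rightNbr A x = some b) (hxk : x ≤ k) (hk : k < b) :
    cnt A k = cnt A x := by
  unfold cnt
  congr 2
  ext e
  simp only [Finset.mem_filter]
  refine ⟨fun he => ⟨he.1, ?_⟩, fun he => ⟨he.1, he.2.trans hxk⟩⟩
  by_contra hc
  exact absurd ((rightNbr_eq_some.1 hb).2.2 e he.1 (not_le.1 hc)) (he.2.trans_lt hk).not_ge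

lemma one_le_cnt {k : Fin n} (hg : g ∈ I) (hk : g ≤ k) : 1 ≤ cnt I k := by
  unfold cnt
  exact_mod_cast Finset.card_pos.2 ⟨g, Finset.mem_filter.2 ⟨hg, hk⟩⟩

lemma cnt_lt_cnt {k k' : Fin n} (hk : k < k') (hg : g ∈ I) (h1 : k < g) (h2 : g ≤ k') :
    cnt I k + 1 ≤ cnt I k' := by
  unfold cnt
  exact_mod_cast Finset.card_lt_card (Finset.ssubset_iff_of_subset (fun e he => by
    rw [Finset.mem_filter] at he ⊢
    exact ⟨he.1, he.2.trans hk.le⟩) |>.2 ⟨g, by simp [hg, h2], by simp [h1]⟩)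

lemma cnt_lt_card {k : Fin n} (hg : g ∈ I) (h1 : k < g) : cnt I k + 1 ≤ I.card := by
  unfold cnt
  exact_mod_cast Finset.card_lt_card (Finset.ssubset_iff_of_subset (Finset.filter_subset _ _) |>.2
    ⟨g, hg, by simp [h1]⟩)

/-- Assigning a request at `x` in the direction prescribed by the islands costs no more than the
imaginary move, up to the decrease of the distance between imaginary and available servers. -/
lemma correct_cost_le (hs : StrictMono s) (hcard : q.imag.card = q.avail.card) (hg : g ∈ q.imag) :
    |s x - s (q.correct s x g)| + gap s (q.imag.erase g) (q.avail.erase (q.correct s x g))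
      ≤ |s x - s g| + gap s q.imag q.avail := by
  classical
  have hA : q.avail.Nonempty := by
    rw [← Finset.card_pos, ← hcard]
    exact Finset.card_pos.2 ⟨g, hg⟩
  rw [gap_erase hg (correct_mem_avail hA)]
  unfold gap State.correct
  by_cases hx : x ∈ q.avail
  · simp only [if_pos hx, sub_self, abs_zero, zero_add]
    have := flowCost_add_le hs (fun k => ind x k - ind g k) fun k => cnt q.imag k - cnt q.avail k
    rw [flowCost_ind hs] at this
    refine le_of_eq_of_le ?_ this
    congr 1
    ext k
    ring
  rw [if_neg hx]
  rcases hl : leftNbr q.avail x with _ | a <;> rcases hr : rightNbr q.avail x with _ | b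
  · exact (not_nbrs_eq_none hA hx hl hr).elim
  · -- All available servers are to the right of `x`.
    refine flowCost_move_right hs (rightNbr_eq_some.1 hr).2.1 fun k hk1 hk2 hk3 => ?_
    have h1 := cnt_eq_of_rightNbr hr hk1 hk2
    have h2 : cnt q.avail x = 0 := by
      unfold cnt
      rw [Finset.card_eq_zero.2, Nat.cast_zero]
      refine Finset.filter_eq_empty_iff.2 fun e he hex => hx ?_
      exact le_antisymm hex (leftNbr_eq_none.1 hl e he) ▸ he
    have := one_le_cnt hg hk3
    lia
  · refine flowCost_move_left hs (leftNbr_eq_some.1 hl).2.1 fun k hk1 hk2 hk3 => ?_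
    have h1 : cnt q.avail k = q.avail.card := by
      rw [cnt_eq_filter_lt hl hk1 hk2]
      congr 2
      refine Finset.filter_true_of_mem fun e he => lt_of_le_of_ne (rightNbr_eq_none.1 hr e he) ?_
      rintro rfl
      exact hx he
    have := cnt_lt_card hg hk3
    lia
  · simp only
    split_ifs with h1 h2 h3
    · refine flowCost_move_left hs (leftNbr_eq_some.1 hl).2.1 fun k hk1 hk2 hk3 => ?_
      have e1 := cnt_eq_filter_lt hl hk1 hk2
      have e2 := card_lt_of_inLeftIsland hs hx h1
      have e3 := cnt_le_card_filter_lt (I := q.imag) hk2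
      lia
    · refine flowCost_move_right hs (rightNbr_eq_some.1 hr).2.1 fun k hk1 hk2 hk3 => ?_
      have e1 := cnt_eq_of_rightNbr hr hk1 hk2
      have e2 := card_lt_of_inRightIsland hs hx h2
      have e3 := cnt_mono q.imag hk1
      unfold cnt at e1 e3 ⊢
      lia
    · refine flowCost_move_left hs (leftNbr_eq_some.1 hl).2.1 fun k hk1 hk2 hk3 => ?_
      have e1 := cnt_eq_filter_lt hl hk1 hk2
      have e2 := card_le_of_not_inRightIsland hcard h2
      have e3 : cnt q.imag k < ((q.imag.filter (· < x)).card : ℤ) := by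
        unfold cnt
        exact_mod_cast Finset.card_lt_card (Finset.ssubset_iff_of_subset (fun e he => by
          rw [Finset.mem_filter] at he ⊢
          exact ⟨he.1, he.2.trans_lt hk2⟩) |>.2 ⟨g, by simp [hg, h3], by simp [hk3]⟩)
      lia
    · have hgx : x < g := by
        refine lt_of_le_of_ne (not_lt.1 h3) ?_
        rintro rfl
        exact hx (mem_avail_of_not_island hcard h1 h2 hg)
      refine flowCost_move_right hs (rightNbr_eq_some.1 hr).2.1 fun k hk1 hk2 hk3 => ?_
      have e1 := cnt_eq_of_rightNbr hr hk1 hk2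
      have e2 := card_le_of_not_inLeftIsland hcard h1
      have e3 := cnt_lt_cnt (hgx.trans_le hk3) hg hgx hk3
      unfold cnt at e1 e3 ⊢
      lia

end steps

/-! ### The distance to the nearest available server -/

section nearest

variable {s : Fin n → ℝ} {A I : Finset (Fin n)} {R : List (Fin n)} {a b x g : Fin n}

/-- The cost of the flow from the requests of `R` to the servers that are no longer in `A`. -/
noncomputable def pastCost (s : Fin n → ℝ) (A : Finset (Fin n)) (R : List (Fin n)) : ℝ :=
  flowCost s fun k => cnt Finset.univ k - cnt A k - reqCnt R k

lemma pastCost_nonneg (hs : StrictMono s) (A : Finset (Fin n)) (R : List (Fin n)) :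
    0 ≤ pastCost s A R := flowCost_nonneg hs _

lemma pastCost_univ_nil (s : Fin n → ℝ) : pastCost s Finset.univ [] = 0 := by
  simp [pastCost, flowCost, reqCnt]

lemma pastCost_append_le (hs : StrictMono s) (hg : g ∈ A) :
    pastCost s (A.erase g) (R ++ [x]) ≤ pastCost s A R + |s x - s g| := by
  have h := flowCost_add_le hs (fun k => cnt Finset.univ k - cnt A k - reqCnt R k)
    fun k => ind g k - ind x k
  rw [flowCost_ind hs, abs_sub_comm] at h
  refine le_of_eq_of_le ?_ h
  unfold pastCost
  congr 1
  ext k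
  rw [cnt_erase hg]
  simp only [reqCnt, List.map_append, List.sum_append, List.map_cons, List.map_nil,
    List.sum_cons, List.sum_nil]
  ring

/-- The imaginary servers are matched to the available ones through the requests. -/
lemma gap_le_pastCost (hs : StrictMono s) (I A : Finset (Fin n)) (R : List (Fin n)) :
    gap s I A ≤ pastCost s I R + pastCost s A R := by
  have h := flowCost_add_le hs (fun k => - (cnt Finset.univ k - cnt I k - reqCnt R k))
    fun k => cnt Finset.univ k - cnt A k - reqCnt R k
  rw [flowCost_neg] at h
  refine le_of_eq_of_le ?_ h
  unfold gap
  congr 1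
  ext k
  ring

/-- An optimal matching gives a flow from the requests to as many servers, at the optimal cost. -/
lemma exists_flowCost_le_optCost (hs : StrictMono s) (h : R.length ≤ n) :
    ∃ O : Finset (Fin n), O.card = R.length ∧
      flowCost s (fun k => reqCnt R k - cnt O k) ≤ optCost s R := by
  obtain ⟨f, hf⟩ := exists_optCost_eq s h
  refine ⟨Finset.univ.map f, by simp, ?_⟩
  rw [← hf]
  simp only [← flowCost_ind hs]
  refine le_of_eq_of_le ?_ (flowCost_sum_le hs Finset.univ fun i k => ind (R.get i) k - ind (f i) k)
  congr 1
  ext k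
  rw [cnt_eq_sum, Finset.sum_map, Finset.sum_sub_distrib]
  congr 1
  exact (Fin.sum_univ_fun_getElem R fun x => ind x k).symm

lemma cnt_compl (A : Finset (Fin n)) (k : Fin n) :
    cnt Aᶜ k = cnt Finset.univ k - cnt A k := by
  rw [cnt_eq_sum, cnt_eq_sum, cnt_eq_sum, ← Finset.sum_add_sum_compl A]
  ring

/-- A request at `x` that finds no available server at `x` has an available server nearby, on a
side on which there is one: the optimal matching, combined with the matching of the previous
requests to the used servers, leads a unit of flow from `x` to an available server. -/
lemma exists_near_avail (hs : StrictMono s) (hx : x ∉ A) (hcard : A.card + R.length = n)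
    (hA : A.Nonempty) :
    (∃ b, rightNbr A x = some b ∧ |s x - s b| ≤ optCost s (R ++ [x]) + pastCost s A R) ∨
      ∃ a, leftNbr A x = some a ∧ |s x - s a| ≤ optCost s (R ++ [x]) + pastCost s A R := by
  have hA' := hA.card_pos
  obtain ⟨O, hO, hopt⟩ := exists_flowCost_le_optCost (R := R ++ [x]) hs (by
    rw [List.length_append, List.length_singleton]; omega)
  rw [List.length_append, List.length_singleton] at hO
  have hflow : flowCost s (fun k => ind x k + (cnt Aᶜ k - cnt O k))
      ≤ optCost s (R ++ [x]) + pastCost s A R := by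
    refine le_trans ?_ (add_le_add_left hopt _)
    refine le_of_eq_of_le ?_ (flowCost_add_le hs _ _)
    congr 1
    ext k
    rw [cnt_compl]
    simp only [reqCnt, List.map_append, List.sum_append, List.map_cons, List.map_nil,
      List.sum_cons, List.sum_nil]
    ring
  have hcompl : Aᶜ.card = R.length := by
    rw [Finset.card_compl, Fintype.card_fin]; omega
  -- The flow beside `x` is at least `1` towards the right or at least `1` towards the left.
  rcases le_or_gt 0 (cnt Aᶜ x - cnt O x) with hD | hD
  · left
    rcases hr : rightNbr A x with _ | b
    · exfalso
      -- There would be fewer used servers than requests.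
      have hlast : ∀ S : Finset (Fin n), cnt S ⟨n - 1, by have := x.2; omega⟩ = S.card := by
        intro S
        unfold cnt
        rw [Finset.filter_true_of_mem]
        intro e _
        rw [Fin.le_def]
        have := e.2
        simp only
        omega
      have h1 := cnt_sub_le (I := O) (A := Aᶜ) (k := x) (k' := ⟨n - 1, by have := x.2; omega⟩)
        (by rw [Fin.le_def]; have := x.2; simp only; omega) (fun e _ hxe _ => by
          rw [Finset.mem_compl]
          exact fun he => (rightNbr_eq_none.1 hr e he).not_gt hxe)
      rw [hlast, hlast, hO, hcompl] at h1
      push_cast at h1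
      lia
    · refine ⟨b, rfl, ?_⟩
      have hxb := (rightNbr_eq_some.1 hr).2.1
      rw [abs_sub_comm, abs_of_nonneg (sub_nonneg.2 (hs hxb).le)]
      refine (le_flowCost hs hxb.le fun k hk1 hk2 => ?_).trans hflow
      have h1 := cnt_sub_le (I := O) (A := Aᶜ) hk1 fun e _ hxe hek => by
        rw [Finset.mem_compl]
        exact fun he => ((rightNbr_eq_some.1 hr).2.2 e he hxe).not_gt (hek.trans_lt hk2)
      simp only [ind, if_pos hk1]
      exact le_abs.2 (Or.inl (by lia))
  · right
    rcases hl : leftNbr A x with _ | a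
    · exfalso
      have h1 : cnt O x ≤ cnt Aᶜ x := by
        unfold cnt
        exact_mod_cast Finset.card_le_card fun e he => by
          rw [Finset.mem_filter] at he ⊢
          refine ⟨Finset.mem_compl.2 fun heA => hx ?_, he.2⟩
          exact le_antisymm he.2 (leftNbr_eq_none.1 hl e heA) ▸ heA
      lia
    · refine ⟨a, rfl, ?_⟩
      have hax := (leftNbr_eq_some.1 hl).2.1
      rw [abs_of_nonneg (sub_nonneg.2 (hs hax).le)]
      refine (le_flowCost hs hax.le fun k hk1 hk2 => ?_).trans hflow
      have h1 := cnt_sub_le (I := O) (A := Aᶜ) hk2.le fun e _ hke hex => by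
        rw [Finset.mem_compl]
        intro he
        rcases hex.lt_or_eq with hlt | rfl
        · exact ((leftNbr_eq_some.1 hl).2.2 e he hlt).not_gt (hk1.trans_lt hke)
        · exact hx he
      simp only [ind, if_neg hk2.not_ge]
      exact le_abs.2 (Or.inr (by lia))

end nearest

/-! ### Triggering requests -/

section trigger

variable {s : Fin n → ℝ} {q : State n} {a b x y g σ : Fin n}

/-- The expectation of a value that is `c` at one point and zero elsewhere, and of the complementary
value. -/
lemma expect_one_or_other {α : Type*} [DecidableEq α] (p : PMF α) (b : α) (c : ℝ≥0∞) :
    expect p (fun σ => if σ = b then c else 0) = p b * c ∧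
      p b * c + expect p (fun σ => if σ = b then 0 else c) = c := by
  have h1 : expect p (fun σ => if σ = b then c else 0) = p b * c := by
    unfold expect
    rw [tsum_eq_single b fun σ hσ => by simp [hσ]]
    simp
  refine ⟨h1, ?_⟩
  rw [← h1, ← expect_add]
  refine (expect_congr fun σ _ => ?_).trans (expect_const p c)
  split_ifs <;> simp

lemma expect_eq_le_expect_ne {α : Type*} [DecidableEq α] {p : PMF α} {b : α} {c : ℝ≥0∞}
    (hc : c ≠ ⊤) (hp : p b ≤ 1 / 2) : expect p (fun σ => if σ = b then c else 0)
      ≤ expect p fun σ => if σ = b then 0 else c := by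
  obtain ⟨h1, h2⟩ := expect_one_or_other p b c
  rw [h1]
  have h3 : p b * c ≤ c / 2 := by
    rw [ENNReal.div_eq_inv_mul, ← one_div]
    gcongr
  have h4 : p b * c ≠ ⊤ := ne_top_of_le_ne_top (ENNReal.div_ne_top hc (by simp)) h3
  refine (ENNReal.add_le_add_iff_left h4).1 ?_
  rw [h2]
  calc p b * c + p b * c ≤ c / 2 + c / 2 := add_le_add h3 h3
    _ = c := ENNReal.add_halves c

lemma expect_ne_le_expect_eq {α : Type*} [DecidableEq α] {p : PMF α} {b : α} {c : ℝ≥0∞}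
    (hc : c ≠ ⊤) (hp : 1 / 2 ≤ p b) : expect p (fun σ => if σ = b then 0 else c)
      ≤ expect p fun σ => if σ = b then c else 0 := by
  obtain ⟨h1, h2⟩ := expect_one_or_other p b c
  rw [h1]
  have h3 : c / 2 ≤ p b * c := by
    rw [ENNReal.div_eq_inv_mul, ← one_div]
    gcongr
  refine le_trans ?_ h3
  have h5 : c / 2 ≠ ⊤ := ENNReal.div_ne_top hc (by simp)
  refine (ENNReal.add_le_add_iff_left h5).1 ?_
  rw [ENNReal.add_halves]
  calc c / 2 + expect p (fun σ => if σ = b then 0 else c)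
      ≤ p b * c + expect p (fun σ => if σ = b then 0 else c) := by gcongr
    _ = c := h2

/-- The expected cost of the imaginary move of a request that would arrive now at `y`. -/
noncomputable def probeCost (s : Fin n → ℝ) (q : State n) (y : Fin n) : ℝ≥0∞ :=
  expect (imagMove s q.est q.imag y) fun g => ENNReal.ofReal |s y - s g|

open Classical in
/-- The points that are not trigger points. -/
noncomputable def State.nontriggers (s : Fin n → ℝ) (q : State n) : Finset (Fin n) :=
  Finset.univ.filter fun y => ¬ q.IsTrigger s y

/-- The expected cost of the imaginary moves of two requests, at the first points to the left and
right of `x` that are not trigger points. -/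
noncomputable def probeCosts (s : Fin n → ℝ) (q : State n) (x : Fin n) : ℝ≥0∞ :=
  (leftNbr (q.nontriggers s) x).elim 0 (probeCost s q) +
    (rightNbr (q.nontriggers s) x).elim 0 (probeCost s q)

/-- The point `yLeft` lies between `a` and `x`; unless it is `a`, it is the first point to the left
of `x` that is not a trigger point, whatever `a` is. -/
lemma yLeft_spec (ha : a < x) : a ≤ q.yLeft s a x ∧ q.yLeft s a x < x ∧
    (q.yLeft s a x ≠ a → leftNbr (q.nontriggers s) x = some (q.yLeft s a x)) := by
  classical
  unfold State.yLeft
  rcases hl : leftNbr (Finset.univ.filter fun y => a ≤ y ∧ (y = a ∨ ¬ q.IsTrigger s y)) x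
    with _ | y
  · rw [leftNbr_eq_none] at hl
    exact absurd (hl a (by simp)) ha.not_ge
  · rw [leftNbr_eq_some] at hl
    obtain ⟨h1, h2, h3⟩ := hl
    simp only [Finset.mem_filter, Finset.mem_univ, true_and] at h1 h3
    refine ⟨h1.1, h2, fun hya => ?_⟩
    simp only [Option.getD_some] at hya ⊢
    rw [leftNbr_eq_some]
    refine ⟨by simpa [State.nontriggers] using h1.2.resolve_left hya, h2, fun e he hex => ?_⟩
    have he' : ¬ q.IsTrigger s e := by simpa [State.nontriggers] using he
    rcases le_total a e with hae | hae
    · exact h3 e ⟨hae, Or.inr he'⟩ hex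
    · exact hae.trans h1.1

lemma yRight_spec (hb : x < b) : q.yRight s b x ≤ b ∧ x < q.yRight s b x ∧
    (q.yRight s b x ≠ b → rightNbr (q.nontriggers s) x = some (q.yRight s b x)) := by
  classical
  unfold State.yRight
  rcases hl : rightNbr (Finset.univ.filter fun y => y ≤ b ∧ (y = b ∨ ¬ q.IsTrigger s y)) x
    with _ | y
  · rw [rightNbr_eq_none] at hl
    exact absurd (hl b (by simp)) hb.not_ge
  · rw [rightNbr_eq_some] at hl
    obtain ⟨h1, h2, h3⟩ := hl
    simp only [Finset.mem_filter, Finset.mem_univ, true_and] at h1 h3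
    refine ⟨h1.1, h2, fun hya => ?_⟩
    simp only [Option.getD_some] at hya ⊢
    rw [rightNbr_eq_some]
    refine ⟨by simpa [State.nontriggers] using h1.2.resolve_left hya, h2, fun e he hex => ?_⟩
    have he' : ¬ q.IsTrigger s e := by simpa [State.nontriggers] using he
    rcases le_total e b with hae | hae
    · exact h3 e ⟨hae, Or.inr he'⟩ hex
    · exact h1.1.trans hae

lemma assign_of_mem (hy : y ∈ q.avail) : q.assign s y = PMF.pure y := by
  unfold State.assign
  have : (fun g => q.correct s y g) = fun _ => y := by
    ext g
    simp [State.correct, hy]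
  rw [this]
  exact PMF.map_const _ _

/-- The analogue of `correct_cost_le` for a request that arrives at `y`. -/
lemma expect_assign_self_le (hs : StrictMono s) (hcard : q.imag.card = q.avail.card)
    (hA : q.avail.Nonempty) (y : Fin n) :
    expect (q.assign s y) (fun σ => ENNReal.ofReal |s y - s σ|)
      ≤ probeCost s q y + ENNReal.ofReal (gap s q.imag q.avail) := by
  have hI : q.imag.Nonempty := by rw [← Finset.card_pos, hcard]; exact hA.card_pos
  unfold State.assign probeCost
  rw [expect_map, ← expect_const (imagMove s q.est q.imag y)
    (ENNReal.ofReal (gap s q.imag q.avail)), ← expect_add]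
  refine expect_mono fun g hg => ?_
  have h := correct_cost_le (x := y) hs hcard (mem_of_mem_support_imagMove hI hg)
  have h' := gap_nonneg hs (q.imag.erase g) (q.avail.erase (q.correct s y g))
  rw [← ENNReal.ofReal_add (abs_nonneg _) (gap_nonneg hs _ _)]
  exact ENNReal.ofReal_le_ofReal (by linarith)

lemma assign_mem_avail (hA : q.avail.Nonempty) (h : σ ∈ (q.assign s y).support) :
    σ ∈ q.avail := by
  unfold State.assign at h
  rw [PMF.mem_support_map_iff] at h
  obtain ⟨g, -, rfl⟩ := h
  exact correct_mem_avail hA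

/-- A request that arrives between `a` and `b` is assigned to one of them. -/
lemma assign_eq_or (ha : leftNbr q.avail x = some a) (hb : rightNbr q.avail x = some b)
    (hx : x ∉ q.avail) (h1 : a ≤ y) (h2 : y ≤ b) (h : σ ∈ (q.assign s y).support) :
    σ = a ∨ σ = b := by
  classical
  rw [leftNbr_eq_some] at ha
  rw [rightNbr_eq_some] at hb
  have key : ∀ e ∈ q.avail, a < e → e < b → False := fun e he hae heb => by
    rcases lt_trichotomy e x with h | h | h
    · exact (ha.2.2 e he h).not_gt hae
    · exact hx (h ▸ he)
    · exact (hb.2.2 e he h).not_gt heb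
  unfold State.assign at h
  rw [PMF.mem_support_map_iff] at h
  obtain ⟨g, -, rfl⟩ := h
  by_cases hy : y ∈ q.avail
  · simp only [State.correct, if_pos hy]
    by_contra hc
    rw [not_or] at hc
    exact key y hy (lt_of_le_of_ne h1 (Ne.symm hc.1)) (lt_of_le_of_ne h2 hc.2)
  · have hya : a < y := lt_of_le_of_ne h1 fun h => hy (h ▸ ha.1)
    have hyb : y < b := lt_of_le_of_ne h2 fun h => hy (h ▸ hb.1)
    have hl : leftNbr q.avail y = some a := leftNbr_eq_some.2
      ⟨ha.1, hya, fun e he hey => not_lt.1 fun hc => key e he hc (hey.trans hyb)⟩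
    have hr : rightNbr q.avail y = some b := rightNbr_eq_some.2
      ⟨hb.1, hyb, fun e he hey => not_lt.1 fun hc => key e he (hya.trans hey) hc⟩
    simp only [State.correct, if_neg hy, hl, hr]
    split_ifs <;> simp

lemma trigAssign_mem_avail (hA : q.avail.Nonempty) (h : σ ∈ (q.trigAssign s x).support) :
    σ ∈ q.avail := by
  unfold State.trigAssign at h
  by_cases hx : x ∈ q.avail
  · rw [if_pos hx, PMF.support_pure, Set.mem_singleton_iff] at h
    rwa [h]
  rw [if_neg hx] at h
  rcases hl : leftNbr q.avail x with _ | a <;> rcases hr : rightNbr q.avail x with _ | b <;>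
    simp only [hl, hr] at h
  · exact (not_nbrs_eq_none hA hx hl hr).elim
  · rw [PMF.support_pure, Set.mem_singleton_iff] at h
    exact h ▸ (rightNbr_eq_some.1 hr).1
  · rw [PMF.support_pure, Set.mem_singleton_iff] at h
    exact h ▸ (leftNbr_eq_some.1 hl).1
  · split_ifs at h <;> exact assign_mem_avail hA h

/-- A triggering request costs at most a constant times the costs of requests at the nearest points
that are not trigger points, plus the bound of `exists_near_avail` for the distance
to an available server. -/
lemma expect_trigAssign_le (hs : StrictMono s) (hcard : q.imag.card = q.avail.card)
    (hlen : q.avail.card + q.hist.length = n) (hA : q.avail.Nonempty) (x : Fin n) :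
    expect (q.trigAssign s x) (fun σ => ENNReal.ofReal |s x - s σ|)
      ≤ 2 * (probeCosts s q x + ENNReal.ofReal (gap s q.imag q.avail))
        + ENNReal.ofReal (optCost s (q.hist ++ [x]) + pastCost s q.avail q.hist) := by
  classical
  unfold State.trigAssign
  by_cases hx : x ∈ q.avail
  · simp [if_pos hx, expect_pure]
  rw [if_neg hx]
  have hnear := exists_near_avail hs hx hlen hA
  set B := optCost s (q.hist ++ [x]) + pastCost s q.avail q.hist
  set W := ENNReal.ofReal (gap s q.imag q.avail)
  rcases hl : leftNbr q.avail x with _ | a <;> rcases hr : rightNbr q.avail x with _ | b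
  · exact (not_nbrs_eq_none hA hx hl hr).elim
  · simp only [expect_pure]
    refine le_add_left (ENNReal.ofReal_le_ofReal ?_)
    simpa [hl, hr] using hnear
  · simp only [expect_pure]
    refine le_add_left (ENNReal.ofReal_le_ofReal ?_)
    simpa [hl, hr] using hnear
  simp only [hl, hr, Option.some.injEq, exists_eq_left'] at hnear ⊢
  have hax := (leftNbr_eq_some.1 hl).2.1
  have hxb := (rightNbr_eq_some.1 hr).2.1
  have haA := (leftNbr_eq_some.1 hl).1
  have hbA := (rightNbr_eq_some.1 hr).1
  have hsa := hs hax
  have hsb := hs hxb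
  obtain ⟨hl1, hl2, hl3⟩ := yLeft_spec (s := s) (q := q) hax
  obtain ⟨hr1, hr2, hr3⟩ := yRight_spec (s := s) (q := q) hxb
  set u := q.yLeft s a x
  set v := q.yRight s b x
  have hsu := hs.monotone hl1
  have hsu' := hs hl2
  have hsv := hs.monotone hr1
  have hsv' := hs hr2
  have hu : ∀ σ ∈ (q.assign s u).support, σ = a ∨ σ = b := fun σ =>
    assign_eq_or hl hr hx hl1 (hl2.trans hxb).le
  have hv : ∀ σ ∈ (q.assign s v).support, σ = a ∨ σ = b := fun σ =>
    assign_eq_or hl hr hx (hax.trans hr2).le hr1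
  -- The servers `a` and `b` serve requests at their locations for free; at any other point, the
  -- cost is compared to that of an imaginary move.
  have hGu : expect (q.assign s u) (fun σ => ENNReal.ofReal |s u - s σ|)
      ≤ probeCosts s q x + W := by
    by_cases hua : u = a
    · rw [hua, assign_of_mem haA, expect_pure]
      simp
    · refine (expect_assign_self_le hs hcard hA u).trans ?_
      unfold probeCosts
      rw [hl3 hua]
      simp only [Option.elim_some]
      gcongr
      exact le_self_add
  have hGv : expect (q.assign s v) (fun σ => ENNReal.ofReal |s v - s σ|)
      ≤ probeCosts s q x + W := by
    by_cases hva : v = b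
    · rw [hva, assign_of_mem hbA, expect_pure]
      simp
    · refine (expect_assign_self_le hs hcard hA v).trans ?_
      unfold probeCosts
      rw [hr3 hva]
      simp only [Option.elim_some]
      gcongr
      exact le_add_self
  have hab : a ≠ b := (hax.trans hxb).ne
  split_ifs with c1 c2 c3
  · -- Going to `b` costs `s v - s x` more from `x` than from `v`.  As `a` is at least as likely,
    -- and at least this far from `v`, the extra cost is bounded by that of a request at `v`.
    refine le_add_right ?_
    rw [two_mul]
    have step : expect (q.assign s v) (fun σ => ENNReal.ofReal |s x - s σ|)
        ≤ expect (q.assign s v) (fun σ => ENNReal.ofReal |s v - s σ|)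
          + expect (q.assign s v) fun σ => if σ = b then ENNReal.ofReal (s v - s x) else 0 := by
      rw [← expect_add]
      refine expect_mono fun σ hσ => ?_
      rcases hv σ hσ with rfl | rfl
      · rw [if_neg hab, add_zero, abs_of_pos (by linarith), abs_of_pos (by linarith)]
        exact ENNReal.ofReal_le_ofReal (by linarith)
      · rw [if_pos rfl, ← ENNReal.ofReal_add (abs_nonneg _) (by linarith)]
        refine ENNReal.ofReal_le_ofReal ?_
        rw [abs_of_neg (by linarith), abs_of_nonpos (by linarith)]
        linarith
    refine step.trans (add_le_add hGv (le_trans ?_ hGv))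
    refine (expect_eq_le_expect_ne ENNReal.ofReal_ne_top c1.le).trans
      (expect_mono fun σ hσ => ?_)
    rcases hv σ hσ with rfl | rfl
    · rw [if_neg hab]
      refine ENNReal.ofReal_le_ofReal ?_
      rw [abs_of_pos (by linarith)]
      linarith
    · simp
  · -- The mirror image of the previous case.
    refine le_add_right ?_
    rw [two_mul]
    have step : expect (q.assign s u) (fun σ => ENNReal.ofReal |s x - s σ|)
        ≤ expect (q.assign s u) (fun σ => ENNReal.ofReal |s u - s σ|)
          + expect (q.assign s u) fun σ => if σ = b then 0 else ENNReal.ofReal (s x - s u) := by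
      rw [← expect_add]
      refine expect_mono fun σ hσ => ?_
      rcases hu σ hσ with rfl | rfl
      · rw [if_neg hab, ← ENNReal.ofReal_add (abs_nonneg _) (by linarith)]
        refine ENNReal.ofReal_le_ofReal ?_
        rw [abs_of_pos (by linarith), abs_of_nonneg (by linarith)]
        linarith
      · rw [if_pos rfl, add_zero, abs_of_neg (by linarith), abs_of_neg (by linarith)]
        exact ENNReal.ofReal_le_ofReal (by linarith)
    refine step.trans (add_le_add hGu (le_trans ?_ hGu))
    refine (expect_ne_le_expect_eq ENNReal.ofReal_ne_top c2.le).trans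
      (expect_mono fun σ hσ => ?_)
    rcases hu σ hσ with rfl | rfl
    · simp [hab]
    · rw [if_pos rfl]
      refine ENNReal.ofReal_le_ofReal ?_
      rw [abs_of_neg (by linarith)]
      linarith
  · -- The nearer server is cheap, and `u` is farther from the other one than `x`.
    rw [two_mul, add_assoc]
    refine le_add_left ?_
    refine le_trans ?_ (add_le_add_left hGu _)
    rw [← expect_const (q.assign s u) (ENNReal.ofReal B), ← expect_add]
    refine expect_mono fun σ hσ => ?_
    rcases hu σ hσ with rfl | rfl
    · refine le_add_left (ENNReal.ofReal_le_ofReal ?_)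
      rcases hnear with h | h
      · rw [abs_of_neg (by linarith)] at h
        rw [abs_of_pos (by linarith)]
        linarith
      · exact h
    · refine le_add_right (ENNReal.ofReal_le_ofReal ?_)
      rw [abs_of_neg (by linarith), abs_of_neg (by linarith)]
      linarith
  · rw [two_mul, add_assoc]
    refine le_add_left ?_
    refine le_trans ?_ (add_le_add_left hGv _)
    rw [← expect_const (q.assign s v) (ENNReal.ofReal B), ← expect_add]
    refine expect_mono fun σ hσ => ?_
    rcases hv σ hσ with rfl | rfl
    · refine le_add_right (ENNReal.ofReal_le_ofReal ?_)
      rw [abs_of_pos (by linarith), abs_of_pos (by linarith)]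
      linarith
    · refine le_add_left (ENNReal.ofReal_le_ofReal ?_)
      rcases hnear with h | h
      · exact h
      · rw [abs_of_pos (by linarith)] at h
        rw [abs_of_neg (by linarith)]
        linarith

end trigger

/-! ### The state of the algorithm after a sequence of requests -/

section global

variable {s : Fin n → ℝ} {Z : ℝ} {R : List (Fin n)} {x : Fin n} {I : Finset (Fin n)} {e : ℕ}

/-- A further request does not decrease the optimal cost; the bound on the length excludes the junk
value of `optCost` for more requests than servers. -/
lemma optCost_le_append (s : Fin n → ℝ) (x : Fin n) (h : R.length + 1 ≤ n) :
    optCost s R ≤ optCost s (R ++ [x]) := by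
  have hlen : (R ++ [x]).length = R.length + 1 := by simp
  obtain ⟨f, hf⟩ := exists_optCost_eq s (R := R ++ [x]) (by omega)
  rw [← hf]
  have hle : R.length ≤ (R ++ [x]).length := by omega
  refine (optCost_le s R ((Fin.castLEEmb hle).trans f)).trans ?_
  refine le_trans (le_of_eq ?_) (Finset.sum_le_univ_sum_of_nonneg
    (s := Finset.univ.map (Fin.castLEEmb hle)) fun k => abs_nonneg _)
  rw [Finset.sum_map]
  refine Finset.sum_congr rfl fun k _ => ?_
  simp

/-- An optimal cost below the least distance of two servers is zero. -/
lemma optCost_eq_zero (hs : ∀ i j : Fin n, i < j → 1 ≤ s j - s i) (h : R.length ≤ n)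
    (hopt : optCost s R < 1) : optCost s R = 0 := by
  obtain ⟨f, hf⟩ := exists_optCost_eq s h
  rw [← hf] at hopt ⊢
  refine Finset.sum_eq_zero fun k _ => ?_
  have h1 : |s (R.get k) - s (f k)| < 1 := lt_of_le_of_lt
    (Finset.single_le_sum (f := fun k => |s (R.get k) - s (f k)|) (fun k _ => abs_nonneg _)
      (Finset.mem_univ k)) hopt
  rcases lt_trichotomy (R.get k) (f k) with h | h | h
  · have := hs _ _ h
    rw [abs_lt] at h1
    linarith
  · rw [h, sub_self, abs_zero]
  · have := hs _ _ h
    rw [abs_lt] at h1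
    linarith

lemma card_of_mem_simulate (h : R.length ≤ n)
    (hI : I ∈ (simulate s Z Finset.univ R).support) : I.card + R.length = n := by
  induction R using List.reverseRecOn generalizing I with
  | nil =>
    rw [simulate, PMF.support_pure, Set.mem_singleton_iff] at hI
    simp [hI]
  | append_singleton R x ih =>
    rw [List.length_append, List.length_singleton] at h ⊢
    rw [simulate_append, PMF.mem_support_bind_iff] at hI
    obtain ⟨J, hJ, hI⟩ := hI
    rw [PMF.mem_support_map_iff] at hI
    obtain ⟨g, hg, rfl⟩ := hI
    have hJc := ih (by omega) hJ
    have hJ' : J.Nonempty := Finset.card_pos.1 (by omega)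
    rw [Finset.card_erase_of_mem (mem_of_mem_support_imagMove hJ' hg)]
    have := hJ'.card_pos
    omega

/-- The matching between requests and imaginary moves bounds the flow between the requests and the
servers that are no longer imaginary. -/
lemma expect_pastCost_simulate_le (hs : StrictMono s) (h : R.length ≤ n) :
    expect (simulate s Z Finset.univ R) (fun I => ENNReal.ofReal (pastCost s I R))
      ≤ simCost s Z Finset.univ R := by
  induction R using List.reverseRecOn with
  | nil => simp [simulate, expect_pure, pastCost_univ_nil]
  | append_singleton R x ih =>
    rw [List.length_append, List.length_singleton] at h
    rw [simulate_append, simCost_append, expect_bind]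
    refine le_trans ?_ (add_le_add_left (ih (by omega)) _)
    rw [← expect_add]
    refine expect_mono fun J hJ => ?_
    have hJc := card_of_mem_simulate (by omega) hJ
    have hJ' : J.Nonempty := Finset.card_pos.1 (by omega)
    rw [expect_map, ← expect_const (imagMove s Z J x) (ENNReal.ofReal (pastCost s J R)),
      ← expect_add]
    refine expect_mono fun g hg => ?_
    rw [← ENNReal.ofReal_add (pastCost_nonneg hs _ _) (abs_nonneg _)]
    exact ENNReal.ofReal_le_ofReal
      (pastCost_append_le hs (mem_of_mem_support_imagMove hJ' hg))

/-- One step of the algorithm, with a record of the cost so far. -/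
noncomputable def track (s : Fin n → ℝ) (p : State n × ℝ) (x : Fin n) : PMF (State n × ℝ) :=
  (p.1.step s x).map fun t => (t.1, p.2 + |s x - s t.2|)

/-- The algorithm, with a record of the cost so far. -/
noncomputable def trackAll (s : Fin n → ℝ) :
    State n × ℝ → List (Fin n) → PMF (State n × ℝ)
  | p, [] => PMF.pure p
  | p, x :: R => (track s p x).bind fun p' => trackAll s p' R

lemma trackAll_append (p : State n × ℝ) (R : List (Fin n)) (x : Fin n) :
    trackAll s p (R ++ [x]) = (trackAll s p R).bind fun p' => track s p' x := by
  induction R generalizing p with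
  | nil => simp [trackAll, PMF.pure_bind, PMF.bind_pure]
  | cons y R ih => simp [trackAll, PMF.bind_bind, ih]

/-- The expected cost of the assigned servers is the expectation of the recorded cost. -/
lemma expect_run (q : State n) (c : ℝ) (R : List (Fin n)) :
    expect (q.run s R) (fun l => ENNReal.ofReal (c + assignCost s R l))
      = expect (trackAll s (q, c) R) fun p => ENNReal.ofReal p.2 := by
  induction R generalizing q c with
  | nil => simp [State.run, trackAll, expect_pure, assignCost]
  | cons x R ih =>
    rw [State.run, trackAll, expect_bind, expect_bind, track, expect_map]
    refine expect_congr fun t _ => ?_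
    rw [expect_map, ← ih]
    refine expect_congr fun l _ => ?_
    simp [assignCost, add_assoc]

lemma expect_track_of_trigger {p : State n × ℝ} (h : p.1.IsTrigger s x)
    (F : State n × ℝ → ℝ≥0∞) :
    expect (track s p x) F = expect (p.1.trigAssign s x) fun σ =>
      expect (simulate s (10 ^ sInf {j : ℕ | optCost s (p.1.hist ++ [x]) < 10 ^ j})
        Finset.univ (p.1.hist ++ [x])) fun I =>
          F (⟨p.1.hist ++ [x], sInf {j : ℕ | optCost s (p.1.hist ++ [x]) < 10 ^ j}, I,
            p.1.avail.erase σ⟩, p.2 + |s x - s σ|) := by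
  rw [track, State.step, if_pos h, expect_map, expect_bind]
  refine expect_congr fun σ _ => ?_
  rw [expect_map]

lemma expect_track_of_not_trigger {p : State n × ℝ} (h : ¬ p.1.IsTrigger s x)
    (F : State n × ℝ → ℝ≥0∞) :
    expect (track s p x) F = expect (imagMove s p.1.est p.1.imag x) fun g =>
      F (⟨p.1.hist ++ [x], p.1.expo, p.1.imag.erase g, p.1.avail.erase (p.1.correct s x g)⟩,
        p.2 + |s x - s (p.1.correct s x g)|) := by
  rw [track, State.step, if_neg h, expect_map, expect_map]

lemma mem_support_track_of_trigger {p p' : State n × ℝ} (h : p.1.IsTrigger s x)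
    (hp' : p' ∈ (track s p x).support) :
    ∃ σ ∈ (p.1.trigAssign s x).support,
      ∃ I ∈ (simulate s (10 ^ sInf {j : ℕ | optCost s (p.1.hist ++ [x]) < 10 ^ j})
        Finset.univ (p.1.hist ++ [x])).support,
        p' = (⟨p.1.hist ++ [x], sInf {j : ℕ | optCost s (p.1.hist ++ [x]) < 10 ^ j}, I,
            p.1.avail.erase σ⟩, p.2 + |s x - s σ|) := by
  rw [track, State.step, if_pos h, PMF.mem_support_map_iff] at hp'
  obtain ⟨t, ht, rfl⟩ := hp'
  rw [PMF.mem_support_bind_iff] at ht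
  obtain ⟨σ, hσ, ht⟩ := ht
  rw [PMF.mem_support_map_iff] at ht
  obtain ⟨I, hI, rfl⟩ := ht
  exact ⟨σ, hσ, I, hI, rfl⟩

lemma mem_support_track_of_not_trigger {p p' : State n × ℝ} (h : ¬ p.1.IsTrigger s x)
    (hp' : p' ∈ (track s p x).support) :
    ∃ g ∈ (imagMove s p.1.est p.1.imag x).support,
        p' = (⟨p.1.hist ++ [x], p.1.expo, p.1.imag.erase g,
          p.1.avail.erase (p.1.correct s x g)⟩, p.2 + |s x - s (p.1.correct s x g)|) := by
  rw [track, State.step, if_neg h, PMF.mem_support_map_iff] at hp'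
  obtain ⟨t, ht, rfl⟩ := hp'
  rw [PMF.mem_support_map_iff] at ht
  obtain ⟨g, hg, rfl⟩ := ht
  exact ⟨g, hg, rfl⟩

/-- The requests are assigned to distinct available servers as long as the available servers
suffice. -/
lemma length_nodup_of_mem_run (q : State n) (h : R.length ≤ q.avail.card) {l : List (Fin n)}
    (hl : l ∈ (q.run s R).support) :
    l.length = R.length ∧ l.Nodup ∧ ∀ y ∈ l, y ∈ q.avail := by
  classical
  induction R generalizing q l with
  | nil =>
    rw [State.run, PMF.support_pure, Set.mem_singleton_iff] at hl
    simp [hl]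
  | cons x R ih =>
    rw [List.length_cons] at h ⊢
    have hA : q.avail.Nonempty := Finset.card_pos.1 (by omega)
    rw [State.run, PMF.mem_support_bind_iff] at hl
    obtain ⟨t, ht, hl⟩ := hl
    rw [PMF.mem_support_map_iff] at hl
    obtain ⟨l, hl, rfl⟩ := hl
    have key : t.2 ∈ q.avail ∧ t.1.avail = q.avail.erase t.2 := by
      unfold State.step at ht
      split_ifs at ht
      · rw [PMF.mem_support_bind_iff] at ht
        obtain ⟨σ, hσ, ht⟩ := ht
        rw [PMF.mem_support_map_iff] at ht
        obtain ⟨I, -, rfl⟩ := ht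
        exact ⟨trigAssign_mem_avail hA hσ, rfl⟩
      · rw [PMF.mem_support_map_iff] at ht
        obtain ⟨g, -, rfl⟩ := ht
        exact ⟨correct_mem_avail hA, rfl⟩
    obtain ⟨h1, h2, h3⟩ := ih t.1 (by rw [key.2, Finset.card_erase_of_mem key.1]; omega) hl
    rw [key.2] at h3
    refine ⟨by simp [h1], List.nodup_cons.2 ⟨fun hm => ?_, h2⟩, fun y hy => ?_⟩
    · exact Finset.notMem_erase _ _ (h3 _ hm)
    · rcases List.mem_cons.1 hy with rfl | hy
      · exact key.1
      · exact Finset.mem_of_mem_erase (h3 y hy)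

/-- The new estimate after a triggering request, whose optimal cost is `r`. -/
lemma sInf_pow_spec {r : ℝ} (he : 10 ^ e ≤ r) :
    r < 10 ^ sInf {j : ℕ | r < 10 ^ j} ∧ e < sInf {j : ℕ | r < 10 ^ j} ∧
      (10 : ℝ) ^ sInf {j : ℕ | r < 10 ^ j} ≤ 10 * r := by
  have hne : {j : ℕ | r < 10 ^ j}.Nonempty := pow_unbounded_of_one_lt r (by norm_num)
  have h1 : r < 10 ^ sInf {j : ℕ | r < 10 ^ j} := Nat.sInf_mem hne
  have h2 : e < sInf {j : ℕ | r < 10 ^ j} := by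
    by_contra hc
    exact absurd (he.trans_lt h1) (pow_le_pow_right₀ (by norm_num) (not_lt.1 hc)).not_gt
  refine ⟨h1, h2, ?_⟩
  obtain ⟨m, hm⟩ : ∃ m, sInf {j : ℕ | r < 10 ^ j} = m + 1 :=
    ⟨_, (Nat.succ_pred_eq_of_pos (by omega)).symm⟩
  have h3 : m ∉ {j : ℕ | r < 10 ^ j} := Nat.notMem_of_lt_sInf (by omega)
  rw [hm, pow_succ]
  have : (10 : ℝ) ^ m ≤ r := not_lt.1 h3
  linarith

end global

/-! ### Amortization over the phases of the estimate -/

section amortization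

variable {s : Fin n → ℝ} {R : List (Fin n)} {x : Fin n} {e : ℕ} {ν : PMF (State n × ℝ)}

/-- What is known of the law `ν` of the state and the cost after the requests `R`.  The exponent of
the estimate is deterministic, as the requests are fixed in advance, and the imaginary servers are
distributed as in a run with that estimate from the start. -/
structure Invariant (s : Fin n → ℝ) (R : List (Fin n)) (e : ℕ) (ν : PMF (State n × ℝ)) :
    Prop where
  hist : ∀ p ∈ ν.support, p.1.hist = R
  expo : ∀ p ∈ ν.support, p.1.expo = e
  card_avail : ∀ p ∈ ν.support, p.1.avail.card + R.length = n
  card_imag : ∀ p ∈ ν.support, p.1.imag.card = p.1.avail.card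
  pastCost_le : ∀ p ∈ ν.support, pastCost s p.1.avail R ≤ p.2
  imag_law : ∀ F, expect ν (fun p => F p.1.imag) = expect (simulate s (10 ^ e) Finset.univ R) F
  opt_lt : optCost s R < 10 ^ e
  le_opt : e ≠ 0 → (10 : ℝ) ^ e ≤ 10 * optCost s R
  cost_le : expect ν (fun p => ENNReal.ofReal (p.2 + gap s p.1.imag p.1.avail))
    ≤ simCost s (10 ^ e) Finset.univ R +
      if e = 0 then 0 else ENNReal.ofReal (6 * (1000 * Real.log n * 10 ^ e))

lemma invariant_init (s : Fin n → ℝ) :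
    Invariant s [] 0 (PMF.pure (initState n, 0)) := by
  have hopt : optCost s [] ≤ 0 := by
    obtain ⟨f, hf⟩ := exists_optCost_eq s (R := []) n.zero_le
    rw [← hf]
    simp
  refine ⟨?_, ?_, ?_, ?_, ?_, ?_, ?_, ?_, ?_⟩
  · simp [initState]
  · simp [initState]
  · simp [initState]
  · simp [initState]
  · simp [initState, pastCost_univ_nil]
  · simp [initState, expect_pure, simulate]
  · exact hopt.trans_lt (by positivity)
  · simp
  · simp [initState, expect_pure, simCost, gap, flowCost]

/-- By `correct_cost_le`, the cost plus `gap` grows at most by the length of the imaginary move. -/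
lemma Invariant.step_of_not_trigger (hs : StrictMono s) (h : Invariant s R e ν)
    (hR : R.length + 1 ≤ n) (hx : optCost s (R ++ [x]) < 10 ^ e) :
    Invariant s (R ++ [x]) e (ν.bind fun p => track s p x) := by
  have htrig : ∀ p ∈ ν.support, ¬ p.1.IsTrigger s x := fun p hp => by
    unfold State.IsTrigger State.est
    rw [h.hist p hp, h.expo p hp]
    exact hx.not_ge
  have himag : ∀ p ∈ ν.support, p.1.imag.Nonempty ∧ p.1.avail.Nonempty := fun p hp => by
    have h1 := h.card_avail p hp
    have h2 := h.card_imag p hp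
    exact ⟨Finset.card_pos.1 (by omega), Finset.card_pos.1 (by omega)⟩
  have hsupp : ∀ p' ∈ (ν.bind fun p => track s p x).support, ∃ p ∈ ν.support,
      ∃ g ∈ p.1.imag, p' = (⟨p.1.hist ++ [x], p.1.expo, p.1.imag.erase g,
          p.1.avail.erase (p.1.correct s x g)⟩, p.2 + |s x - s (p.1.correct s x g)|) := by
    intro p' hp'
    rw [PMF.mem_support_bind_iff] at hp'
    obtain ⟨p, hp, hp'⟩ := hp'
    obtain ⟨g, hg, rfl⟩ := mem_support_track_of_not_trigger (htrig p hp) hp'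
    exact ⟨p, hp, g, mem_of_mem_support_imagMove (himag p hp).1 hg, rfl⟩
  have hest : ∀ p ∈ ν.support, p.1.est = 10 ^ e := fun p hp => by
    unfold State.est
    rw [h.expo p hp]
  refine ⟨?_, ?_, ?_, ?_, ?_, ?_, hx, ?_, ?_⟩
  · intro p' hp'
    obtain ⟨p, hp, g, hg, rfl⟩ := hsupp p' hp'
    rw [h.hist p hp]
  · intro p' hp'
    obtain ⟨p, hp, g, hg, rfl⟩ := hsupp p' hp'
    exact h.expo p hp
  · intro p' hp'
    obtain ⟨p, hp, g, hg, rfl⟩ := hsupp p' hp'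
    have h1 := h.card_avail p hp
    have h2 := (himag p hp).2.card_pos
    rw [Finset.card_erase_of_mem (correct_mem_avail (himag p hp).2), List.length_append,
      List.length_singleton]
    omega
  · intro p' hp'
    obtain ⟨p, hp, g, hg, rfl⟩ := hsupp p' hp'
    rw [Finset.card_erase_of_mem (correct_mem_avail (himag p hp).2),
      Finset.card_erase_of_mem hg, h.card_imag p hp]
  · intro p' hp'
    obtain ⟨p, hp, g, hg, rfl⟩ := hsupp p' hp'
    exact (pastCost_append_le hs (correct_mem_avail (himag p hp).2)).trans
      (add_le_add_left (h.pastCost_le p hp) _)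
  · intro F
    rw [expect_bind, simulate_append, expect_bind, ← h.imag_law]
    refine expect_congr fun p hp => ?_
    rw [expect_track_of_not_trigger (htrig p hp), expect_map, hest p hp]
  · intro he
    exact (h.le_opt he).trans
      (mul_le_mul_of_nonneg_left (optCost_le_append s x hR) (by norm_num))
  · rw [simCost_append, add_right_comm, expect_bind]
    refine le_trans ?_ (add_le_add_left h.cost_le _)
    rw [← h.imag_law, ← expect_add]
    refine expect_mono fun p hp => ?_
    rw [expect_track_of_not_trigger (htrig p hp), hest p hp,
      ← expect_const (imagMove s (10 ^ e) p.1.imag x)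
        (ENNReal.ofReal (p.2 + gap s p.1.imag p.1.avail)), ← expect_add]
    refine expect_mono fun g hg => ?_
    have hp2 := (pastCost_nonneg hs _ _).trans (h.pastCost_le p hp)
    have := correct_cost_le (x := x) hs (h.card_imag p hp)
      (mem_of_mem_support_imagMove (himag p hp).1 hg)
    rw [← ENNReal.ofReal_add (add_nonneg hp2 (gap_nonneg hs _ _)) (abs_nonneg _)]
    exact ENNReal.ofReal_le_ofReal (by simp only; linarith)

/-- Before a triggering request, the probes at points that are not trigger points are cheap. -/
lemma Invariant.expect_probeCosts_le (hs : StrictMono s) (hn : 2 ≤ n) (h : Invariant s R e ν)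
    (hR : R.length + 1 ≤ n) (x : Fin n) :
    expect ν (fun p => probeCosts s p.1 x)
      ≤ 2 * ENNReal.ofReal (1000 * Real.log n * 10 ^ e) := by
  classical
  set N : Finset (Fin n) := Finset.univ.filter fun y => ¬ 10 ^ e ≤ optCost s (R ++ [y]) with hN
  have hnon : ∀ p ∈ ν.support, p.1.nontriggers s = N := fun p hp => by
    ext y
    simp [State.nontriggers, hN, State.IsTrigger, State.est, h.hist p hp, h.expo p hp]
  have hone : ∀ y ∈ N, expect ν (fun p => probeCost s p.1 y)
      ≤ ENNReal.ofReal (1000 * Real.log n * 10 ^ e) := by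
    intro y hy
    have hy' : optCost s (R ++ [y]) < 10 ^ e := by simpa [hN] using hy
    refine le_trans ?_ (simCost_le hs hn (by positivity) (by simpa using hR) hy').1
    rw [simCost_append, ← h.imag_law]
    refine le_add_left (le_of_eq (expect_congr fun p hp => ?_))
    unfold probeCost State.est
    rw [h.expo p hp]
  have hsplit : expect ν (fun p => probeCosts s p.1 x)
      = expect ν (fun p => (leftNbr N x).elim 0 (probeCost s p.1))
        + expect ν fun p => (rightNbr N x).elim 0 (probeCost s p.1) := by
    rw [← expect_add]
    refine expect_congr fun p hp => ?_
    unfold probeCosts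
    rw [hnon p hp]
  rw [hsplit, two_mul]
  refine add_le_add ?_ ?_
  · rcases hl : leftNbr N x with _ | y
    · simp [expect_const]
    · exact hone y (leftNbr_eq_some.1 hl).1
  · rcases hr : rightNbr N x with _ | y
    · simp [expect_const]
    · exact hone y (rightNbr_eq_some.1 hr).1

lemma one_le_mul_log (hn : 2 ≤ n) : 1 ≤ 1000 * Real.log n := by
  have h1 : Real.log 2 ≤ Real.log n := Real.log_le_log (by norm_num) (by exact_mod_cast hn)
  have := Real.log_two_gt_d9
  linarith

/-- With `B = 1000 * log n`, the expected cost plus `gap` is at most `7 * B * 10 ^ e` before a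
triggering request.  The request multiplies this by a constant and adds terms of the order of the
new estimate `10 ^ e' ≥ 10 * 10 ^ e`, and the constant `6` in `Invariant` is large enough to absorb
the result. -/
lemma Invariant.step_of_trigger (hs : StrictMono s) (hn : 2 ≤ n) (h : Invariant s R e ν)
    (hR : R.length + 1 ≤ n) (hx : 10 ^ e ≤ optCost s (R ++ [x])) :
    ∃ e', Invariant s (R ++ [x]) e' (ν.bind fun p => track s p x) := by
  have htrig : ∀ p ∈ ν.support, p.1.IsTrigger s x := fun p hp => by
    unfold State.IsTrigger State.est
    rw [h.hist p hp, h.expo p hp]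
    exact hx
  have havail : ∀ p ∈ ν.support, p.1.avail.Nonempty := fun p hp => by
    have h1 := h.card_avail p hp
    exact Finset.card_pos.1 (by omega)
  obtain ⟨hopt, hlt, hle⟩ := sInf_pow_spec hx
  set e' := sInf {j : ℕ | optCost s (R ++ [x]) < 10 ^ j}
  have hRx : (R ++ [x]).length ≤ n := by simpa using hR
  have hsupp : ∀ p' ∈ (ν.bind fun p => track s p x).support, ∃ p ∈ ν.support,
      ∃ σ ∈ p.1.avail, ∃ I ∈ (simulate s (10 ^ e') Finset.univ (R ++ [x])).support,
        p' = (⟨R ++ [x], e', I, p.1.avail.erase σ⟩, p.2 + |s x - s σ|) := by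
    intro p' hp'
    rw [PMF.mem_support_bind_iff] at hp'
    obtain ⟨p, hp, hp'⟩ := hp'
    obtain ⟨σ, hσ, I, hI, rfl⟩ := mem_support_track_of_trigger (htrig p hp) hp'
    rw [h.hist p hp] at hI ⊢
    exact ⟨p, hp, σ, trigAssign_mem_avail (havail p hp) hσ, I, hI, rfl⟩
  have hexp : ∀ F : State n × ℝ → ℝ≥0∞, expect (ν.bind fun p => track s p x) F
      = expect ν fun p => expect (p.1.trigAssign s x) fun σ =>
        expect (simulate s (10 ^ e') Finset.univ (R ++ [x])) fun I =>
          F (⟨R ++ [x], e', I, p.1.avail.erase σ⟩, p.2 + |s x - s σ|) := by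
    intro F
    rw [expect_bind]
    refine expect_congr fun p hp => ?_
    rw [expect_track_of_trigger (htrig p hp), h.hist p hp]
  have hcost0 : ∀ p ∈ ν.support, 0 ≤ p.2 := fun p hp =>
    (pastCost_nonneg hs _ _).trans (h.pastCost_le p hp)
  refine ⟨e', ?_, ?_, ?_, ?_, ?_, ?_, hopt, fun _ => hle, ?_⟩
  · intro p' hp'
    obtain ⟨p, hp, σ, hσ, I, hI, rfl⟩ := hsupp p' hp'
    rfl
  · intro p' hp'
    obtain ⟨p, hp, σ, hσ, I, hI, rfl⟩ := hsupp p' hp'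
    rfl
  · intro p' hp'
    obtain ⟨p, hp, σ, hσ, I, hI, rfl⟩ := hsupp p' hp'
    have h1 := h.card_avail p hp
    have h2 := (havail p hp).card_pos
    rw [Finset.card_erase_of_mem hσ, List.length_append, List.length_singleton]
    omega
  · intro p' hp'
    obtain ⟨p, hp, σ, hσ, I, hI, rfl⟩ := hsupp p' hp'
    have h1 := h.card_avail p hp
    have h3 := card_of_mem_simulate hRx hI
    rw [List.length_append, List.length_singleton] at h3
    rw [Finset.card_erase_of_mem hσ]
    simp only
    omega
  · intro p' hp'
    obtain ⟨p, hp, σ, hσ, I, hI, rfl⟩ := hsupp p' hp'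
    exact (pastCost_append_le hs hσ).trans (add_le_add_left (h.pastCost_le p hp) _)
  · intro F
    rw [hexp]
    simp only [expect_const]
  · rw [hexp, if_neg (by omega)]
    set B := 1000 * Real.log n
    have hB : 1 ≤ B := one_le_mul_log hn
    have hZ : (0 : ℝ) < 10 ^ e := by positivity
    have hZ' : (10 : ℝ) * 10 ^ e ≤ 10 ^ e' := by
      rw [← pow_succ']
      exact pow_le_pow_right₀ (by norm_num) hlt
    -- The fresh imaginary servers are compared to the available ones through the requests.
    have h1 : (expect ν fun p => expect (p.1.trigAssign s x) fun σ =>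
        expect (simulate s (10 ^ e') Finset.univ (R ++ [x])) fun I =>
          ENNReal.ofReal (p.2 + |s x - s σ| + gap s I (p.1.avail.erase σ)))
        ≤ 2 * (expect ν fun p => expect (p.1.trigAssign s x) fun σ =>
            ENNReal.ofReal (p.2 + |s x - s σ|)) + simCost s (10 ^ e') Finset.univ (R ++ [x]) := by
      refine le_trans ?_ (add_le_add_right (expect_pastCost_simulate_le hs hRx) _)
      obtain ⟨E, hE⟩ : ∃ E, E = expect (simulate s (10 ^ e') Finset.univ (R ++ [x]))
        fun I => ENNReal.ofReal (pastCost s I (R ++ [x])) := ⟨_, rfl⟩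
      rw [← hE, ← expect_const_mul, ← expect_const ν E, ← expect_add]
      refine expect_mono fun p hp => ?_
      rw [← expect_const_mul, ← expect_const (p.1.trigAssign s x) E, ← expect_add]
      refine expect_mono fun σ hσ => ?_
      have hσ' := trigAssign_mem_avail (havail p hp) hσ
      rw [hE, ← expect_const (simulate s (10 ^ e') Finset.univ (R ++ [x])) (2 * _), ← expect_add]
      refine expect_mono fun I hI => ?_
      have h2 := gap_le_pastCost hs I (p.1.avail.erase σ) (R ++ [x])
      have h3 := pastCost_append_le (R := R) (x := x) hs hσ'
      have h4 := h.pastCost_le p hp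
      have h5 := pastCost_nonneg hs I (R ++ [x])
      have h6 := hcost0 p hp
      have h7 := abs_nonneg (s x - s σ)
      rw [two_mul, ← ENNReal.ofReal_add (by linarith) (by linarith),
        ← ENNReal.ofReal_add (by linarith) h5]
      exact ENNReal.ofReal_le_ofReal (by linarith)
    have h2 : (expect ν fun p => expect (p.1.trigAssign s x) fun σ =>
        ENNReal.ofReal (p.2 + |s x - s σ|))
        ≤ 2 * expect ν (fun p => ENNReal.ofReal (p.2 + gap s p.1.imag p.1.avail))
          + 2 * expect ν (fun p => probeCosts s p.1 x) + ENNReal.ofReal (10 ^ e') := by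
      rw [← expect_const_mul, ← expect_const_mul, ← expect_add,
        ← expect_const ν (ENNReal.ofReal (10 ^ e')), ← expect_add]
      refine expect_mono fun p hp => ?_
      have hp0 := hcost0 p hp
      have hg0 := gap_nonneg hs p.1.imag p.1.avail
      have hlen : p.1.avail.card + p.1.hist.length = n := by
        rw [h.hist p hp]
        exact h.card_avail p hp
      have h3 := expect_trigAssign_le hs (h.card_imag p hp) hlen (havail p hp) x
      rw [h.hist p hp] at h3
      have h4 : (expect (p.1.trigAssign s x) fun σ => ENNReal.ofReal (p.2 + |s x - s σ|))
          = ENNReal.ofReal p.2 + expect (p.1.trigAssign s x) fun σ =>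
            ENNReal.ofReal |s x - s σ| := by
        rw [← expect_const (p.1.trigAssign s x) (ENNReal.ofReal p.2), ← expect_add]
        refine expect_congr fun σ _ => ?_
        rw [← ENNReal.ofReal_add hp0 (abs_nonneg _)]
      rw [h4]
      refine (add_le_add_right h3 _).trans ?_
      have h5 : ENNReal.ofReal (optCost s (R ++ [x]) + pastCost s p.1.avail R)
          ≤ ENNReal.ofReal p.2 + ENNReal.ofReal (10 ^ e') := by
        rw [← ENNReal.ofReal_add hp0 (by positivity)]
        exact ENNReal.ofReal_le_ofReal (by linarith [h.pastCost_le p hp])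
      refine (add_le_add_right (add_le_add_right h5 _) _).trans (le_of_eq ?_)
      rw [ENNReal.ofReal_add hp0 hg0]
      ring
    have h3 : expect ν (fun p => ENNReal.ofReal (p.2 + gap s p.1.imag p.1.avail))
        ≤ ENNReal.ofReal (7 * (B * 10 ^ e)) := by
      have h4 := (simCost_le hs hn hZ (by omega) h.opt_lt).1
      refine h.cost_le.trans ((add_le_add h4 (c := _) (d := ENNReal.ofReal (6 * (B * 10 ^ e)))
        (by split_ifs <;> simp [B])).trans (le_of_eq ?_))
      rw [← ENNReal.ofReal_add (by positivity) (by positivity)]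
      congr 1
      ring
    have h4 := h.expect_probeCosts_le hs hn hR x
    refine h1.trans ?_
    rw [add_comm]
    gcongr
    have hp1 : 0 ≤ B * 10 ^ e := by positivity
    have hp2 : (0:ℝ) ≤ 10 ^ e' := by positivity
    calc _ ≤ 2 * (2 * ENNReal.ofReal (7 * (B * 10 ^ e))
          + 2 * (2 * ENNReal.ofReal (B * 10 ^ e)) + ENNReal.ofReal (10 ^ e')) := by
          refine mul_le_mul_right (h2.trans ?_) _
          gcongr
      _ = ENNReal.ofReal (2 * (2 * (7 * (B * 10 ^ e)) + 2 * (2 * (B * 10 ^ e)) + 10 ^ e')) := by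
          have two : (2 : ℝ≥0∞) = ENNReal.ofReal 2 := by simp
          rw [two]
          repeat rw [← ENNReal.ofReal_mul (by norm_num)]
          rw [← ENNReal.ofReal_add (by positivity) (by positivity),
            ← ENNReal.ofReal_add (by positivity) (by positivity),
            ← ENNReal.ofReal_mul (by norm_num)]
      _ ≤ ENNReal.ofReal (6 * (B * 10 ^ e')) := by
          refine ENNReal.ofReal_le_ofReal ?_
          have h5 : B * (10 * 10 ^ e) ≤ B * 10 ^ e' := mul_le_mul_of_nonneg_left hZ' (by linarith)
          have h6 : 1 * 10 ^ e' ≤ B * 10 ^ e' := mul_le_mul_of_nonneg_right hB hp2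
          linarith

lemma exists_invariant (hs : StrictMono s) (hn : 2 ≤ n) (hR : R.length ≤ n) :
    ∃ e, Invariant s R e (trackAll s (initState n, 0) R) := by
  induction R using List.reverseRecOn with
  | nil => exact ⟨0, invariant_init s⟩
  | append_singleton R x ih =>
    rw [List.length_append, List.length_singleton] at hR
    obtain ⟨e, he⟩ := ih (by omega)
    rw [trackAll_append]
    rcases lt_or_ge (optCost s (R ++ [x])) (10 ^ e) with hx | hx
    · exact ⟨e, he.step_of_not_trigger hs hR hx⟩
    · exact he.step_of_trigger hs hn hR hx

lemma mdhExpCost_eq (s : Fin n → ℝ) (R : List (Fin n)) :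
    mdhExpCost s R = expect (trackAll s (initState n, 0) R) fun p => ENNReal.ofReal p.2 := by
  rw [← expect_run]
  simp [mdhExpCost, mdh, expect]

lemma mdhExpCost_le (hs : ∀ i j : Fin n, i < j → 1 ≤ s j - s i) (hn : 2 ≤ n)
    (hR : R.length ≤ n) :
    mdhExpCost s R ≤ ENNReal.ofReal (70000 * Real.log n * optCost s R) := by
  have hmono : StrictMono s := fun i j hij => by linarith [hs i j hij]
  obtain ⟨e, h⟩ := exists_invariant hmono hn hR
  have hB := one_le_mul_log hn
  obtain ⟨h2, h3⟩ := simCost_le hmono hn (by positivity) hR h.opt_lt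
  rw [mdhExpCost_eq]
  have h1 : expect (trackAll s (initState n, 0) R) (fun p => ENNReal.ofReal p.2)
      ≤ simCost s (10 ^ e) Finset.univ R +
        if e = 0 then 0 else ENNReal.ofReal (6 * (1000 * Real.log n * 10 ^ e)) :=
    (expect_mono fun p _ => ENNReal.ofReal_le_ofReal
      (by linarith [gap_nonneg hmono p.1.imag p.1.avail])).trans h.cost_le
  refine h1.trans ?_
  by_cases he : e = 0
  · -- The optimal cost is below the initial estimate, hence zero.
    have h4 : optCost s R = 0 := optCost_eq_zero hs hR (by simpa [he] using h.opt_lt)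
    rw [if_pos he, h3 h4]
    simp
  · rw [if_neg he]
    refine (add_le_add_left h2 _).trans ?_
    rw [← ENNReal.ofReal_add (by positivity) (by positivity)]
    refine ENNReal.ofReal_le_ofReal ?_
    have := mul_le_mul_of_nonneg_left (h.le_opt he) (show 0 ≤ 1000 * Real.log n by linarith)
    linarith

lemma assignCost_eq_zero (hn : n ≤ 1) (s : Fin n → ℝ) (R l : List (Fin n)) :
    assignCost s R l = 0 := by
  have : Subsingleton (Fin n) := Fin.subsingleton_iff_le_one.2 hn
  unfold assignCost
  induction R generalizing l with
  | nil => simp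
  | cons x R ih =>
    cases l with
    | nil => simp
    | cons y l =>
      rw [List.zipWith_cons_cons, List.sum_cons, ih, Subsingleton.elim x y]
      simp

end amortization

end LineMatching

theorem theorem2 :
    ∃ C : ℝ, 0 < C ∧ ∀ (n : ℕ) (s : Fin n → ℝ), (∀ i j : Fin n, i < j → 1 ≤ s j - s i) →
      ∀ r : Fin n → Fin n,
        (∀ l ∈ (LineMatching.mdh s (List.ofFn r)).support, l.length = n ∧ l.Nodup) ∧
        LineMatching.mdhExpCost s (List.ofFn r) ≤
          ENNReal.ofReal (C * Real.log n * LineMatching.optCost s (List.ofFn r)) := by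
  refine ⟨70000, by norm_num, fun n s hs r => ⟨fun l hl => ?_, ?_⟩⟩
  · have h := LineMatching.length_nodup_of_mem_run (LineMatching.initState n)
      (by simp [LineMatching.initState]) hl
    exact ⟨by simpa using h.1, h.2.1⟩
  · rcases Nat.lt_or_ge n 2 with hn | hn
    · -- There is at most one server, and every cost is zero.
      simp [LineMatching.mdhExpCost, LineMatching.assignCost_eq_zero (Nat.lt_succ_iff.1 hn)]
    · exact LineMatching.mdhExpCost_le hs hn (by simp)
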